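/- **Conventions.** Let $q=e^{h}$ with $h\in\mathbb C$, where either $h=0$ (so $q=1$) or $q$ is not a root of unity (for instance, any real $q>0$), and let $q^{x}=e^{hx}$. Put $[x]=(q^{x}-q^{-x})/(q-q^{-1})$ (and $[x]=x$ if $h=0$) and $[n]!=[n][n-1]\cdots[1]$, $[0]!=1$, with $1/[n]!=0$ for integers $n<0$. Square roots of $q$-numbers are principal, and the square root of a quotient of products of $q$-factorials and $q$-numbers is the corresponding quotient of products of the roots $[k]^{1/2}$ (the positive root if $q>0$). Let $$\nabla[abc]=\left(\frac{[a+b-c]!\,[a-b+c]!\,[a+b+c+1]!}{[b+c-a]!}\right)^{1/2},\qquad Z_{ab\ldots c}=-a(a+1)-b(b+1)-\ldots-c(c+1).$$ Angular momenta are elements of $\{0,\frac12,1,\frac32,\ldots\}$; $(a,b,c)$ is *triangular* if $a+b+c\in\mathbb Z$ and $|a-b|\le c\le a+b$. The $q$-$6j$ coefficient is $$\left\{\begin{array}{ccc}a&b&e\\d&c&f\end{array}\right\}_q=\frac{\nabla[acf]\nabla[dbf]}{\nabla[abe]\nabla[dce]}\sum_z\frac{(-1)^{a+b+c+d+z}[c+f-a+z]!\,[b+f-d+z]!\,[a+d+e-f-z]!}{[z]!\,[a+c-f-z]!\,[b+d-f-z]!\,[e+f-a-d+z]!\,[2f+z+1]!}$$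 if $(a,b,e),(a,c,f),(d,b,f),(d,c,e)$ are triangular, and $0$ otherwise. The $q$-$9j$ coefficient is $$\left\{\begin{array}{ccc}a&b&e\\c&d&f\\r&k&g\end{array}\right\}_q=\sum_j(-1)^{2j}q^{Z_{der}-j(j+1)}[2j+1]\left\{\begin{array}{ccc}a&c&r\\k&g&j\end{array}\right\}_q\left\{\begin{array}{ccc}k&j&c\\f&d&b\end{array}\right\}_q\left\{\begin{array}{ccc}a&g&j\\f&b&e\end{array}\right\}_q ,$$ and the $q$-$12j$ coefficient of the first kind is $$\left\{\begin{array}{cccccccc}j_1&&j_2&&j_3&&j_4&\\&l_1&&l_2&&l_3&&l_4\\k_1&&k_2&&k_3&&k_4&\end{array}\right\}_q=\sum_x[2x+1](-1)^{R_4-x}q^{x(x+1)+Z_{j_1j_2j_3j_4}+Z_{k_1k_2k_3k_4}}$$ $$\times\left\{\begin{array}{ccc}j_1&j_2&l_1\\k_2&k_1&x\end{array}\right\}_q\left\{\begin{array}{ccc}j_3&k_3&x\\k_2&j_2&l_2\end{array}\right\}_q\left\{\begin{array}{ccc}j_3&j_4&l_3\\k_4&k_3&x\end{array}\right\}_q\left\{\begin{array}{ccc}k_1&j_1&x\\k_4&j_4&l_4\end{array}\right\}_q,\qquad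 R_4=\sum_{i=1}^4(j_i+l_i+k_i),$$ with $j,x$ running over $0,\frac12,1,\ldots$. A subscript $q^{-1}$ means that $h$ is replaced by $-h$. Wherever a $q$-$6j$ or $q$-$9j$ coefficient on a right-hand side is zero because one of its triangular conditions fails, that right-hand side is read as $0$. **Theorem.** Let $j_i,l_i,k_i$ ($1\le i\le4$) be angular momenta such that $(l_i,j_i,j_{i+1})$, $(l_i,k_i,k_{i+1})$ ($i=1,2,3$), $(l_4,j_1,k_4)$ and $(l_4,k_1,j_4)$ are triangular, and let $T$ be the above $q$-$12j$ coefficient of the first kind. (1) If $l_4=k_4+j_1$, then $$T=(-1)^{k_1+k_2-k_3-j_2+j_3+j_4-l_4}\frac{\nabla[j_3j_2l_2]\nabla[k_2k_3l_2]\nabla[l_4j_4k_1]}{\nabla[j_1j_2l_1]\nabla[k_2k_1l_1]\nabla[j_3j_4l_3]\nabla[k_4k_3l_3]}\left(\frac{[2k_4]!\,[2j_1]!}{[2l_4+1]!}\right)^{1/2}$$ $$\times q^{-(j_1+k_2-l_1+1)(k_4-k_2+l_2-l_3)-(l_2-k_2-j_3-1)(j_3+k_4-l_3)+Z_{j_1j_2j_3j_4}+Z_{k_1k_2k_3k_4}}$$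 $$\times\sum_{z_1,z_2,z_3\ge0}\frac{(-1)^{z_1+z_3}[j_1+j_2-l_1+z_1]!\,[k_1+k_2-l_1+z_1]!\,[2l_1-z_1]!}{[z_1]!\,[z_2]!\,[z_3]!\,[k_1-k_2+l_1-z_1]!\,[l_1-j_1+j_2-z_1]!}$$ $$\times\frac{[l_2+j_2-j_3+z_2]!\,[l_2+k_3-k_2+z_2]!}{[j_2+j_3-l_2-z_2]!\,[k_2+k_3-l_2-z_2]!\,[2l_2+z_2+1]!}\cdot\frac{[k_3+k_4-l_3+z_3]!\,[j_3+j_4-l_3+z_3]!\,[2l_3-z_3]!}{[k_3+l_3-k_4-z_3]!\,[l_3-j_3+j_4-z_3]!\,[j_1-j_3-l_1+l_2+z_1+z_2]!}$$ $$\times\frac{q^{z_3(l_1-l_2-j_1+j_3)-z_2(j_3+k_2-l_1-l_3+l_4+z_3+1)-z_1(l_2-l_3-k_2+k_4+z_2+z_3)}}{[l_2-l_3-k_2+k_4+z_2+z_3]!\,[j_3+k_2-l_1-l_3+l_4+z_1+z_3+1]!}.$$ (2) If $k_4=l_4+j_1$, then $$T=(-1)^{j_3+j_4-l_3+l_2+k_2-k_3}\frac{\nabla[j_3j_4l_3]\nabla[k_4k_3l_3]\nabla[k_2k_3l_2]}{\nabla[j_1j_2l_1]\nabla[k_2k_1l_1]\nabla[j_3j_2l_2]\nabla[l_4k_1j_4]}\left(\frac{[2j_1]!\,[2l_4]!}{[2k_4+1]!}\right)^{1/2}$$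 $$\times q^{(j_1+k_2-l_1+1)(k_2+k_4+l_2-l_3+1)-(l_2+k_2-j_3+1)(j_3-l_3+k_4+1)+Z_{j_1j_2j_3j_4}+Z_{k_1k_2k_3k_4}}$$ $$\times\sum_{z_1,z_2,z_3\ge0}\frac{[j_1+j_2-l_1+z_1]!\,[k_1+k_2-l_1+z_1]!\,[2l_1-z_1]!}{[z_1]!\,[z_2]!\,[z_3]!\,[k_1-k_2+l_1-z_1]!\,[l_1-j_1+j_2-z_1]!}$$ $$\times\frac{(-1)^{z_1+z_2+z_3}[j_2+j_3-l_2+z_2]!\,[2l_2-z_2]!}{[l_2+k_2-k_3-z_2]!\,[j_2-j_3+l_2-z_2]!\,[l_2+k_2+k_3-z_2+1]!}$$ $$\times\frac{q^{z_1(k_2+k_4+l_2-l_3-z_2-z_3+1)}[k_3-k_4+l_3+z_3]!\,[j_4-j_3+l_3+z_3]!}{[k_3+k_4-l_3-z_3]!\,[j_3+j_4-l_3-z_3]!\,[2l_3+z_3+1]!}$$ $$\times\frac{q^{-z_2(k_2-j_3-l_1+l_3-l_4+z_3)-z_3(j_1+j_3-l_1-l_2)}[k_2+k_4+l_2-l_3-z_2-z_3]!}{[j_1+j_3-l_1-l_2+z_1+z_2]!\,[k_2-j_3-l_1+l_3-l_4+z_1+z_3]!}.$$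 (3) If $k_4=l_4+j_1$ and $j_1=l_1+j_2$, then $$T=(-1)^{j_3+j_4-l_3+l_2+k_2-k_3}q^{Z_{j_1j_2j_3j_4}+Z_{k_1k_2k_3k_4}+Z_{l_2,l_3,l_1+l_4}}\frac{\nabla[l_1+l_4,j_4,k_2]}{\nabla[l_1k_1k_2]\nabla[l_4k_1j_4]}$$ $$\times\left(\frac{[2l_1]!\,[2l_4]!}{[2l_1+2l_4]!\,[2j_1+1]}\right)^{1/2}\left\{\begin{array}{ccc}k_4&k_3&l_3\\j_2&l_2&j_3\\l_1+l_4&k_2&j_4\end{array}\right\}_{q^{-1}}.$$ (4) If $k_4=l_4+j_1$ and $l_3=k_3+k_4$, then $$T=(-1)^{j_3+j_4-l_4-l_2-k_2-j_2-l_1}q^{Z_{j_1j_2j_3j_4}+Z_{k_1k_2k_3k_4}+Z_{l_2,j_1+k_3,l_1}}\frac{\nabla[l_3j_3j_4]}{\nabla[l_4k_1j_4]\nabla[j_1+k_3,j_3,k_1]}$$ $$\times\left(\frac{[2l_4]!\,[2j_1+2k_3+1]!}{[2l_3+1]!\,[2k_4+1]}\right)^{1/2}\left\{\begin{array}{ccc}j_1&k_3&j_1+k_3\\j_2&l_2&j_3\\l_1&k_2&k_1\end{array}\right\}_{q^{-1}}.$$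 (5) If $l_1=j_1+j_2$ and $k_2=k_1+l_1$, then $$T=(-1)^{k_1+j_3-l_3-l_4+2k_3}\frac{q^{2j_1k_1+Z_{j_2j_3j_4}+Z_{k_2k_3k_4}}\nabla[k_2k_3l_2]\nabla[k_1+j_1,j_4,k_4]}{\nabla[j_1k_4l_4]\nabla[j_2l_2j_3]\nabla[k_1j_4l_4]\nabla[k_1+j_1,j_3,k_3]}$$ $$\times\left(\frac{[2j_2]!\,[2j_1]!\,[2k_1]!}{[2k_2+1]!\,[2l_1+1]}\right)^{1/2}\left\{\begin{array}{ccc}j_3&j_4&l_3\\k_4&k_3&k_1+j_1\end{array}\right\}_q.$$ (6) If $j_3=j_1+k_1+k_3$, then $$T=(-1)^{j_2+j_4-l_1-k_1-j_1-l_4}\frac{q^{2j_1k_1+Z_{j_2j_3j_4}+Z_{k_2k_3k_4}}[2j_1]!\,[2k_1]!\,[2k_3]!\,\nabla[j_3j_4l_3]\nabla[j_3j_2l_2]}{[2j_3+1]!\,\nabla[j_1j_2l_1]\nabla[k_1k_2l_1]\nabla[j_1k_4l_4]\nabla[k_1j_4l_4]\nabla[k_3k_2l_2]\nabla[k_3k_4l_3]}.$$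 -/

import Mathlib

noncomputable section

namespace QuantumU2

/-!
The deformation parameter is `q = exp h` with `h` complex; fractional powers of `q` are read as
`q ^ x = exp (h * x)`, and `q⁻¹` corresponds to `-h`.  Real `h` gives all real `q > 0`.
Angular momenta are rational numbers; `IsSpin` singles out the non-negative half-integers.
-/

/-- The power `q ^ x`, where `q = exp h`. -/
def qpow (h : ℂ) (x : ℚ) : ℂ := Complex.exp (h * (x : ℂ))

/-- `q = exp h` is generic: either `q = 1` (the classical case `h = 0`), or `q` is not a root
of unity. -/
def Generic (h : ℂ) : Prop := h = 0 ∨ ∀ n : ℕ, 1 ≤ n → qpow h n ≠ 1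

open Classical in
/-- The `q`-number `[x] = (q ^ x - q ^ (-x)) / (q - q⁻¹)`, with `[x] = x` for `q = 1`. -/
def qnum (h : ℂ) (x : ℚ) : ℂ :=
  if h = 0 then (x : ℂ) else (qpow h x - qpow h (-x)) / (qpow h 1 - qpow h (-1))

/-- The `q`-factorial `[x]! = [1] [2] ⋯ [x]` of an integer `x ≥ 0`. -/
def qfact (h : ℂ) (x : ℚ) : ℂ := ∏ k ∈ Finset.Icc 1 ⌊x⌋₊, qnum h k

/-- The reciprocal `1 / [x]!`, which is `0` for a negative integer `x`.  This is what restricts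
the summation intervals. -/
def rfact (h : ℂ) (x : ℚ) : ℂ := if x < 0 then 0 else (qfact h x)⁻¹

/-- The principal square root `[x] ^ (1/2)`. -/
def qsqrt (h : ℂ) (x : ℚ) : ℂ := (qnum h x) ^ (1 / 2 : ℂ)

/-- The square root `([x]!) ^ (1/2) = [1] ^ (1/2) [2] ^ (1/2) ⋯ [x] ^ (1/2)`, which is the positive
one when `q > 0`.  The square root of a quotient of products of `q`-factorials and `q`-numbers is
formed from these. -/
def sfact (h : ℂ) (x : ℚ) : ℂ := ∏ k ∈ Finset.Icc 1 ⌊x⌋₊, qsqrt h k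

/-- The asymmetric triangle coefficient
`∇[a b c] = ([a+b-c]! [a-b+c]! [a+b+c+1]! / [b+c-a]!) ^ (1/2)`. -/
def nabla (h : ℂ) (a b c : ℚ) : ℂ :=
  sfact h (a + b - c) * sfact h (a - b + c) * sfact h (a + b + c + 1) / sfact h (b + c - a)

/-- The sign `(-1) ^ x` of an integer `x`. -/
def sgn (x : ℚ) : ℂ := (-1 : ℂ) ^ ⌊x⌋

/-- `Z_{a b … c} = - a (a+1) - b (b+1) - … - c (c+1)`. -/
def Z (l : List ℚ) : ℚ := -(l.map fun j => j * (j + 1)).sum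

/-- `j` is one of `0, 1/2, 1, 3/2, …`. -/
def IsSpin (j : ℚ) : Prop := ∃ n : ℕ, j = n / 2

/-- The triangular condition for the angular momenta `a, b, c`. -/
def Triangle (a b c : ℚ) : Prop :=
  IsSpin a ∧ IsSpin b ∧ IsSpin c ∧ (∃ n : ℤ, a + b + c = n) ∧ |a - b| ≤ c ∧ c ≤ a + b

open Classical in
/-- The `q`-`6j` coefficient `{a b e; d c f}_q` (first row `a b e`, second row `d c f`).
It is zero when a triangular condition fails. -/
def sixJ (h : ℂ) (a b e d c f : ℚ) : ℂ :=
  if Triangle a b e ∧ Triangle a c f ∧ Triangle d b f ∧ Triangle d c e then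
    nabla h a c f * nabla h d b f / (nabla h a b e * nabla h d c e) *
      ∑ z ∈ Finset.range (⌊a + c - f⌋₊ + 1),
        sgn (a + b + c + d + z) * qfact h (c + f - a + z) * rfact h z * rfact h (a + c - f - z) *
          rfact h (b + d - f - z) * qfact h (b + f - d + z) * qfact h (a + d + e - f - z) *
          rfact h (e + f - a - d + z) * rfact h (2 * f + z + 1)
  else 0

/-- The `q`-`9j` coefficient with rows `a b e`, `c d f`, `h' k g`.  The summation runs over
`j = 0, 1/2, 1, …`; only the `j` allowed by the triangular conditions contribute. -/
def nineJ (h : ℂ) (a b e c d f h' k g : ℚ) : ℂ :=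
  ∑ t ∈ Finset.range (⌊2 * (a + g)⌋₊ + 1),
    let j : ℚ := (t : ℚ) / 2
    sgn (2 * j) * qpow h (Z [d, e, h'] - j * (j + 1)) * qnum h (2 * j + 1) *
      sixJ h a c h' k g j * sixJ h k j c f d b * sixJ h a g j f b e

/-- The `q`-`12j` coefficient of the first kind, with rows `j₁ j₂ j₃ j₄`, `l₁ l₂ l₃ l₄`,
`k₁ k₂ k₃ k₄`.  The summation runs over `x = 0, 1/2, 1, …`; only the `x` allowed by the triangular
conditions contribute. -/
def twelveJ (h : ℂ) (j1 j2 j3 j4 l1 l2 l3 l4 k1 k2 k3 k4 : ℚ) : ℂ :=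
  ∑ t ∈ Finset.range (⌊2 * (j1 + k1)⌋₊ + 1),
    let x : ℚ := (t : ℚ) / 2
    qnum h (2 * x + 1) *
      sgn (j1 + j2 + j3 + j4 + l1 + l2 + l3 + l4 + k1 + k2 + k3 + k4 - x) *
      qpow h (x * (x + 1) + Z [j1, j2, j3, j4] + Z [k1, k2, k3, k4]) *
      sixJ h j1 j2 l1 k2 k1 x * sixJ h j3 k3 x k2 j2 l2 *
      sixJ h j3 j4 l3 k4 k3 x * sixJ h k1 j1 x k4 j4 l4

/-- The triangular conditions of the `12j` array of the first kind. -/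
def Admissible (j1 j2 j3 j4 l1 l2 l3 l4 k1 k2 k3 k4 : ℚ) : Prop :=
  Triangle l1 j1 j2 ∧ Triangle l2 j2 j3 ∧ Triangle l3 j3 j4 ∧ Triangle l4 j1 k4 ∧
    Triangle l1 k1 k2 ∧ Triangle l2 k2 k3 ∧ Triangle l3 k3 k4 ∧ Triangle l4 k1 j4

end QuantumU2

end

open QuantumU2

namespace QuantumU2

/-! ### `q`-numbers -/

/-! The foundation is hypergeometric. Sears' transformation of terminating balanced `₄φ₃` series
(`bal_sears`), which is the `q`-Saalschütz sum applied twice, identifies the `6j` coefficient of the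
definition with Racah's symmetric sum (`Tetra.sixJ_eq_racahJ`). This yields the tetrahedral
symmetries. It also yields a closed form whenever one spin of a triangle is the sum of the other
two, because the sum can then be arranged to have a single term (`sixJ_stretched`).

In the virtually stretched case, and in the case that reduces to a `6j` coefficient, two triangular
conditions pin the intermediate spin `x`, so one summand remains. In the two cases that reduce to a
`9j` coefficient, two of the four `6j` factors are stretched. Their product is, up to factors free
of `x`, a single stretched `6j`, and the `12j` and `9j` sums agree term by term. The weight
`q^{x(x+1)}` has the opposite sign in the `9j`, hence the passage to `q⁻¹`.

For the two triple sums, three `6j` factors are expanded in single sums, arranged so that the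
asymmetric `∇` factors containing `x` cancel around the cycle. What remains depends on `x` through
`[2x+1] q^{x(x+1)}`, a sign in the first case, and factors `eFun` and `gFun` governed by `λ_x =
[x][x+1]`. Since `λ_a - λ_x = [a-x][a+x+1]`, a unit shift of a parameter multiplies such a factor by
a linear polynomial in `λ_x`. The identity `(λ_B - λ_x) + (λ_x - λ_C) = λ_B - λ_C` then becomes a
recurrence that sums over `x` in closed form: `latSum_star` for one `gFun` and two `eFun`,
`latSum_star₂` for two `gFun` and one `eFun`.

The delicate point is that these sums run over a whole lattice, not only over the `x` allowed by the
triangles. For `k₄ = l₄ + j₁` the superfluous terms vanish by themselves (`twelveJ_eq_latSum`). For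
`l₄ = k₄ + j₁` the parameter of `gFun` may be negative, and the closed form is no longer literally a
sum. It is first extended to a functional on polynomials in `λ_x` (`starFun`). The polynomials
coming from the `6j` factors have enough zeros (`nodePoly_dvd_sixPoly`) to turn the functional back
into a sum over admissible spins (`starFun_mul_eq_latSum`). -/

theorem qpow_add (h : ℂ) (x y : ℚ) : qpow h (x + y) = qpow h x * qpow h y := by
  simp [qpow, mul_add, Complex.exp_add]

theorem qpow_neg (h : ℂ) (x : ℚ) : qpow h (-x) = (qpow h x)⁻¹ := by
  simp [qpow, Complex.exp_neg]

theorem qpow_sub (h : ℂ) (x y : ℚ) : qpow h (x - y) = qpow h x / qpow h y := by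
  rw [sub_eq_add_neg, qpow_add, qpow_neg, div_eq_mul_inv]

theorem qpow_ne_zero (h : ℂ) (x : ℚ) : qpow h x ≠ 0 := Complex.exp_ne_zero _

theorem qnum_of_ne {h : ℂ} (h0 : h ≠ 0) (x : ℚ) :
    qnum h x = (qpow h x - (qpow h x)⁻¹) / (qpow h 1 - qpow h (-1)) := by
  rw [qnum, if_neg h0, qpow_neg]

theorem qnum_zero_left (x : ℚ) : qnum 0 x = x := by simp [qnum]

theorem qnum_zero (h : ℂ) : qnum h 0 = 0 := by simp [qnum]

theorem qnum_neg (h : ℂ) (x : ℚ) : qnum h (-x) = -qnum h x := by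
  unfold qnum; split_ifs
  · simp
  · rw [neg_neg, ← neg_sub, neg_div]

theorem qnum_neg_left (h : ℂ) (x : ℚ) : qnum (-h) x = qnum h x := by
  unfold qnum
  by_cases h0 : h = 0
  · simp [h0]
  · have e : ∀ y, qpow (-h) y = qpow h (-y) := fun y => by simp [qpow]
    rw [if_neg (neg_ne_zero.2 h0), if_neg h0, e, e, e, e, neg_neg, neg_neg,
      ← neg_sub, ← neg_sub (qpow h 1), neg_div_neg_eq]

theorem Generic.qpow_ne_one {h : ℂ} (hq : Generic h) (h0 : h ≠ 0) {n : ℤ} (hn : n ≠ 0) :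
    qpow h n ≠ 1 := by
  obtain hq | hq := hq
  · exact absurd hq h0
  have key : ∀ m : ℕ, m ≠ 0 → qpow h (m : ℤ) ≠ 1 := fun m hm => by
    simpa using hq m (Nat.one_le_iff_ne_zero.2 hm)
  obtain ⟨m, rfl | rfl⟩ := n.eq_nat_or_neg
  · exact key m (by simpa using hn)
  · intro e
    refine key m (by simpa using hn) ?_
    push_cast at e ⊢
    rw [qpow_neg] at e
    exact inv_eq_one.1 e

theorem Generic.delta_ne_zero {h : ℂ} (hq : Generic h) (h0 : h ≠ 0) :
    qpow h 1 - qpow h (-1) ≠ 0 := by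
  intro e
  refine hq.qpow_ne_one h0 (n := 2) (by norm_num) ?_
  have e2 : ((2 : ℤ) : ℚ) = 1 + 1 := by norm_num
  rw [e2, qpow_add]
  nth_rewrite 1 [sub_eq_zero.1 e]
  rw [qpow_neg, inv_mul_cancel₀ (qpow_ne_zero _ _)]

theorem Generic.qnum_ne_zero {h : ℂ} (hq : Generic h) {n : ℤ} (hn : n ≠ 0) : qnum h n ≠ 0 := by
  by_cases h0 : h = 0
  · subst h0; rw [qnum_zero_left]; exact_mod_cast hn
  · rw [qnum_of_ne h0]
    refine div_ne_zero (fun e => ?_) (hq.delta_ne_zero h0)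
    refine hq.qpow_ne_one h0 (n := 2 * n) (by omega) ?_
    have e2 : ((2 * n : ℤ) : ℚ) = n + n := by push_cast; ring
    rw [e2, qpow_add]
    nth_rewrite 1 [sub_eq_zero.1 e]
    exact inv_mul_cancel₀ (qpow_ne_zero _ _)

theorem Generic.qnum_nat_succ_ne_zero {h : ℂ} (hq : Generic h) (n : ℕ) :
    qnum h (n + 1) ≠ 0 := by
  have := hq.qnum_ne_zero (n := (n : ℤ) + 1) (by omega)
  push_cast at this; exact this

/-- The product formula `[a][b] = [a+b-d][d] + [a-d][b-d]`. -/
theorem qnum_mul_qnum {h : ℂ} (hq : Generic h) (a b d : ℚ) :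
    qnum h a * qnum h b = qnum h (a + b - d) * qnum h d + qnum h (a - d) * qnum h (b - d) := by
  by_cases h0 : h = 0
  · subst h0; simp only [qnum_zero_left]; push_cast; ring
  · have hd := hq.delta_ne_zero h0
    simp only [qnum_of_ne h0, qpow_add, qpow_sub]
    have ha := qpow_ne_zero h a
    have hb := qpow_ne_zero h b
    have hd' := qpow_ne_zero h d
    generalize qpow h a = A at *
    generalize qpow h b = B at *
    generalize qpow h d = D at *
    field_simp
    ring

/-- This unsymmetric addition formula is what makes the powers of `q` in the closed forms of the
star sums satisfy their recurrences. -/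
theorem qnum_sub {h : ℂ} (hq : Generic h) (y z : ℚ) :
    qnum h (y - z) = qpow h z * qnum h y - qpow h y * qnum h z := by
  by_cases h0 : h = 0
  · subst h0; simp [qnum_zero_left, qpow]
  · have hd := hq.delta_ne_zero h0
    simp only [qnum_of_ne h0, qpow_sub]
    have ha := qpow_ne_zero h y
    have hb := qpow_ne_zero h z
    generalize qpow h y = A at *
    generalize qpow h z = B at *
    field_simp
    ring

/-- The creative-telescoping certificate of the Saalschütz sum: with `y = c + n` and `n = k + m`,
this is what remains of the recurrence in `n` once the common factors of the summands are removed.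
-/
theorem saalschutz_certificate {h : ℂ} (hq : Generic h) (a b y m k : ℚ) :
    qnum h (m + k + 1) * qnum h y * qnum h (a + b - y + k) +
        qnum h (m + 1) * qnum h (y - a) * qnum h (y - b) =
      qnum h (m + 1) * qnum h (a + k) * qnum h (b + k) +
        qnum h k * qnum h (y - m - 1) * qnum h (a + b - y + k) := by
  by_cases h0 : h = 0
  · subst h0; simp only [qnum_zero_left]; push_cast; ring
  · have hd := hq.delta_ne_zero h0
    simp only [qnum_of_ne h0, qpow_add, qpow_sub]
    have ha := qpow_ne_zero h a
    have hb := qpow_ne_zero h b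
    have hy := qpow_ne_zero h y
    have hm := qpow_ne_zero h m
    have hk := qpow_ne_zero h k
    have h1 := qpow_ne_zero h 1
    generalize qpow h 1 - qpow h (-1) = δ at *
    generalize qpow h 1 = Q at *
    generalize qpow h a = A at *
    generalize qpow h b = B at *
    generalize qpow h y = Y at *
    generalize qpow h m = M at *
    generalize qpow h k = K at *
    field_simp
    ring

/-! ### Shifted factorials -/

/-- The `q`-shifted factorial `[a][a+1]⋯[a+n-1]`. -/
noncomputable def poch (h : ℂ) (a : ℚ) (n : ℕ) : ℂ := ∏ i ∈ Finset.range n, qnum h (a + i)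

theorem poch_zero (h : ℂ) (a : ℚ) : poch h a 0 = 1 := by simp [poch]

theorem poch_succ (h : ℂ) (a : ℚ) (n : ℕ) : poch h a (n + 1) = poch h a n * qnum h (a + n) :=
  Finset.prod_range_succ _ _

theorem poch_succ' (h : ℂ) (a : ℚ) (n : ℕ) :
    poch h a (n + 1) = qnum h a * poch h (a + 1) n := by
  rw [poch, Finset.prod_range_succ', mul_comm, poch]
  congr 1
  · simp
  · refine Finset.prod_congr rfl fun i _ => ?_
    congr 1; push_cast; ring

theorem poch_add (h : ℂ) (a : ℚ) (m n : ℕ) : poch h a (m + n) = poch h a m * poch h (a + m) n := by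
  rw [poch, Finset.prod_range_add, poch, poch]
  congr 1
  refine Finset.prod_congr rfl fun i _ => ?_
  congr 1; push_cast; ring

theorem poch_reflect (h : ℂ) (a : ℚ) (n : ℕ) :
    poch h a n = (-1) ^ n * poch h (1 - a - n) n := by
  rw [poch, ← Finset.prod_range_reflect, poch]
  conv_rhs => rw [← Finset.card_range n, ← Finset.prod_const, Finset.card_range, ← Finset.prod_mul_distrib]
  refine Finset.prod_congr rfl fun i hi => ?_
  rw [Finset.mem_range] at hi
  rw [neg_one_mul, ← qnum_neg]
  congr 1
  rw [Nat.sub_sub, Nat.cast_sub (by omega)]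
  push_cast; ring

theorem poch_eq_zero {h : ℂ} {a : ℚ} {n : ℕ} (i : ℕ) (hi : i < n) (ha : a + i = 0) :
    poch h a n = 0 :=
  Finset.prod_eq_zero (Finset.mem_range.2 hi) (by rw [ha, qnum_zero])

/-- The `q`-factorial of a natural number. -/
noncomputable def nfact (h : ℂ) (n : ℕ) : ℂ := ∏ i ∈ Finset.range n, qnum h (i + 1)

theorem nfact_zero (h : ℂ) : nfact h 0 = 1 := by simp [nfact]

theorem nfact_succ (h : ℂ) (n : ℕ) : nfact h (n + 1) = nfact h n * qnum h (n + 1) :=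
  Finset.prod_range_succ _ _

theorem nfact_ne_zero {h : ℂ} (hq : Generic h) (n : ℕ) : nfact h n ≠ 0 :=
  Finset.prod_ne_zero_iff.2 fun i _ => hq.qnum_nat_succ_ne_zero i

/-! ### The `q`-Saalschütz sum and Sears' transformation. -/

/-- Induction on `n` by creative telescoping. The balancing parameter depends on `n`, but its
shifted factorial read backwards is a product of `[a+b-c-i]`, whose factors do not; this form is
suited to the induction. -/
theorem saalschutz_aux {h : ℂ} (hq : Generic h) (a b c : ℚ) (n : ℕ) :
    ∑ k ∈ Finset.range (n + 1), (-1) ^ k * poch h a k * poch h b k * poch h (c + k) (n - k) *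
        (∏ i ∈ Finset.range (n - k), qnum h (a + b - c - i)) / (nfact h k * nfact h (n - k)) =
      (-1) ^ n * poch h (c - a) n * poch h (c - b) n / nfact h n := by
  induction n with
  | zero => simp [poch_zero, nfact_zero]
  | succ n ih =>
    -- The telescoping companion of the summand. It vanishes at `k = 0` because of `[k]`, and its
    -- value at `k = n + 1` cancels the extra last summand of the sum for `n + 1`.
    let g : ℕ → ℂ := fun k => (-1) ^ (k + 1) * poch h a k * poch h b k *
      poch h (c + k - 1) (n + 1 - k) *
      (∏ i ∈ Finset.range (n + 1 - k), qnum h (a + b - c - i)) * qnum h k /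
        (nfact h k * nfact h (n + 1 - k))
    have step : ∀ k ∈ Finset.range (n + 1),
        qnum h (n + 1) * ((-1) ^ k * poch h a k * poch h b k * poch h (c + k) (n + 1 - k) *
        (∏ i ∈ Finset.range (n + 1 - k), qnum h (a + b - c - i)) /
          (nfact h k * nfact h (n + 1 - k))) =
        (g (k + 1) - g k) - qnum h (c - a + n) * qnum h (c - b + n) *
        ((-1) ^ k * poch h a k * poch h b k * poch h (c + k) (n - k) *
        (∏ i ∈ Finset.range (n - k), qnum h (a + b - c - i)) / (nfact h k * nfact h (n - k))) := by
      intro k hk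
      obtain ⟨m, rfl⟩ := Nat.exists_eq_add_of_le (Nat.lt_succ_iff.1 (Finset.mem_range.1 hk))
      have e1 : k + m + 1 - k = m + 1 := by omega
      have e2 : k + m - k = m := by omega
      have e3 : k + m + 1 - (k + 1) = m := by omega
      have hc := saalschutz_certificate hq a b (c + k + m) m k
      simp only [g]
      rw [e1, e2, e3, poch_succ h a, poch_succ h b, poch_succ h (c + k), nfact_succ h k,
        nfact_succ h m, Finset.prod_range_succ, poch_succ' h (c + k - 1)]
      have r1 : c + ((k + 1 : ℕ) : ℚ) - 1 = c + k := by push_cast; ring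
      have r2 : c + (k : ℚ) - 1 + 1 = c + k := by ring
      have r3 : (((k + m : ℕ) : ℚ) + 1) = m + k + 1 := by push_cast; ring
      have r4 : c - a + ((k + m : ℕ) : ℚ) = c + k + m - a := by push_cast; ring
      have r5 : c - b + ((k + m : ℕ) : ℚ) = c + k + m - b := by push_cast; ring
      have r6 : a + b - (c + k + m) + k = a + b - c - m := by ring
      have r7 : c + k + m - m - 1 = c + (k : ℚ) - 1 := by ring
      rw [r1, r2, r3, r4, r5]
      rw [r6, r7] at hc
      have n1 := nfact_ne_zero hq k
      have n2 := nfact_ne_zero hq m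
      have n3 := hq.qnum_nat_succ_ne_zero k
      have n4 := hq.qnum_nat_succ_ne_zero m
      push_cast
      field_simp
      linear_combination ((-1 : ℂ) ^ k * poch h a k * poch h b k * poch h (c + k) m * (∏ i ∈ Finset.range m, qnum h (a + b - c - i))) * hc
    have hn1 := hq.qnum_nat_succ_ne_zero n
    apply mul_left_cancel₀ hn1
    rw [Finset.sum_range_succ, mul_add, Finset.mul_sum, Finset.sum_congr rfl step,
      Finset.sum_sub_distrib, ← Finset.mul_sum, ih, Finset.sum_range_sub]
    simp only [g]
    rw [nfact_succ, poch_succ h (c - a), poch_succ h (c - b)]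
    have hn := nfact_ne_zero hq n
    simp [poch_zero, nfact_zero, qnum_zero]
    field_simp
    ring

/-- The balanced terminating `q`-Pfaff--Saalschütz sum, in a form without denominators. -/
theorem saalschutz {h : ℂ} (hq : Generic h) {a b c d : ℚ} (n : ℕ) (hs : c + d = a + b + 1 - n) :
    ∑ k ∈ Finset.range (n + 1), (-1) ^ k * poch h a k * poch h b k * poch h (c + k) (n - k) *
        poch h (d + k) (n - k) / (nfact h k * nfact h (n - k)) =
      (-1) ^ n * poch h (c - a) n * poch h (c - b) n / nfact h n := by
  rw [← saalschutz_aux hq]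
  refine Finset.sum_congr rfl fun k hk => ?_
  congr 2
  rw [poch, ← Finset.prod_range_reflect]
  refine Finset.prod_congr rfl fun i hi => ?_
  rw [Finset.mem_range] at hk hi
  congr 1
  rw [Nat.sub_sub, Nat.cast_sub (by omega), Nat.cast_sub (by omega)]
  push_cast; linarith

/-- The terminating balanced `₄φ₃` series, multiplied by the product of its denominators and
divided by the `q`-factorial of `n`. -/
noncomputable def bal (h : ℂ) (n : ℕ) (a b c d e f : ℚ) : ℂ :=
  ∑ k ∈ Finset.range (n + 1), (-1) ^ k * poch h a k * poch h b k * poch h c k *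
    poch h (d + k) (n - k) * poch h (e + k) (n - k) * poch h (f + k) (n - k) /
      (nfact h k * nfact h (n - k))

/-- Sears' transformation of a terminating balanced `₄φ₃` series. -/
theorem sears {h : ℂ} (hq : Generic h) {a b c d e f : ℚ} (n : ℕ)
    (hs : d + e + f = a + b + c + 1 - n) :
    bal h n a b c d e f =
      ∑ k ∈ Finset.range (n + 1), (-1) ^ k * poch h a k * poch h (d - b) k * poch h (d - c) k *
        poch h (d + k) (n - k) * poch h (e - a) (n - k) * poch h (f - a) (n - k) /
          (nfact h k * nfact h (n - k)) := by
  -- The product `poch (d-b) m * poch (d-c) m` is expanded by Saalschütz; the parameter `b + c + 1 -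
  -- m - d` is forced by the balancing condition.
  have expand : ∀ m ∈ Finset.range (n + 1),
      (-1) ^ m * poch h a m * poch h (d - b) m * poch h (d - c) m *
        poch h (d + m) (n - m) * poch h (e - a) (n - m) * poch h (f - a) (n - m) /
          (nfact h m * nfact h (n - m)) =
      ∑ j ∈ Finset.range (m + 1), poch h a m * poch h (d + m) (n - m) * poch h (e - a) (n - m) *
        poch h (f - a) (n - m) / nfact h (n - m) *
        ((-1) ^ j * poch h b j * poch h c j * poch h (d + j) (m - j) *
          poch h (b + c + 1 - m - d + j) (m - j) / (nfact h j * nfact h (m - j))) := by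
    intro m _
    rw [← Finset.mul_sum, saalschutz hq m (by ring)]
    have n1 := nfact_ne_zero hq m
    have n2 := nfact_ne_zero hq (n - m)
    field_simp
  rw [Finset.sum_congr rfl expand, Finset.sum_comm' (t' := Finset.range (n + 1))
    (s' := fun j => Finset.Ico j (n + 1)) (by intro x y; simp; omega), bal]
  refine Finset.sum_congr rfl fun j hj => ?_
  obtain ⟨N, rfl⟩ := Nat.exists_eq_add_of_le (Nat.lt_succ_iff.1 (Finset.mem_range.1 hj))
  rw [Finset.sum_Ico_eq_sum_range]
  have e0 : j + N + 1 - j = N + 1 := by omega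
  have e1 : j + N - j = N := by omega
  rw [e0, e1]
  -- After the exchange of summations, with `m = j + i`, the inner sum is brought to Saalschütz form
  -- by reflecting shifted factorials. It is balanced precisely because of `hs`.
  have inner : ∀ i ∈ Finset.range (N + 1),
      poch h a (j + i) * poch h (d + (j + i : ℕ)) (j + N - (j + i)) *
        poch h (e - a) (j + N - (j + i)) * poch h (f - a) (j + N - (j + i)) /
          nfact h (j + N - (j + i)) *
        ((-1) ^ j * poch h b j * poch h c j * poch h (d + j) (j + i - j) *
          poch h (b + c + 1 - (j + i : ℕ) - d + j) (j + i - j) /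
            (nfact h j * nfact h (j + i - j))) =
      ((-1) ^ j * poch h a j * poch h b j * poch h c j * poch h (d + j) N / nfact h j) *
        ((-1) ^ i * poch h (a + j) i * poch h (d - b - c) i *
          poch h (1 - e + a - N + i) (N - i) * poch h (1 - f + a - N + i) (N - i) /
            (nfact h i * nfact h (N - i))) := by
    intro i hi
    obtain ⟨M, rfl⟩ := Nat.exists_eq_add_of_le (Nat.lt_succ_iff.1 (Finset.mem_range.1 hi))
    have f1 : j + (i + M) - (j + i) = M := by omega
    have f2 : j + i - j = i := by omega
    have f3 : i + M - i = M := by omega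
    rw [f1, f2, f3, poch_add h a, poch_add h (d + j) i M, poch_reflect h (e - a),
      poch_reflect h (f - a), poch_reflect h (b + c + 1 - _ - d + j)]
    have r1 : 1 - (b + c + 1 - ((j + i : ℕ) : ℚ) - d + j) - i = d - b - c := by push_cast; ring
    have r2 : 1 - (e - a) - (M : ℚ) = 1 - e + a - ((i + M : ℕ) : ℚ) + i := by push_cast; ring
    have r3 : 1 - (f - a) - (M : ℚ) = 1 - f + a - ((i + M : ℕ) : ℚ) + i := by push_cast; ring
    have r4 : d + ((j + i : ℕ) : ℚ) = d + j + i := by push_cast; ring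
    rw [r1, r2, r3, r4]
    have hM : ((-1 : ℂ) ^ M) * (-1) ^ M = 1 := by rw [← mul_pow]; simp
    have n1 := nfact_ne_zero hq j
    have n2 := nfact_ne_zero hq i
    have n3 := nfact_ne_zero hq M
    field_simp
    linear_combination (poch h a j * poch h (a + j) i * poch h (d + j + i) M *
      poch h (1 - e + a - ((i + M : ℕ) : ℚ) + i) M * poch h (1 - f + a - ((i + M : ℕ) : ℚ) + i) M *
      poch h b j * poch h c j * poch h (d + j) i * poch h (d - b - c) i) * hM
  rw [Finset.sum_congr rfl inner, ← Finset.mul_sum,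
    saalschutz hq N (by push_cast at hs; linarith)]
  have r1 : 1 - e + a - N - (a + j) = 1 - (e + j) - (N : ℚ) := by ring
  have r2 : 1 - e + a - N - (d - b - c) = f + (j : ℚ) := by push_cast at hs; linarith
  rw [r1, r2, poch_reflect h (e + j)]
  have n1 := nfact_ne_zero hq j
  have n2 := nfact_ne_zero hq N
  field_simp

/-- Sears' transformation, with a balanced series on both sides. -/
theorem bal_sears {h : ℂ} (hq : Generic h) {a b c d e f : ℚ} (n : ℕ)
    (hs : d + e + f = a + b + c + 1 - n) :
    bal h n a b c d e f = bal h n a (d - b) (d - c) d (a - e - n + 1) (a - f - n + 1) := by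
  rw [sears hq n hs, bal]
  refine Finset.sum_congr rfl fun k hk => ?_
  obtain ⟨m, rfl⟩ := Nat.exists_eq_add_of_le (Nat.lt_succ_iff.1 (Finset.mem_range.1 hk))
  have f1 : k + m - k = m := by omega
  rw [f1, poch_reflect h (e - a), poch_reflect h (f - a)]
  have r1 : 1 - (e - a) - (m : ℚ) = a - e - ((k + m : ℕ) : ℚ) + 1 + k := by push_cast; ring
  have r2 : 1 - (f - a) - (m : ℚ) = a - f - ((k + m : ℕ) : ℚ) + 1 + k := by push_cast; ring
  rw [r1, r2]
  have hM : ((-1 : ℂ) ^ m) * (-1) ^ m = 1 := by rw [← mul_pow]; simp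
  have n1 := nfact_ne_zero hq k
  have n2 := nfact_ne_zero hq m
  field_simp
  linear_combination (poch h a k * poch h (d - b) k * poch h (d - c) k * poch h (d + k) m *
    poch h (a - e - ((k + m : ℕ) : ℚ) + 1 + k) m * poch h (a - f - ((k + m : ℕ) : ℚ) + 1 + k) m) * hM

/-! ### `q`-factorials of integers -/

theorem prod_Icc_one (f : ℕ → ℂ) (n : ℕ) :
    ∏ k ∈ Finset.Icc 1 n, f k = ∏ i ∈ Finset.range n, f (i + 1) := by
  rw [Finset.range_eq_Ico, Finset.prod_Ico_add' f 0 n 1]; rfl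

theorem qfact_natCast (h : ℂ) (n : ℕ) : qfact h n = nfact h n := by
  rw [qfact, Nat.floor_natCast, prod_Icc_one (fun k => qnum h k), nfact]
  simp

theorem rfact_natCast (h : ℂ) (n : ℕ) : rfact h n = (nfact h n)⁻¹ := by
  rw [rfact, if_neg (not_lt.2 n.cast_nonneg), qfact_natCast]

theorem rfact_of_neg (h : ℂ) {x : ℚ} (hx : x < 0) : rfact h x = 0 := if_pos hx

theorem rfact_of_nonneg (h : ℂ) {x : ℚ} (hx : 0 ≤ x) : rfact h x = (qfact h x)⁻¹ :=
  if_neg (not_lt.2 hx)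

theorem rfact_zero (h : ℂ) : rfact h 0 = 1 := by
  simpa [nfact_zero] using rfact_natCast h 0

theorem qsqrt_sq (h : ℂ) (x : ℚ) : qsqrt h x * qsqrt h x = qnum h x := by
  rw [qsqrt, ← pow_two, ← Complex.cpow_nat_mul]; norm_num

theorem qfact_eq_sfact (h : ℂ) (x : ℚ) : qfact h x = sfact h x * sfact h x := by
  rw [qfact, sfact, ← Finset.prod_mul_distrib]
  exact Finset.prod_congr rfl fun k _ => (qsqrt_sq h k).symm

theorem qfact_ne_zero {h : ℂ} (hq : Generic h) (x : ℚ) : qfact h x ≠ 0 := by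
  rw [qfact]
  refine Finset.prod_ne_zero_iff.2 fun k hk => ?_
  have := hq.qnum_ne_zero (n := k) (by have := (Finset.mem_Icc.1 hk).1; omega)
  simpa using this

theorem sfact_ne_zero {h : ℂ} (hq : Generic h) (x : ℚ) : sfact h x ≠ 0 := fun e =>
  qfact_ne_zero hq x (by rw [qfact_eq_sfact, e, zero_mul])

theorem sfact_natCast_succ (h : ℂ) (n : ℕ) :
    sfact h (n + 1) = sfact h n * qsqrt h (n + 1) := by
  have e : ((n : ℚ) + 1) = ((n + 1 : ℕ) : ℚ) := by push_cast; rfl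
  rw [e, sfact, sfact, Nat.floor_natCast, Nat.floor_natCast,
    prod_Icc_one (fun k => qsqrt h k), prod_Icc_one (fun k => qsqrt h k), Finset.prod_range_succ]

/-- `x` is a natural number. -/
def IsNat (x : ℚ) : Prop := ∃ n : ℕ, x = n

/-- `x` is an integer. -/
def IsZ (x : ℚ) : Prop := ∃ n : ℤ, x = n

theorem IsNat.nonneg {x : ℚ} (hx : IsNat x) : 0 ≤ x := by
  obtain ⟨n, rfl⟩ := hx; positivity

theorem IsNat.isZ {x : ℚ} (hx : IsNat x) : IsZ x := by
  obtain ⟨n, rfl⟩ := hx; exact ⟨n, by simp⟩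

theorem IsZ.isNat {x : ℚ} (hx : IsZ x) (h0 : 0 ≤ x) : IsNat x := by
  obtain ⟨n, rfl⟩ := hx
  lift n to ℕ using by exact_mod_cast h0
  exact ⟨n, by simp⟩

theorem isZ_natCast (n : ℕ) : IsZ n := ⟨n, by simp⟩

theorem isZ_one : IsZ 1 := ⟨1, by simp⟩

theorem IsZ.add {x y : ℚ} (hx : IsZ x) (hy : IsZ y) : IsZ (x + y) := by
  obtain ⟨n, rfl⟩ := hx; obtain ⟨m, rfl⟩ := hy; exact ⟨n + m, by simp⟩

theorem IsZ.neg {x : ℚ} (hx : IsZ x) : IsZ (-x) := by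
  obtain ⟨n, rfl⟩ := hx; exact ⟨-n, by simp⟩

theorem IsZ.sub {x y : ℚ} (hx : IsZ x) (hy : IsZ y) : IsZ (x - y) := by
  obtain ⟨n, rfl⟩ := hx; obtain ⟨m, rfl⟩ := hy; exact ⟨n - m, by simp⟩

/-- No positivity is needed: at `0` the factor `[0]` vanishes, and below it both reciprocals do. By
contrast `qfact` takes the value `1` at negative arguments, so its recurrence is restricted to
natural `x`. -/
theorem rfact_sub_one {h : ℂ} (hq : Generic h) {x : ℚ} (hx : IsZ x) :
    rfact h (x - 1) = qnum h x * rfact h x := by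
  obtain ⟨n, rfl⟩ := hx
  obtain hn | rfl | hn := lt_trichotomy n 0
  · have : (n : ℚ) < 0 := by exact_mod_cast hn
    rw [rfact_of_neg h (by linarith), rfact_of_neg h this, mul_zero]
  · rw [rfact_of_neg h (by simp)]; simp [qnum_zero]
  · obtain ⟨m, rfl⟩ : ∃ m : ℕ, n = m + 1 := ⟨(n - 1).toNat, by omega⟩
    have e : (((m : ℤ) + 1 : ℤ) : ℚ) = ((m + 1 : ℕ) : ℚ) := by push_cast; ring
    have e' : (((m + 1 : ℕ) : ℚ)) - 1 = m := by push_cast; ring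
    rw [e, e', rfact_natCast, rfact_natCast, nfact_succ]
    have := hq.qnum_nat_succ_ne_zero m
    have := nfact_ne_zero hq m
    push_cast
    field_simp

theorem qfact_add_one {h : ℂ} {x : ℚ} (hx : IsNat x) :
    qfact h (x + 1) = qnum h (x + 1) * qfact h x := by
  obtain ⟨n, rfl⟩ := hx
  have e : ((n : ℚ) + 1) = ((n + 1 : ℕ) : ℚ) := by push_cast; ring
  rw [qfact_natCast, e, qfact_natCast, nfact_succ, mul_comm]; push_cast; rfl

theorem qfact_add_nat {h : ℂ} {x : ℚ} (hx : IsNat x) (k : ℕ) :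
    qfact h (x + k) = qfact h x * poch h (x + 1) k := by
  induction k with
  | zero => simp [poch_zero]
  | succ k ih =>
    have hk : IsNat (x + k) := by obtain ⟨n, rfl⟩ := hx; exact ⟨n + k, by push_cast; ring⟩
    have e : x + ((k + 1 : ℕ) : ℚ) = x + k + 1 := by push_cast; ring
    have e' : x + 1 + (k : ℚ) = x + k + 1 := by ring
    rw [e, qfact_add_one hk, ih, poch_succ, e']; ring

theorem qfact_sub_nat {h : ℂ} {x : ℚ} {n k : ℕ} (hx : IsNat (x - n)) (hk : k ≤ n) :
    qfact h (x - k) = qfact h (x - n) * ((-1) ^ (n - k) * poch h (-x + k) (n - k)) := by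
  obtain ⟨m, rfl⟩ := Nat.exists_eq_add_of_le hk
  have e : x - (k : ℚ) = x - ((k + m : ℕ) : ℚ) + m := by push_cast; ring
  have e2 : k + m - k = m := by omega
  rw [e, qfact_add_nat hx, poch_reflect, e2]
  congr 3; push_cast; ring

theorem rfact_add_nat {h : ℂ} (hq : Generic h) {x : ℚ} {n k : ℕ} (hx : IsNat (x + n))
    (hk : k ≤ n) : rfact h (x + k) = rfact h (x + n) * poch h (x + 1 + k) (n - k) := by
  obtain ⟨m, rfl⟩ := Nat.exists_eq_add_of_le hk
  have e2 : k + m - k = m := by omega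
  rw [e2]
  clear hk e2
  have hz : IsZ x := by
    have := hx.isZ.sub (isZ_natCast (k + m)); simpa using this
  clear hx
  induction m with
  | zero => simp [poch_zero]
  | succ m ih =>
    have e : x + ((k + m : ℕ) : ℚ) = x + ((k + (m + 1) : ℕ) : ℚ) - 1 := by push_cast; ring
    have e' : x + 1 + k + (m : ℚ) = x + ((k + (m + 1) : ℕ) : ℚ) := by push_cast; ring
    rw [ih, poch_succ, e, rfact_sub_one hq (hz.add (isZ_natCast _)), e']
    ring

theorem rfact_sub_nat {h : ℂ} (hq : Generic h) {x : ℚ} (hx : IsZ x) (k : ℕ) :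
    rfact h (x - k) = rfact h x * ((-1) ^ k * poch h (-x) k) := by
  induction k with
  | zero => simp [poch_zero]
  | succ k ih =>
    have e : x - ((k + 1 : ℕ) : ℚ) = x - k - 1 := by push_cast; ring
    have e' : x - (k : ℚ) = -(-x + k) := by ring
    rw [e, rfact_sub_one hq (hx.sub (isZ_natCast k)), ih, poch_succ, e', qnum_neg]
    ring

theorem rfact_nat_mul {h : ℂ} {n k : ℕ} (hk : k ≤ n) :
    rfact h k * rfact h (n - k) = (nfact h k * nfact h (n - k))⁻¹ := by
  rw [← Nat.cast_sub hk, rfact_natCast, rfact_natCast, mul_inv]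

theorem sgn_natCast (n : ℕ) : sgn n = (-1) ^ n := by
  rw [sgn, show ((n : ℚ)) = ((n : ℤ) : ℚ) by simp, Int.floor_intCast, zpow_natCast]

theorem sgn_add {x y : ℚ} (hx : IsZ x) (hy : IsZ y) : sgn (x + y) = sgn x * sgn y := by
  obtain ⟨n, rfl⟩ := hx
  obtain ⟨m, rfl⟩ := hy
  rw [sgn, sgn, sgn, ← Int.cast_add, Int.floor_intCast, Int.floor_intCast, Int.floor_intCast,
    zpow_add₀ (by norm_num)]

theorem sgn_mul_self (x : ℚ) : sgn x * sgn x = 1 := by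
  rw [sgn, ← mul_zpow]; simp

theorem sgn_neg {x : ℚ} (hx : IsZ x) : sgn (-x) = sgn x := by
  obtain ⟨n, rfl⟩ := hx
  rw [sgn, sgn, ← Int.cast_neg, Int.floor_intCast, Int.floor_intCast, zpow_neg, ← inv_zpow]
  norm_num

theorem sgn_sub {x y : ℚ} (hx : IsZ x) (hy : IsZ y) : sgn (x - y) = sgn x * sgn y := by
  rw [sub_eq_add_neg, sgn_add hx hy.neg, sgn_neg hy]

/-! ### The symmetric form of the `q`-`6j` coefficient -/

/-- Racah's single sum, in the perimeters of the four triangles and the three quadrangles. -/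
noncomputable def racah (h : ℂ) (t₁ t₂ t₃ t₄ q₁ q₂ q₃ : ℕ) : ℂ :=
  ∑ z ∈ Finset.range (q₁ + q₂ + q₃ + 1), (-1) ^ z * qfact h (z + 1) * rfact h (z - t₁) *
    rfact h (z - t₂) * rfact h (z - t₃) * rfact h (z - t₄) * rfact h (q₁ - z) *
    rfact h (q₂ - z) * rfact h (q₃ - z)

theorem racah_perm_t₁₂ (h : ℂ) (t₁ t₂ t₃ t₄ q₁ q₂ q₃ : ℕ) :
    racah h t₁ t₂ t₃ t₄ q₁ q₂ q₃ = racah h t₂ t₁ t₃ t₄ q₁ q₂ q₃ :=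
  Finset.sum_congr rfl fun _ _ => by ring

theorem racah_perm_t₁₃ (h : ℂ) (t₁ t₂ t₃ t₄ q₁ q₂ q₃ : ℕ) :
    racah h t₁ t₂ t₃ t₄ q₁ q₂ q₃ = racah h t₃ t₂ t₁ t₄ q₁ q₂ q₃ :=
  Finset.sum_congr rfl fun _ _ => by ring

theorem racah_perm_t₁₄ (h : ℂ) (t₁ t₂ t₃ t₄ q₁ q₂ q₃ : ℕ) :
    racah h t₁ t₂ t₃ t₄ q₁ q₂ q₃ = racah h t₄ t₂ t₃ t₁ q₁ q₂ q₃ :=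
  Finset.sum_congr rfl fun _ _ => by ring

theorem racah_perm_q₁₂ (h : ℂ) (t₁ t₂ t₃ t₄ q₁ q₂ q₃ : ℕ) :
    racah h t₁ t₂ t₃ t₄ q₁ q₂ q₃ = racah h t₁ t₂ t₃ t₄ q₂ q₁ q₃ := by
  rw [racah, racah, add_comm q₁ q₂]
  exact Finset.sum_congr rfl fun _ _ => by ring

theorem racah_perm_q₁₃ (h : ℂ) (t₁ t₂ t₃ t₄ q₁ q₂ q₃ : ℕ) :
    racah h t₁ t₂ t₃ t₄ q₁ q₂ q₃ = racah h t₁ t₂ t₃ t₄ q₃ q₂ q₁ := by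
  rw [racah, racah, show q₃ + q₂ + q₁ = q₁ + q₂ + q₃ by ring]
  exact Finset.sum_congr rfl fun _ _ => by ring

/-- Reverse the sum by `z = q₁ - k`. The reciprocal factorials cut the generous symmetric range of
`racah` down to `0 ≤ k ≤ q₁ - t₁`, and every factor becomes a shifted factorial in `k`. -/
theorem racah_eq_bal {h : ℂ} (hq : Generic h) {t₁ t₂ t₃ t₄ q₁ q₂ q₃ n : ℕ} (hn : q₁ = t₁ + n)
    (h12 : t₁ ≤ q₂) (h13 : t₁ ≤ q₃) :
    racah h t₁ t₂ t₃ t₄ q₁ q₂ q₃ =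
      (-1) ^ (q₁ + n) * qfact h (t₁ + 1) * rfact h (q₁ - t₂) * rfact h (q₁ - t₃) *
        rfact h (q₁ - t₄) * rfact h (q₂ - t₁) * rfact h (q₃ - t₁) *
        bal h n (-(q₁ - t₂)) (-(q₁ - t₃)) (-(q₁ - t₄)) (q₂ - q₁ + 1) (q₃ - q₁ + 1) (-q₁ - 1) := by
  rw [racah, bal, Finset.mul_sum]
  have s1 : Finset.range (q₁ + 1) ⊆ Finset.range (q₁ + q₂ + q₃ + 1) :=
    Finset.range_subset_range.2 (by omega)
  rw [← Finset.sum_subset s1, ← Finset.sum_range_reflect]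
  · have s2 : Finset.range (n + 1) ⊆ Finset.range (q₁ + 1) :=
      Finset.range_subset_range.2 (by omega)
    rw [← Finset.sum_subset s2]
    · refine Finset.sum_congr rfl fun k hk => ?_
      have hk := Nat.lt_succ_iff.1 (Finset.mem_range.1 hk)
      have e0 : q₁ + 1 - 1 - k = q₁ - k := by omega
      have e1 : (((q₁ - k : ℕ)) : ℚ) = q₁ - k := Nat.cast_sub (by omega)
      rw [e0, e1]
      have hnq : (q₁ : ℚ) = t₁ + n := by rw [hn]; push_cast; ring
      have r1 : (q₁ : ℚ) - k + 1 = (q₁ + 1) - k := by ring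
      have r2 : ∀ t : ℚ, (q₁ : ℚ) - k - t = (q₁ - t) - k := fun t => by ring
      have r3 : ∀ t : ℚ, t - ((q₁ : ℚ) - k) = (t - q₁) + k := fun t => by ring
      have a1 : (q₁ : ℚ) + 1 - n = t₁ + 1 := by rw [hnq]; ring
      have a2 : (q₁ : ℚ) - t₁ = n := by rw [hnq]; ring
      have a3 : (q₂ : ℚ) - q₁ + n = q₂ - t₁ := by rw [hnq]; ring
      have a4 : (q₃ : ℚ) - q₁ + n = q₃ - t₁ := by rw [hnq]; ring
      have a5 : (q₁ : ℚ) - q₁ + k = k := by ring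
      rw [r1, r2, r2, r2, r2, r3, r3, r3, a2, a5,
        qfact_sub_nat (n := n) (by rw [a1]; exact ⟨t₁ + 1, by push_cast; ring⟩) hk, a1,
        rfact_sub_nat hq ((isZ_natCast q₁).sub (isZ_natCast t₂)),
        rfact_sub_nat hq ((isZ_natCast q₁).sub (isZ_natCast t₃)),
        rfact_sub_nat hq ((isZ_natCast q₁).sub (isZ_natCast t₄)),
        rfact_add_nat hq (x := q₂ - q₁) (n := n)
          (by rw [a3]; exact ⟨q₂ - t₁, by rw [Nat.cast_sub h12]⟩) hk,
        rfact_add_nat hq (x := q₃ - q₁) (n := n)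
          (by rw [a4]; exact ⟨q₃ - t₁, by rw [Nat.cast_sub h13]⟩) hk, a3, a4, div_eq_mul_inv,
        ← rfact_nat_mul hk]
      have b1 : -((q₁ : ℚ) + 1) + k = -q₁ - 1 + k := by ring
      rw [b1]
      have c1 : (-1 : ℂ) ^ (q₁ + n) = (-1) ^ (q₁ - k) * (-1) ^ (n - k) := by
        rw [← pow_add, show q₁ + n = (q₁ - k + (n - k)) + 2 * k by omega, pow_add _ _ (2 * k),
          pow_mul]
        simp
      have c2 : ((-1 : ℂ) ^ k) ^ 2 = 1 := by rw [← pow_mul, mul_comm, pow_mul]; simp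
      rw [c1]
      linear_combination (exp := 1) ((-1) ^ (q₁ - k) * qfact h (t₁ + 1) * (-1) ^ (n - k) *
        poch h (-q₁ - 1 + k) (n - k) * rfact h (n - k) * rfact h (q₁ - t₂) *
        poch h (-(q₁ - t₂)) k * rfact h (q₁ - t₃) * poch h (-(q₁ - t₃)) k * rfact h (q₁ - t₄) *
        poch h (-(q₁ - t₄)) k * rfact h k * rfact h (q₂ - t₁) * poch h (q₂ - q₁ + 1 + k) (n - k) *
        rfact h (q₃ - t₁) * poch h (q₃ - q₁ + 1 + k) (n - k) * (-1) ^ k) * c2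
    · intro k hk hk'
      rw [Finset.mem_range] at hk hk'
      have e1 : (((q₁ + 1 - 1 - k : ℕ)) : ℚ) = q₁ - k := by
        rw [Nat.add_sub_cancel]; exact Nat.cast_sub (by omega)
      have : (n : ℚ) + 1 ≤ k := by exact_mod_cast (by omega : n + 1 ≤ k)
      rw [e1, rfact_of_neg h (x := (q₁ : ℚ) - k - t₁) (by rw [hn]; push_cast; linarith)]
      ring
  · intro z _ hz
    rw [Finset.mem_range] at hz
    have : (q₁ : ℚ) + 1 ≤ z := by exact_mod_cast (by omega : q₁ + 1 ≤ z)
    rw [rfact_of_neg h (x := (q₁ : ℚ) - z) (by linarith)]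
    ring

/-- The symmetric triangle coefficient. -/
noncomputable def tri (h : ℂ) (a b c : ℚ) : ℂ :=
  sfact h (a + b - c) * sfact h (a - b + c) * sfact h (b + c - a) / sfact h (a + b + c + 1)

theorem tri_swap (h : ℂ) (a b c : ℚ) : tri h a b c = tri h b a c := by
  rw [tri, tri, add_comm a b, show a - b + c = a + c - b by ring,
    show b + c - a = b - a + c by ring]; ring

theorem tri_swap' (h : ℂ) (a b c : ℚ) : tri h a b c = tri h a c b := by
  rw [tri, tri, add_comm b c, show a + b - c = a - c + b by ring,
    show a - b + c = a + c - b by ring, show a + b + c + 1 = a + c + b + 1 by ring]; ring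

theorem nabla_eq_tri {h : ℂ} (hq : Generic h) (a b c : ℚ) :
    nabla h a b c = tri h a b c * qfact h (a + b + c + 1) / qfact h (b + c - a) := by
  have n1 := sfact_ne_zero hq (b + c - a)
  have n2 := sfact_ne_zero hq (a + b + c + 1)
  rw [nabla, tri, qfact_eq_sfact, qfact_eq_sfact]
  field_simp

theorem nabla_mul_tri {h : ℂ} (hq : Generic h) (a b c : ℚ) :
    nabla h a b c * tri h a b c = qfact h (a + b - c) * qfact h (a - b + c) := by
  have n1 := sfact_ne_zero hq (b + c - a)
  have n2 := sfact_ne_zero hq (a + b + c + 1)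
  rw [nabla, tri, qfact_eq_sfact, qfact_eq_sfact]
  field_simp

theorem nabla_ne_zero {h : ℂ} (hq : Generic h) (a b c : ℚ) : nabla h a b c ≠ 0 := by
  have := sfact_ne_zero hq
  unfold nabla; simp [this]

theorem IsSpin.two_mul_isNat {a : ℚ} (ha : IsSpin a) : IsNat (2 * a) := by
  obtain ⟨n, rfl⟩ := ha; exact ⟨n, by ring⟩

theorem IsSpin.nonneg {a : ℚ} (ha : IsSpin a) : 0 ≤ a := by
  obtain ⟨n, rfl⟩ := ha; positivity

/-- The four triangular conditions of a `6j` coefficient. -/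
def Tetra (a b e d c f : ℚ) : Prop :=
  Triangle a b e ∧ Triangle a c f ∧ Triangle d b f ∧ Triangle d c e

theorem Triangle.swap {a b c : ℚ} (H : Triangle a b c) : Triangle b a c := by
  obtain ⟨ha, hb, hc, hz, h1, h2⟩ := H
  exact ⟨hb, ha, hc, by rwa [add_comm b a], by rwa [abs_sub_comm], by linarith⟩

theorem Triangle.swap' {a b c : ℚ} (H : Triangle a b c) : Triangle a c b := by
  obtain ⟨ha, hb, hc, ⟨n, hn⟩, h1, h2⟩ := H
  rw [abs_le] at h1
  exact ⟨ha, hc, hb, ⟨n, by linarith⟩, abs_le.2 ⟨by linarith, by linarith⟩, by linarith⟩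

theorem triangle_swap {a b c : ℚ} : Triangle a b c ↔ Triangle b a c := ⟨.swap, .swap⟩

theorem triangle_swap' {a b c : ℚ} : Triangle a b c ↔ Triangle a c b := ⟨.swap', .swap'⟩

theorem Triangle.isZ {a b c : ℚ} (H : Triangle a b c) : IsZ (a + b + c) := H.2.2.2.1

theorem Triangle.le₁ {a b c : ℚ} (H : Triangle a b c) : a ≤ b + c := by
  have := (abs_le.1 H.2.2.2.2.1).2; linarith

theorem Triangle.le₂ {a b c : ℚ} (H : Triangle a b c) : b ≤ a + c := by
  have := (abs_le.1 H.2.2.2.2.1).1; linarith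

theorem Triangle.le₃ {a b c : ℚ} (H : Triangle a b c) : c ≤ a + b := H.2.2.2.2.2

theorem Triangle.le {a b c : ℚ} (H : Triangle a b c) : a ≤ b + c ∧ b ≤ a + c ∧ c ≤ a + b :=
  ⟨H.le₁, H.le₂, H.le₃⟩

theorem IsNat.of_triangle {a b c x y : ℚ} (H : Triangle a b c) (hy : IsNat (2 * y))
    (hx : x = a + b + c - 2 * y) (h0 : 0 ≤ x) : IsNat x :=
  IsZ.isNat (by rw [hx]; exact H.isZ.sub hy.isZ) h0

theorem Triangle.isNat₁ {a b c : ℚ} (H : Triangle a b c) : IsNat (b + c - a) :=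
  .of_triangle H H.1.two_mul_isNat (by ring) (by linarith [H.le₁])

theorem Triangle.isNat₂ {a b c : ℚ} (H : Triangle a b c) : IsNat (a - b + c) :=
  .of_triangle H H.2.1.two_mul_isNat (by ring) (by linarith [H.le₂])

theorem Triangle.isNat₃ {a b c : ℚ} (H : Triangle a b c) : IsNat (a + b - c) :=
  .of_triangle H H.2.2.1.two_mul_isNat (by ring) (by linarith [H.le₃])

theorem Triangle.isNat {a b c : ℚ} (H : Triangle a b c) : IsNat (a + b + c) :=
  H.isZ.isNat (by linarith [H.1.nonneg, H.2.1.nonneg, H.2.2.1.nonneg])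

/-- Racah's sum for the array `{a b e; d c f}`. -/
noncomputable def racahJ (h : ℂ) (a b e d c f : ℚ) : ℂ :=
  racah h ⌊a + b + e⌋₊ ⌊a + c + f⌋₊ ⌊d + b + f⌋₊ ⌊d + c + e⌋₊ ⌊a + b + c + d⌋₊
    ⌊a + d + e + f⌋₊ ⌊b + c + e + f⌋₊

theorem Tetra.exists_nat {a b e d c f : ℚ} (H : Tetra a b e d c f) :
    ∃ t₁ t₂ t₃ t₄ q₁ q₂ q₃ : ℕ, a + b + e = t₁ ∧ a + c + f = t₂ ∧ d + b + f = t₃ ∧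
      d + c + e = t₄ ∧ a + b + c + d = q₁ ∧ a + d + e + f = q₂ ∧ b + c + e + f = q₃ := by
  obtain ⟨h1, h2, h3, h4⟩ := H
  have n1 := h1.1.nonneg
  have n2 := h1.2.1.nonneg
  have n3 := h1.2.2.1.nonneg
  have n4 := h4.1.nonneg
  have n5 := h4.2.1.nonneg
  have n6 := h2.2.2.1.nonneg
  obtain ⟨t₁, e1⟩ := h1.isNat
  obtain ⟨t₂, e2⟩ := h2.isNat
  obtain ⟨t₃, e3⟩ := h3.isNat
  obtain ⟨t₄, e4⟩ := h4.isNat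
  obtain ⟨q₁, e5⟩ : IsNat (a + b + c + d) := IsZ.isNat
    (by have := (h1.isZ.add h4.isZ).sub h1.2.2.1.two_mul_isNat.isZ; convert this using 1; ring)
    (by linarith)
  obtain ⟨q₂, e6⟩ : IsNat (a + d + e + f) := IsZ.isNat
    (by have := (h1.isZ.add h3.isZ).sub h1.2.1.two_mul_isNat.isZ; convert this using 1; ring)
    (by linarith)
  obtain ⟨q₃, e7⟩ : IsNat (b + c + e + f) := IsZ.isNat
    (by have := (h1.isZ.add h2.isZ).sub h1.1.two_mul_isNat.isZ; convert this using 1; ring)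
    (by linarith)
  exact ⟨_, _, _, _, _, _, _, e1, e2, e3, e4, e5, e6, e7⟩

/-- Racah's sum as a balanced series, of length `a + c - f`. -/
theorem racahJ_eq_bal {h : ℂ} (hq : Generic h) {a b e d c f : ℚ} (H : Tetra a b e d c f)
    {n : ℕ} (hn : a + c - f = n) :
    racahJ h a b e d c f = sgn (a + b + c + d + n) * qfact h (d + b + f + 1) *
      rfact h (b + d - f) * rfact h (c + d - e) * rfact h (a + b - e) * rfact h (a + e - b) *
      rfact h (c + e - d) *
      bal h n (-(b + d - f)) (-(c + d - e)) (-(a + b - e)) (e + f - b - c + 1)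
        (e + f - a - d + 1) (-(a + b + c + d) - 1) := by
  obtain ⟨t₁, t₂, t₃, t₄, q₁, q₂, q₃, e1, e2, e3, e4, e5, e6, e7⟩ := H.exists_nat
  obtain ⟨h1, h2, h3, h4⟩ := H
  have hq1 : q₁ = t₃ + n := by
    have : (q₁ : ℚ) = t₃ + n := by linarith
    exact_mod_cast this
  have l2 : t₃ ≤ q₂ := by
    have : (t₃ : ℚ) ≤ q₂ := by linarith [h1.le₂]
    exact_mod_cast this
  have l3 : t₃ ≤ q₃ := by
    have : (t₃ : ℚ) ≤ q₃ := by linarith [h4.le₁]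
    exact_mod_cast this
  rw [racahJ, e1, e2, e3, e4, e5, e6, e7]
  simp only [Nat.floor_natCast]
  rw [racah_perm_t₁₃, racah_eq_bal hq hq1 l2 l3]
  have r1 : (q₁ : ℚ) - t₂ = b + d - f := by linarith
  have r2 : (q₁ : ℚ) - t₁ = c + d - e := by linarith
  have r3 : (q₁ : ℚ) - t₄ = a + b - e := by linarith
  have r4 : (q₂ : ℚ) - t₃ = a + e - b := by linarith
  have r5 : (q₃ : ℚ) - t₃ = c + e - d := by linarith
  have r6 : (q₂ : ℚ) - q₁ + 1 = e + f - b - c + 1 := by linarith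
  have r7 : (q₃ : ℚ) - q₁ + 1 = e + f - a - d + 1 := by linarith
  have r8 : (q₁ : ℚ) + n = (q₁ + n : ℕ) := by push_cast; ring
  rw [r1, r2, r3, r4, r5, r6, r7, r8, sgn_natCast]

/-- The sum in the definition of the `6j` coefficient. -/
noncomputable def sixSum (h : ℂ) (a b e d c f : ℚ) : ℂ :=
  ∑ z ∈ Finset.range (⌊a + c - f⌋₊ + 1),
    sgn (a + b + c + d + z) * qfact h (c + f - a + z) * rfact h z * rfact h (a + c - f - z) *
      rfact h (b + d - f - z) * qfact h (b + f - d + z) * qfact h (a + d + e - f - z) *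
      rfact h (e + f - a - d + z) * rfact h (2 * f + z + 1)

theorem Tetra.sixJ {h : ℂ} {a b e d c f : ℚ} (H : Tetra a b e d c f) :
    sixJ h a b e d c f =
      nabla h a c f * nabla h d b f / (nabla h a b e * nabla h d c e) * sixSum h a b e d c f :=
  if_pos H

theorem sixJ_of_not_tetra {h : ℂ} {a b e d c f : ℚ} (H : ¬ Tetra a b e d c f) :
    sixJ h a b e d c f = 0 := if_neg H

theorem sixSum_eq_bal {h : ℂ} (hq : Generic h) {a b e d c f : ℚ} (H : Tetra a b e d c f)
    {n : ℕ} (hn : a + c - f = n) :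
    sixSum h a b e d c f = sgn (a + b + c + d + n) * qfact h (c + f - a) * qfact h (b + f - d) *
      qfact h (d + e - c) * rfact h (b + d - f) * rfact h (e + c - d) * rfact h (a + c + f + 1) *
      bal h n (-(b + d - f)) (c + f - a + 1) (b + f - d + 1) (e + f - a - d + 1)
        (-(a + d + e - f)) (2 * f + 2) := by
  obtain ⟨t₁, t₂, t₃, t₄, q₁, q₂, q₃, e1, e2, e3, e4, e5, e6, e7⟩ := H.exists_nat
  obtain ⟨h1, h2, h3, h4⟩ := H
  rw [sixSum, bal, hn, Nat.floor_natCast, Finset.mul_sum]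
  refine Finset.sum_congr rfl fun k hk => ?_
  have hk := Nat.lt_succ_iff.1 (Finset.mem_range.1 hk)
  have a1 : a + d + e - f - n = d + e - c := by linarith
  have a2 : e + f - a - d + n = e + c - d := by linarith
  have a3 : 2 * f + 1 + n = a + c + f + 1 := by linarith
  have a4 : 2 * f + k + 1 = 2 * f + 1 + k := by ring
  have hsg : ∀ m : ℕ, sgn (a + b + c + d + m) = (-1) ^ (q₁ + m) := fun m => by
    rw [e5, ← sgn_natCast]; push_cast; rfl
  rw [a4, qfact_add_nat (by have := h2.isNat₁; exact this),
    qfact_add_nat (x := b + f - d) h3.isNat₁,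
    rfact_sub_nat hq (x := b + d - f) (by have := h3.isNat₃.isZ; convert this using 1; ring),
    qfact_sub_nat (n := n) (by rw [a1]; have := h4.isNat₂; convert this using 1; ring) hk,
    rfact_add_nat hq (x := e + f - a - d) (n := n)
      (by rw [a2]; have := h4.isNat₁; convert this using 1; ring) hk,
    rfact_add_nat hq (x := 2 * f + 1) (n := n)
      (by rw [a3]; obtain ⟨m, hm⟩ := h2.isNat; exact ⟨m + 1, by rw [hm]; push_cast; ring⟩) hk,
    a1, a2, a3, div_eq_mul_inv, ← rfact_nat_mul hk, hsg, hsg]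
  have c1 : (-1 : ℂ) ^ (q₁ + n) = (-1) ^ (q₁ + k) * (-1) ^ (n - k) := by
    rw [← pow_add]; congr 1; omega
  have b1 : 2 * f + 1 + 1 + (k : ℚ) = 2 * f + 2 + k := by ring
  rw [c1, b1]
  ring

/-- The `q`-`6j` coefficient in Racah's symmetric form. -/
theorem Tetra.sixJ_eq_racahJ {h : ℂ} (hq : Generic h) {a b e d c f : ℚ} (H : Tetra a b e d c f) :
    QuantumU2.sixJ h a b e d c f =
      tri h a b e * tri h a c f * tri h d b f * tri h d c e * racahJ h a b e d c f := by
  obtain ⟨n, hn⟩ := H.2.1.isNat₃.isZ.isNat (by linarith [H.2.1.le₃])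
  have hn : a + c - f = n := hn
  rw [H.sixJ, sixSum_eq_bal hq H hn, racahJ_eq_bal hq H hn]
  obtain ⟨h1, h2, h3, h4⟩ := H
  -- Up to a permutation of the denominators, Racah's form and the form in the definition are the
  -- two sides of one Sears transformation.
  have hb : bal h n (-(b + d - f)) (-(c + d - e)) (-(a + b - e)) (e + f - b - c + 1)
        (e + f - a - d + 1) (-(a + b + c + d) - 1) =
      bal h n (-(b + d - f)) (c + f - a + 1) (b + f - d + 1) (e + f - a - d + 1)
        (-(a + d + e - f)) (2 * f + 2) := by
    have e1 : ∀ x y z u v w, bal h n x y z u v w = bal h n x y z v u w := fun x y z u v w =>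
      Finset.sum_congr rfl fun k _ => by ring
    rw [e1, bal_sears hq n (by rw [← hn]; ring)]
    congr 1 <;> linarith
  have p1 : 0 ≤ b + d - f := by linarith [h3.le₃]
  have p2 : 0 ≤ e + c - d := by linarith [h4.le₁]
  have p3 : 0 ≤ a + c + f + 1 := by linarith [h2.isNat.nonneg]
  have p4 : 0 ≤ c + d - e := by linarith [h4.le₃]
  have p5 : 0 ≤ a + b - e := by linarith [h1.le₃]
  have p6 : 0 ≤ a + e - b := by linarith [h1.le₂]
  have p7 : 0 ≤ c + e - d := by linarith [h4.le₁]
  rw [hb, rfact_of_nonneg h p1, rfact_of_nonneg h p2, rfact_of_nonneg h p3,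
    rfact_of_nonneg h p4, rfact_of_nonneg h p5, rfact_of_nonneg h p6, rfact_of_nonneg h p7]
  have m1 := nabla_mul_tri hq a b e
  have m2 := nabla_mul_tri hq d c e
  have k1 := nabla_eq_tri hq a c f
  have k2 := nabla_eq_tri hq d b f
  have n1 := nabla_ne_zero hq a b e
  have n2 := nabla_ne_zero hq d c e
  have Q := qfact_ne_zero hq
  rw [show a - b + e = a + e - b by ring] at m1
  rw [show d + c - e = c + d - e by ring, show d - c + e = d + e - c by ring] at m2
  have x1 := eq_div_of_mul_eq n1 ((mul_comm _ _).trans m1)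
  have x2 := eq_div_of_mul_eq n2 ((mul_comm _ _).trans m2)
  rw [k1, k2, x1, x2, show e + c - d = c + e - d by ring]
  have := Q (b + d - f)
  have := Q (c + e - d)
  have := Q (a + c + f + 1)
  have := Q (c + d - e)
  have := Q (a + b - e)
  have := Q (a + e - b)
  have := Q (c + f - a)
  have := Q (b + f - d)
  field_simp

/-! ### Tetrahedral symmetries of the `6j` coefficient. -/

theorem racahJ_columns₁₂ (h : ℂ) (a b e d c f : ℚ) :
    racahJ h a b e d c f = racahJ h b a e c d f := by
  simp only [racahJ]
  rw [racah_perm_t₁₂, racah_perm_t₁₃, racah_perm_t₁₂, racah_perm_q₁₂, racah_perm_q₁₃,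
    racah_perm_q₁₂]
  congr 2 <;> ring

theorem racahJ_columns₂₃ (h : ℂ) (a b e d c f : ℚ) :
    racahJ h a b e d c f = racahJ h a e b d f c := by
  simp only [racahJ]
  rw [racah_perm_t₁₃, racah_perm_t₁₄, racah_perm_t₁₃, racah_perm_q₁₂]
  congr 2 <;> ring

theorem racahJ_flip (h : ℂ) (a b e d c f : ℚ) :
    racahJ h a b e d c f = racahJ h d c e a b f := by
  simp only [racahJ]
  rw [racah_perm_t₁₄, racah_perm_t₁₂, racah_perm_t₁₃, racah_perm_t₁₂]
  congr 2 <;> ring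

theorem tetra_columns₁₂ {a b e d c f : ℚ} : Tetra a b e d c f ↔ Tetra b a e c d f := by
  unfold Tetra
  rw [triangle_swap (a := a) (b := b), triangle_swap (a := d) (b := c),
    triangle_swap (a := a) (b := c), triangle_swap (a := d) (b := b)]
  tauto

theorem tetra_columns₂₃ {a b e d c f : ℚ} : Tetra a b e d c f ↔ Tetra a e b d f c := by
  unfold Tetra
  rw [triangle_swap' (a := a) (b := b), triangle_swap' (a := d) (b := c),
    triangle_swap' (a := a) (b := c), triangle_swap' (a := d) (b := b)]
  tauto

theorem tetra_flip {a b e d c f : ℚ} : Tetra a b e d c f ↔ Tetra d c e a b f := by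
  unfold Tetra
  tauto

theorem sixJ_columns₁₂ {h : ℂ} (hq : Generic h) (a b e d c f : ℚ) :
    sixJ h a b e d c f = sixJ h b a e c d f := by
  by_cases H : Tetra a b e d c f
  · rw [H.sixJ_eq_racahJ hq, (tetra_columns₁₂.1 H).sixJ_eq_racahJ hq, racahJ_columns₁₂,
      tri_swap h a b, tri_swap h d c, tri_swap h a c, tri_swap h d b]
    ring
  · rw [sixJ_of_not_tetra H, sixJ_of_not_tetra (mt tetra_columns₁₂.2 H)]

theorem sixJ_columns₂₃ {h : ℂ} (hq : Generic h) (a b e d c f : ℚ) :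
    sixJ h a b e d c f = sixJ h a e b d f c := by
  by_cases H : Tetra a b e d c f
  · rw [H.sixJ_eq_racahJ hq, (tetra_columns₂₃.1 H).sixJ_eq_racahJ hq, racahJ_columns₂₃,
      tri_swap' h a b, tri_swap' h d c, tri_swap' h a c, tri_swap' h d b]
    ring
  · rw [sixJ_of_not_tetra H, sixJ_of_not_tetra (mt tetra_columns₂₃.2 H)]

theorem sixJ_flip {h : ℂ} (hq : Generic h) (a b e d c f : ℚ) :
    sixJ h a b e d c f = sixJ h d c e a b f := by
  by_cases H : Tetra a b e d c f
  · rw [H.sixJ_eq_racahJ hq, (tetra_flip.1 H).sixJ_eq_racahJ hq, racahJ_flip]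
    ring
  · rw [sixJ_of_not_tetra H, sixJ_of_not_tetra (mt tetra_flip.2 H)]

/-! ### Stretched `6j` coefficients. -/

/-- The `6j` coefficient with the stretched triangle `f = a + c`. -/
theorem sixJ_stretched {h : ℂ} (hq : Generic h) {a b e d c f : ℚ} (H : Tetra a b e d c f)
    (hf : f = a + c) :
    sixJ h a b e d c f = sgn (a + b + c + d) * (sfact h (2 * a) * sfact h (2 * c) /
      sfact h (2 * f + 1)) * (nabla h f d b / (nabla h a b e * nabla h c d e)) := by
  rw [H.sixJ]
  obtain ⟨h1, h2, h3, h4⟩ := H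
  have f0 : a + c - f = 0 := by rw [hf]; ring
  have p1 : 0 ≤ b + d - f := by linarith [h3.le₃]
  have p2 : 0 ≤ e + f - a - d := by linarith [h4.le₁]
  have p3 : 0 ≤ 2 * f + 0 + 1 := by linarith [h2.2.2.1.nonneg]
  have Q := sfact_ne_zero hq
  have e0 : sfact h 0 = 1 := by simp [sfact]
  rw [sixSum, f0]
  simp only [Nat.floor_zero, zero_add, Finset.range_one, Finset.sum_singleton, Nat.cast_zero]
  rw [add_zero, add_zero, add_zero, add_zero, sub_zero, sub_zero, sub_zero,
    rfact_zero, rfact_of_nonneg h p1, rfact_of_nonneg h p2, rfact_of_nonneg h p3, add_zero]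
  simp only [nabla, qfact_eq_sfact]
  rw [f0, e0]
  have r1 : a - c + f = 2 * a := by rw [hf]; ring
  have r2 : a + c + f + 1 = 2 * f + 1 := by rw [hf]; ring
  have r3 : c + f - a = 2 * c := by rw [hf]; ring
  have r4 : a + d + e - f = d - c + e := by rw [hf]; ring
  have r5 : e + f - a - d = c + e - d := by rw [hf]; ring
  have r6 : d + b - f = b + d - f := by ring
  have r7 : d - b + f = f + d - b := by ring
  have r8 : d + b + f + 1 = f + d + b + 1 := by ring
  have r9 : b + f - d = f - d + b := by ring
  have r10 : c - d + e = c + e - d := by ring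
  have r11 : c + d - e = d + c - e := by ring
  have r12 : c + d + e + 1 = d + c + e + 1 := by ring
  have r13 : d + e - c = d - c + e := by ring
  rw [r1, r2, r3, r4, r5, r6, r7, r8, r9, r10, r11, r12, r13]
  have n1 := Q (2 * a)
  have n2 := Q (2 * c)
  have n3 := Q (2 * f + 1)
  have n4 := Q (b + d - f)
  have n5 := Q (c + e - d)
  have n6 := Q (d - c + e)
  have n7 := Q (f - d + b)
  have n8 := Q (d + c - e)
  have n9 := Q (d + c + e + 1)
  have n10 := Q (a + b - e)
  have n11 := Q (a - b + e)
  have n12 := Q (a + b + e + 1)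
  have n13 := Q (b + e - a)
  field_simp

theorem nabla_swap' (h : ℂ) (a b c : ℚ) : nabla h a b c = nabla h a c b := by
  rw [nabla, nabla, add_comm b c, show a + b - c = a - c + b by ring,
    show a - b + c = a + c - b by ring, show a + b + c + 1 = a + c + b + 1 by ring]; ring

/-! ### Signs -/

/-- `exp (π i x)`. -/
noncomputable def cis (x : ℚ) : ℂ := Complex.exp (Real.pi * Complex.I * x)

theorem cis_add (x y : ℚ) : cis (x + y) = cis x * cis y := by
  rw [cis, cis, cis, ← Complex.exp_add]; push_cast; ring_nf

theorem sgn_eq_cis {x : ℚ} (hx : IsZ x) : sgn x = cis x := by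
  obtain ⟨n, rfl⟩ := hx
  rw [sgn, Int.floor_intCast, cis, ← Complex.exp_pi_mul_I, ← Complex.exp_int_mul]
  push_cast; ring_nf

/-- The floor-based `sgn` is multiplicative only on integers, while `cis` is a homomorphism on all
rationals. Sign identities are therefore moved to `cis`, where a single parity check remains,
witnessed by `n`. -/
theorem cis_eq {x y : ℚ} (n : ℤ) (hn : x = y + 2 * n) : cis x = cis y := by
  rw [hn, cis_add, ← mul_one (cis y)]
  congr 1
  · simp
  · rw [cis, Complex.exp_eq_one_iff]
    exact ⟨n, by push_cast; ring⟩

/-! ### The sum over the intermediate spin -/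

/-- A summand of the `12j` coefficient. -/
noncomputable def twTerm (h : ℂ) (j1 j2 j3 j4 l1 l2 l3 l4 k1 k2 k3 k4 x : ℚ) : ℂ :=
  qnum h (2 * x + 1) *
    sgn (j1 + j2 + j3 + j4 + l1 + l2 + l3 + l4 + k1 + k2 + k3 + k4 - x) *
    qpow h (x * (x + 1) + Z [j1, j2, j3, j4] + Z [k1, k2, k3, k4]) *
    sixJ h j1 j2 l1 k2 k1 x * sixJ h j3 k3 x k2 j2 l2 *
    sixJ h j3 j4 l3 k4 k3 x * sixJ h k1 j1 x k4 j4 l4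

/-- A sum over the spins `0, 1/2, …, s`. -/
noncomputable def spinSum (s : ℚ) (f : ℚ → ℂ) : ℂ :=
  ∑ t ∈ Finset.range (⌊2 * s⌋₊ + 1), f ((t : ℚ) / 2)

theorem twelveJ_eq_spinSum (h : ℂ) (j1 j2 j3 j4 l1 l2 l3 l4 k1 k2 k3 k4 : ℚ) :
    twelveJ h j1 j2 j3 j4 l1 l2 l3 l4 k1 k2 k3 k4 =
      spinSum (j1 + k1) (twTerm h j1 j2 j3 j4 l1 l2 l3 l4 k1 k2 k3 k4) := rfl

theorem spinSum_eq_single {s : ℚ} {f : ℚ → ℂ} {x : ℚ} (hx : IsSpin x) (hxs : x ≤ s)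
    (h0 : ∀ y, IsSpin y → y ≠ x → f y = 0) : spinSum s f = f x := by
  obtain ⟨n, rfl⟩ := hx
  refine Finset.sum_eq_single n (fun t _ ht => h0 _ ⟨t, rfl⟩ fun e => ht ?_) fun hn => ?_
  · have : (t : ℚ) = n := by linarith
    exact_mod_cast this
  · refine absurd (Finset.mem_range.2 (Nat.lt_succ_iff.2 (Nat.le_floor ?_))) hn
    linarith

/-- Since the terms beyond either limit vanish, both sums extend to the larger of the two limits. -/
theorem spinSum_congr {s s' : ℚ} {f g : ℚ → ℂ} (hfg : ∀ x, IsSpin x → f x = g x)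
    (hs : ∀ x, s < x → f x = 0) (hs' : ∀ x, s' < x → g x = 0) : spinSum s f = spinSum s' g := by
  have ext : ∀ (u : ℚ) (F : ℚ → ℂ) (K : ℕ), (∀ x, u < x → F x = 0) → ⌊2 * u⌋₊ ≤ K →
      spinSum u F = ∑ t ∈ Finset.range (K + 1), F ((t : ℚ) / 2) := by
    intro u F K hu hK
    refine Finset.sum_subset (Finset.range_subset_range.2 (by omega)) fun t _ ht => hu _ ?_
    have := Nat.lt_of_floor_lt (a := 2 * u) (n := t) (by rw [Finset.mem_range] at ht; omega)
    linarith
  rw [ext s f (max ⌊2 * s⌋₊ ⌊2 * s'⌋₊) hs (le_max_left _ _),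
    ext s' g (max ⌊2 * s⌋₊ ⌊2 * s'⌋₊) hs' (le_max_right _ _)]
  exact Finset.sum_congr rfl fun t _ => hfg _ ⟨t, rfl⟩

theorem twTerm_tetra {h : ℂ} {j1 j2 j3 j4 l1 l2 l3 l4 k1 k2 k3 k4 x : ℚ}
    (hx : twTerm h j1 j2 j3 j4 l1 l2 l3 l4 k1 k2 k3 k4 x ≠ 0) :
    Tetra j1 j2 l1 k2 k1 x ∧ Tetra j3 k3 x k2 j2 l2 ∧ Tetra j3 j4 l3 k4 k3 x ∧
      Tetra k1 j1 x k4 j4 l4 := by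
  refine ⟨?_, ?_, ?_, ?_⟩ <;> by_contra H <;> refine hx ?_ <;>
    rw [twTerm, sixJ_of_not_tetra H] <;> ring

theorem Triangle.mk' {a b c : ℚ} (ha : IsSpin a) (hb : IsSpin b) (hc : IsSpin c)
    (hz : IsZ (a + b + c)) (h1 : a ≤ b + c) (h2 : b ≤ a + c) (h3 : c ≤ a + b) : Triangle a b c :=
  ⟨ha, hb, hc, hz, abs_le.2 ⟨by linarith, by linarith⟩, h3⟩

theorem Triangle.rot {a b c : ℚ} (H : Triangle a b c) : Triangle b c a := H.swap.swap'

theorem Triangle.rev {a b c : ℚ} (H : Triangle a b c) : Triangle c b a := H.rot.swap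

theorem IsNat.isSpin {x : ℚ} (hx : IsNat (2 * x)) : IsSpin x := by
  obtain ⟨n, hn⟩ := hx; exact ⟨n, by linarith⟩

theorem IsSpin.add {x y : ℚ} (hx : IsSpin x) (hy : IsSpin y) : IsSpin (x + y) := by
  obtain ⟨n, rfl⟩ := hx; obtain ⟨m, rfl⟩ := hy; exact ⟨n + m, by push_cast; ring⟩

theorem sfact_two_mul_add_one (h : ℂ) {x : ℚ} (hx : IsSpin x) :
    sfact h (2 * x + 1) = sfact h (2 * x) * qsqrt h (2 * x + 1) := by
  obtain ⟨n, hn⟩ := hx.two_mul_isNat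
  rw [hn, sfact_natCast_succ]

theorem qnum_mul_sfact_sq (h : ℂ) {x : ℚ} (hx : IsSpin x) :
    qnum h (2 * x + 1) * (sfact h (2 * x) * sfact h (2 * x)) =
      sfact h (2 * x + 1) * sfact h (2 * x + 1) := by
  rw [sfact_two_mul_add_one h hx, ← qsqrt_sq]; ring

/-- A cancellation device: `u` collects quotients equal to `1` and squares of signs, so that `x = u
* y` follows from `ring` with inverses treated as atoms. -/
theorem eq_of_eq_mul_one {x y u : ℂ} (hu : u = 1) (hx : x = u * y) : x = y := by
  rw [hx, hu, one_mul]

theorem sixJ_flip₂₃ {h : ℂ} (hq : Generic h) (a b e d c f : ℚ) :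
    sixJ h a b e d c f = sixJ h a c f d b e := by
  rw [sixJ_columns₁₂ hq, sixJ_columns₂₃ hq, sixJ_flip hq, sixJ_columns₂₃ hq, sixJ_columns₁₂ hq]

theorem sixJ_flip₁₃ {h : ℂ} (hq : Generic h) (a b e d c f : ℚ) :
    sixJ h a b e d c f = sixJ h d b f a c e := by
  rw [sixJ_columns₂₃ hq, sixJ_flip hq, sixJ_columns₂₃ hq]

theorem sixJ_columns₁₃ {h : ℂ} (hq : Generic h) (a b e d c f : ℚ) :
    sixJ h a b e d c f = sixJ h e b a f c d := by
  rw [sixJ_columns₁₂ hq, sixJ_columns₂₃ hq, sixJ_columns₁₂ hq]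

theorem tetra_flip₂₃ {a b e d c f : ℚ} : Tetra a b e d c f ↔ Tetra a c f d b e := by
  unfold Tetra; tauto

theorem tetra_flip₁₃ {a b e d c f : ℚ} : Tetra a b e d c f ↔ Tetra d b f a c e := by
  unfold Tetra; tauto

theorem tetra_columns₁₃ {a b e d c f : ℚ} : Tetra a b e d c f ↔ Tetra e b a f c d := by
  rw [tetra_columns₁₂, tetra_columns₂₃, tetra_columns₁₂]

/-- This and the following variants transport `sixJ_stretched` along the symmetries to the positions
at which a spin gets stretched in the four factors of the `12j` coefficient. -/
theorem sixJ_stretched_e_ab {h : ℂ} (hq : Generic h) {a b e d c f : ℚ} (H : Tetra a b e d c f)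
    (hf : e = a + b) :
    sixJ h a b e d c f = sgn (a + c + b + d) * (sfact h (2 * a) * sfact h (2 * b) /
      sfact h (2 * e + 1)) * (nabla h e d c / (nabla h a c f * nabla h b d f)) := by
  rw [sixJ_flip₂₃ hq, sixJ_stretched hq (tetra_flip₂₃.1 H) hf]

theorem sixJ_stretched_e_dc {h : ℂ} (hq : Generic h) {a b e d c f : ℚ} (H : Tetra a b e d c f)
    (hf : e = d + c) :
    sixJ h a b e d c f = sgn (d + b + c + a) * (sfact h (2 * d) * sfact h (2 * c) /
      sfact h (2 * e + 1)) * (nabla h e a b / (nabla h d b f * nabla h c a f)) := by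
  rw [sixJ_flip₁₃ hq, sixJ_stretched hq (tetra_flip₁₃.1 H) hf]

theorem sixJ_stretched_d_ec {h : ℂ} (hq : Generic h) {a b e d c f : ℚ} (H : Tetra a b e d c f)
    (hf : d = e + c) :
    sixJ h a b e d c f = sgn (e + b + c + f) * (sfact h (2 * e) * sfact h (2 * c) /
      sfact h (2 * d + 1)) * (nabla h d f b / (nabla h e b a * nabla h c f a)) := by
  rw [sixJ_columns₁₃ hq, sixJ_stretched hq (tetra_columns₁₃.1 H) hf]

theorem sixJ_stretched_d_fb {h : ℂ} (hq : Generic h) {a b e d c f : ℚ} (H : Tetra a b e d c f)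
    (hf : d = f + b) :
    sixJ h a b e d c f = sgn (f + c + b + e) * (sfact h (2 * f) * sfact h (2 * b) /
      sfact h (2 * d + 1)) * (nabla h d e c / (nabla h f c a * nabla h b e a)) := by
  rw [sixJ_columns₁₃ hq, sixJ_flip hq, sixJ_stretched hq (tetra_flip.1 (tetra_columns₁₃.1 H)) hf]

theorem sixJ_stretched_a_cf {h : ℂ} (hq : Generic h) {a b e d c f : ℚ} (H : Tetra a b e d c f)
    (hf : a = f + c) :
    sixJ h a b e d c f = sgn (f + b + c + e) * (sfact h (2 * f) * sfact h (2 * c) /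
      sfact h (2 * a + 1)) * (nabla h a e b / (nabla h f b d * nabla h c e d)) := by
  rw [sixJ_columns₁₃ hq, sixJ_flip₁₃ hq,
    sixJ_stretched hq (tetra_flip₁₃.1 (tetra_columns₁₃.1 H)) hf]

theorem sixJ_stretched_a_be {h : ℂ} (hq : Generic h) {a b e d c f : ℚ} (H : Tetra a b e d c f)
    (hf : a = e + b) :
    sixJ h a b e d c f = sgn (e + c + b + f) * (sfact h (2 * e) * sfact h (2 * b) /
      sfact h (2 * a + 1)) * (nabla h a f c / (nabla h e c d * nabla h b f d)) := by
  rw [sixJ_columns₁₃ hq, sixJ_flip₂₃ hq,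
    sixJ_stretched hq (tetra_flip₂₃.1 (tetra_columns₁₃.1 H)) hf]

/-- Later integrality and parity claims are integer combinations of these perimeters and doubled
spins, together with one integer involving `x` when it occurs. The explicit coefficient tuples in
the proofs below are such combinations. -/
theorem Admissible.exists_int {j1 j2 j3 j4 l1 l2 l3 l4 k1 k2 k3 k4 : ℚ}
    (H : Admissible j1 j2 j3 j4 l1 l2 l3 l4 k1 k2 k3 k4) :
    ∃ m1 m2 m3 m4 m5 m6 m7 m8 J1 J2 J3 J4 K1 K2 K3 K4 L1 L2 L3 L4 : ℤ,
      (l1 + j1 + j2 = m1 ∧ l2 + j2 + j3 = m2 ∧ l3 + j3 + j4 = m3 ∧ l4 + j1 + k4 = m4 ∧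
      l1 + k1 + k2 = m5 ∧ l2 + k2 + k3 = m6 ∧ l3 + k3 + k4 = m7 ∧ l4 + k1 + j4 = m8) ∧
      (2 * j1 = J1 ∧ 2 * j2 = J2 ∧ 2 * j3 = J3 ∧ 2 * j4 = J4) ∧
      (2 * k1 = K1 ∧ 2 * k2 = K2 ∧ 2 * k3 = K3 ∧ 2 * k4 = K4) ∧
      (2 * l1 = L1 ∧ 2 * l2 = L2 ∧ 2 * l3 = L3 ∧ 2 * l4 = L4) := by
  obtain ⟨h1, h2, h3, h4, h5, h6, h7, h8⟩ := H
  obtain ⟨m1, e1⟩ := h1.isZ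
  obtain ⟨m2, e2⟩ := h2.isZ
  obtain ⟨m3, e3⟩ := h3.isZ
  obtain ⟨m4, e4⟩ := h4.isZ
  obtain ⟨m5, e5⟩ := h5.isZ
  obtain ⟨m6, e6⟩ := h6.isZ
  obtain ⟨m7, e7⟩ := h7.isZ
  obtain ⟨m8, e8⟩ := h8.isZ
  obtain ⟨J1, f1⟩ := h1.2.1.two_mul_isNat.isZ
  obtain ⟨J2, f2⟩ := h1.2.2.1.two_mul_isNat.isZ
  obtain ⟨J3, f3⟩ := h2.2.2.1.two_mul_isNat.isZ
  obtain ⟨J4, f4⟩ := h3.2.2.1.two_mul_isNat.isZ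
  obtain ⟨K1, g1⟩ := h5.2.1.two_mul_isNat.isZ
  obtain ⟨K2, g2⟩ := h5.2.2.1.two_mul_isNat.isZ
  obtain ⟨K3, g3⟩ := h6.2.2.1.two_mul_isNat.isZ
  obtain ⟨K4, g4⟩ := h7.2.2.1.two_mul_isNat.isZ
  obtain ⟨L1, i1⟩ := h1.1.two_mul_isNat.isZ
  obtain ⟨L2, i2⟩ := h2.1.two_mul_isNat.isZ
  obtain ⟨L3, i3⟩ := h3.1.two_mul_isNat.isZ
  obtain ⟨L4, i4⟩ := h4.1.two_mul_isNat.isZ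
  exact ⟨m1, m2, m3, m4, m5, m6, m7, m8, J1, J2, J3, J4, K1, K2, K3, K4, L1, L2, L3, L4,
    ⟨e1, e2, e3, e4, e5, e6, e7, e8⟩, ⟨f1, f2, f3, f4⟩, ⟨g1, g2, g3, g4⟩, i1, i2, i3, i4⟩

/-! ### The cases with a single intermediate spin. -/

/-- The triangle `(j₁, k₁, x)` gives `x ≤ j₁ + k₁`, and `(j₃, k₃, x)` gives `x ≥ j₃ - k₃ = j₁ + k₁`.
At the only surviving `x` all four `6j` factors are stretched. -/
theorem twelveJ_virtually_stretched {h : ℂ} (hq : Generic h)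
    {j1 j2 j3 j4 l1 l2 l3 l4 k1 k2 k3 k4 : ℚ}
    (hadm : Admissible j1 j2 j3 j4 l1 l2 l3 l4 k1 k2 k3 k4) (hj : j3 = j1 + k1 + k3) :
    twelveJ h j1 j2 j3 j4 l1 l2 l3 l4 k1 k2 k3 k4 =
        sgn (j2 + j4 - l1 - k1 - j1 - l4) *
        (qpow h (2 * j1 * k1 + Z [j2, j3, j4] + Z [k2, k3, k4]) *
          qfact h (2 * j1) * qfact h (2 * k1) * qfact h (2 * k3) *
          nabla h j3 j4 l3 * nabla h j3 j2 l2 /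
          (qfact h (2 * j3 + 1) * nabla h j1 j2 l1 * nabla h k1 k2 l1 * nabla h j1 k4 l4 *
            nabla h k1 j4 l4 * nabla h k3 k2 l2 * nabla h k3 k4 l3)) := by
  obtain ⟨m1, m2, m3, m4, m5, m6, m7, m8, J1, J2, J3, J4, K1, K2, K3, K4, L1, L2, L3, L4,
    ⟨e1, e2, e3, e4, e5, e6, e7, e8⟩, ⟨f1, f2, f3, f4⟩, ⟨g1, g2, g3, g4⟩, i1, i2, i3, i4⟩ :=
    hadm.exists_int
  obtain ⟨h1, h2, h3, h4, h5, h6, h7, h8⟩ := hadm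
  obtain ⟨u1, v1, w1⟩ := h1.le
  obtain ⟨u2, v2, w2⟩ := h2.le
  obtain ⟨u3, v3, w3⟩ := h3.le
  obtain ⟨u4, v4, w4⟩ := h4.le
  obtain ⟨u5, v5, w5⟩ := h5.le
  obtain ⟨u6, v6, w6⟩ := h6.le
  obtain ⟨u7, v7, w7⟩ := h7.le
  obtain ⟨u8, v8, w8⟩ := h8.le
  have s1 := h1.2.1
  have s2 := h5.2.1
  have sx : IsSpin (j1 + k1) := s1.add s2
  obtain ⟨x, hx⟩ : ∃ x, x = j1 + k1 := ⟨_, rfl⟩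
  rw [← hx] at sx
  have tx2 : Triangle k2 j2 x := .mk' h5.2.2.1 h1.2.2.1 sx
    ⟨(-1) * m1 + m3 + m4 + m5 + (-1) * m7 + (-1) * m8 + J2, by push_cast; linarith⟩
    (by linarith) (by linarith) (by linarith)
  have sg : sgn (j1 + j2 + j3 + j4 + l1 + l2 + l3 + l4 + k1 + k2 + k3 + k4 - x) * sgn (j1 + j2 + k1 + k2) * sgn (x + j2 + k3 + l2) * sgn (x + j4 + k3 + l3) * sgn (k1 + j4 + j1 + k4) = sgn (j2 + j4 - l1 - k1 - j1 - l4) := by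
    rw [sgn_eq_cis (x := j1 + j2 + j3 + j4 + l1 + l2 + l3 + l4 + k1 + k2 + k3 + k4 - x) ⟨m1 + m6 + m7 + m8, by push_cast; linarith⟩,
      sgn_eq_cis (x := j1 + j2 + k1 + k2) ⟨(-1) * m1 + m3 + m4 + m5 + (-1) * m7 + (-1) * m8 + J2, by push_cast; linarith⟩,
      sgn_eq_cis (x := x + j2 + k3 + l2) ⟨m2, by linarith⟩,
      sgn_eq_cis (x := x + j4 + k3 + l3) ⟨m3, by linarith⟩,
      sgn_eq_cis (x := k1 + j4 + j1 + k4) ⟨(-1) * m1 + m2 + m4 + m5 + (-1) * m6 + (-1) * m8 + J4, by push_cast; linarith⟩,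
      sgn_eq_cis (x := j2 + j4 - l1 - k1 - j1 - l4) ⟨(-1) * m1 + (-1) * m8 + J2 + J4, by push_cast; linarith⟩,
      ← cis_add, ← cis_add, ← cis_add, ← cis_add]
    exact cis_eq (m2 + m3 + m4 + m5) (by push_cast; linarith)
  have tx4 : Triangle k4 j4 x := .mk' h4.2.2.1 h3.2.2.1 sx
    ⟨(-1) * m1 + m2 + m4 + m5 + (-1) * m6 + (-1) * m8 + J4, by push_cast; linarith⟩
    (by linarith) (by linarith) (by linarith)
  have tx1 : Triangle j1 k1 x := .mk' s1 s2 sx ⟨J1 + K1, by push_cast; linarith⟩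
    (by linarith [s2.nonneg]) (by linarith [s1.nonneg]) (by linarith)
  have tx3 : Triangle j3 k3 x := .mk' h2.2.2.1 h6.2.2.1 sx ⟨J3, by linarith⟩
    (by linarith) (by linarith [sx.nonneg, h2.2.2.1.nonneg]) (by linarith [h6.2.2.1.nonneg])
  have T1 : Tetra j1 j2 l1 k2 k1 x := ⟨h1.rot, tx1, tx2, h5.rev⟩
  have T2 : Tetra j3 k3 x k2 j2 l2 := ⟨tx3, h2.rev, h6.rot, tx2⟩
  have T3 : Tetra j3 j4 l3 k4 k3 x := ⟨h3.rot, tx3, tx4, h7.rev⟩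
  have T4 : Tetra k1 j1 x k4 j4 l4 := ⟨tx1.swap, h8.rot, h4.rev, tx4⟩
  rw [twelveJ_eq_spinSum, spinSum_eq_single (x := x) sx (by linarith)]
  · rw [twTerm, sixJ_stretched hq T1 hx, sixJ_stretched_a_be hq T2 (by linarith),
      sixJ_stretched_a_cf hq T3 (by linarith), sixJ_stretched_e_ab hq T4 (by linarith)]
    have hZ : x * (x + 1) + Z [j1, j2, j3, j4] + Z [k1, k2, k3, k4] =
        2 * j1 * k1 + Z [j2, j3, j4] + Z [k2, k3, k4] := by
      simp only [Z, List.map_cons, List.map_nil, List.sum_cons, List.sum_nil]; rw [hx]; ring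
    rw [hZ, ← sg, nabla_swap' h x j2 k2, nabla_swap' h k3 l2 k2, nabla_swap' h k3 l3 k4,
      nabla_swap' h x j4 k4, nabla_swap' h j3 l2 j2, nabla_swap' h j3 l3 j4]
    simp only [qfact_eq_sfact]
    -- The weight `[2x+1]` absorbs the two quotients `sfact (2x) / sfact (2x+1)` left by the four
    -- stretched factors, and the `∇` containing `x` cancel in pairs.
    refine eq_of_eq_mul_one (u := qnum h (2 * x + 1) * (sfact h (2 * x) * sfact h (2 * x)) /
          (sfact h (2 * x + 1) * sfact h (2 * x + 1)) * (nabla h x k2 j2 / nabla h x k2 j2) *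
          (nabla h x k4 j4 / nabla h x k4 j4)) ?_ (by ring)
    rw [qnum_mul_sfact_sq h sx, div_self (nabla_ne_zero hq _ _ _),
      div_self (nabla_ne_zero hq _ _ _),
      div_self (mul_self_ne_zero.2 (sfact_ne_zero hq _)), one_mul, one_mul]
  · intro y _ hy
    by_contra H
    obtain ⟨T1', T2', _, _⟩ := twTerm_tetra H
    exact hy (le_antisymm (by linarith [T1'.2.1.le₃]) (by linarith [T2'.1.le₁]))

theorem sfact_zero (h : ℂ) : sfact h 0 = 1 := by simp [sfact]

theorem nabla_of_eq_add (h : ℂ) {a b c : ℚ} (e : a = b + c) :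
    nabla h a b c = sfact h (2 * b) * sfact h (2 * c) * sfact h (2 * a + 1) := by
  rw [nabla, e, show b + c + b - c = 2 * b by ring, show b + c - b + c = 2 * c by ring,
    show b + c + b + c + 1 = 2 * (b + c) + 1 by ring, show b + c - (b + c) = 0 by ring,
    sfact_zero, div_one]

theorem nabla_of_eq_add' (h : ℂ) {a b c : ℚ} (e : b = a + c) :
    nabla h a b c = sfact h (2 * a) * sfact h (2 * b + 1) / sfact h (2 * c) := by
  rw [nabla, e, show a + (a + c) - c = 2 * a by ring, show a - (a + c) + c = 0 by ring,
    show a + (a + c) + c + 1 = 2 * (a + c) + 1 by ring, show a + c + c - a = 2 * c by ring,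
    sfact_zero, mul_one]

/-- The triangles `(j₁, k₁, x)` and `(k₂, j₂, x)` bound `x` by `k₁ + j₁` from above and from below.
Three factors are then stretched and the fourth survives as the `6j` coefficient of the result. -/
theorem twelveJ_stretched_sixJ {h : ℂ} (hq : Generic h)
    {j1 j2 j3 j4 l1 l2 l3 l4 k1 k2 k3 k4 : ℚ}
    (hadm : Admissible j1 j2 j3 j4 l1 l2 l3 l4 k1 k2 k3 k4) (hl : l1 = j1 + j2)
    (hk : k2 = k1 + l1) :
    twelveJ h j1 j2 j3 j4 l1 l2 l3 l4 k1 k2 k3 k4 =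
        sgn (k1 + j3 - l3 - l4 + 2 * k3) *
        (qpow h (2 * j1 * k1 + Z [j2, j3, j4] + Z [k2, k3, k4]) *
          nabla h k2 k3 l2 * nabla h (k1 + j1) j4 k4 /
          (nabla h j1 k4 l4 * nabla h j2 l2 j3 * nabla h k1 j4 l4 * nabla h (k1 + j1) j3 k3)) *
        (sfact h (2 * j2) * sfact h (2 * j1) * sfact h (2 * k1) /
          (sfact h (2 * k2 + 1) * qsqrt h (2 * l1 + 1))) *
        sixJ h j3 j4 l3 k4 k3 (k1 + j1) := by
  obtain ⟨m1, m2, m3, m4, m5, m6, m7, m8, J1, J2, J3, J4, K1, K2, K3, K4, L1, L2, L3, L4,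
    ⟨e1, e2, e3, e4, e5, e6, e7, e8⟩, ⟨f1, f2, f3, f4⟩, ⟨g1, g2, g3, g4⟩, i1, i2, i3, i4⟩ :=
    hadm.exists_int
  obtain ⟨h1, h2, h3, h4, h5, h6, h7, h8⟩ := hadm
  obtain ⟨u1, v1, w1⟩ := h1.le
  obtain ⟨u2, v2, w2⟩ := h2.le
  obtain ⟨u3, v3, w3⟩ := h3.le
  obtain ⟨u4, v4, w4⟩ := h4.le
  obtain ⟨u5, v5, w5⟩ := h5.le
  obtain ⟨u6, v6, w6⟩ := h6.le
  obtain ⟨u7, v7, w7⟩ := h7.le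
  obtain ⟨u8, v8, w8⟩ := h8.le
  have s1 := h1.2.1
  have s2 := h5.2.1
  have sx : IsSpin (k1 + j1) := s2.add s1
  obtain ⟨x, hx⟩ : ∃ x, x = k1 + j1 := ⟨_, rfl⟩
  rw [← hx] at sx ⊢
  rw [twelveJ_eq_spinSum, spinSum_eq_single (x := x) sx (by linarith)]
  -- If the surviving tetrahedron is not admissible, both sides vanish. Otherwise it supplies the
  -- two triangles through `x` that the other tetrahedra still lack.
  · by_cases T3 : Tetra j3 j4 l3 k4 k3 x
    swap
    · rw [twTerm, sixJ_of_not_tetra T3]; ring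
    have tx2 : Triangle k2 j2 x := .mk' h5.2.2.1 h1.2.2.1 sx ⟨K2, by linarith⟩
      (by linarith) (by linarith [sx.nonneg]) (by linarith [h1.2.2.1.nonneg])
    have tx1 : Triangle j1 k1 x := .mk' s1 s2 sx ⟨J1 + K1, by push_cast; linarith⟩
      (by linarith [s2.nonneg]) (by linarith [s1.nonneg]) (by linarith)
    have tx3 := T3.2.1
    have tx4 := T3.2.2.1
    have T1 : Tetra j1 j2 l1 k2 k1 x := ⟨h1.rot, tx1, tx2, h5.rev⟩
    have T2 : Tetra j3 k3 x k2 j2 l2 := ⟨tx3, h2.rev, h6.rot, tx2⟩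
    have T4 : Tetra k1 j1 x k4 j4 l4 := ⟨tx1.swap, h8.rot, h4.rev, tx4⟩
    have sg : sgn (j1 + j2 + j3 + j4 + l1 + l2 + l3 + l4 + k1 + k2 + k3 + k4 - x) * sgn (l1 + j2 + k1 + x) * sgn (x + k3 + j2 + l2) * sgn (k1 + j4 + j1 + k4) = sgn (k1 + j3 - l3 - l4 + 2 * k3) := by
      rw [sgn_eq_cis (x := j1 + j2 + j3 + j4 + l1 + l2 + l3 + l4 + k1 + k2 + k3 + k4 - x) ⟨m1 + m2 + m7 + m8, by push_cast; linarith⟩,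
        sgn_eq_cis (x := l1 + j2 + k1 + x) ⟨m5, by linarith⟩,
        sgn_eq_cis (x := x + k3 + j2 + l2) ⟨m6, by linarith⟩,
        sgn_eq_cis (x := k1 + j4 + j1 + k4) ⟨(-1) * m1 + m4 + m5 + (-1) * m8 + J4, by push_cast; linarith⟩,
        sgn_eq_cis (x := k1 + j3 - l3 - l4 + 2 * k3) ⟨(-1) * m2 + (-2) * m3 + (-1) * m4 + m6 + m7 + (2) * J3 + J4, by push_cast; linarith⟩,
        ← cis_add, ← cis_add, ← cis_add]
      exact cis_eq (m2 + m3 + m4 + m5 + (-1) * J3) (by push_cast; linarith)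
    rw [twTerm, sixJ_stretched_d_ec hq T1 (by linarith), sixJ_stretched_d_ec hq T2 (by linarith),
      sixJ_stretched_e_ab hq T4 hx]
    have hZ : x * (x + 1) + Z [j1, j2, j3, j4] + Z [k1, k2, k3, k4] =
        2 * j1 * k1 + Z [j2, j3, j4] + Z [k2, k3, k4] := by
      simp only [Z, List.map_cons, List.map_nil, List.sum_cons, List.sum_nil]; rw [hx]; ring
    rw [hZ, ← sg, nabla_swap' h k2 l2 k3, nabla_swap' h x k3 j3, nabla_swap' h x k4 j4,
      nabla_of_eq_add h (show k2 = x + j2 by linarith),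
      nabla_of_eq_add h (show l1 = j2 + j1 by linarith), nabla_of_eq_add' h hx,
      sfact_two_mul_add_one h h1.1]
    have Q := sfact_ne_zero hq
    refine eq_of_eq_mul_one (u := qnum h (2 * x + 1) * (sfact h (2 * x) * sfact h (2 * x)) /
          (sfact h (2 * x + 1) * sfact h (2 * x + 1)) * (sfact h (2 * k1) / sfact h (2 * k1)) *
          (sfact h (2 * j2) / sfact h (2 * j2)) * (sfact h (2 * j1) / sfact h (2 * j1)) *
          (sfact h (2 * k2 + 1) / sfact h (2 * k2 + 1)) *
          (sfact h (2 * l1) / sfact h (2 * l1))) ?_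
      (by simp only [div_eq_mul_inv, mul_inv, inv_inv]; ring)
    rw [qnum_mul_sfact_sq h sx, div_self (Q _), div_self (Q _), div_self (Q _), div_self (Q _),
      div_self (Q _), div_self (mul_self_ne_zero.2 (Q _))]
    norm_num
  · intro y _ hy
    by_contra H
    obtain ⟨T1', _, _, _⟩ := twTerm_tetra H
    exact hy (le_antisymm (by linarith [T1'.2.1.le₃]) (by linarith [T1'.2.2.1.le₁]))

/-! ### The cases that reduce to a `9j` coefficient. -/

/-- A summand of the `9j` coefficient. -/
noncomputable def nineTerm (h : ℂ) (a b e c d f r k g j : ℚ) : ℂ :=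
  sgn (2 * j) * qpow h (Z [d, e, r] - j * (j + 1)) * qnum h (2 * j + 1) *
    sixJ h a c r k g j * sixJ h k j c f d b * sixJ h a g j f b e

theorem nineJ_eq_spinSum (h : ℂ) (a b e c d f r k g : ℚ) :
    nineJ h a b e c d f r k g = spinSum (a + g) (nineTerm h a b e c d f r k g) := rfl

theorem qpow_neg_left (h : ℂ) (x : ℚ) : qpow (-h) x = qpow h (-x) := by simp [qpow]

theorem sixJ_neg_left (h : ℂ) (a b e d c f : ℚ) : sixJ (-h) a b e d c f = sixJ h a b e d c f := by
  simp only [sixJ, nabla, sfact, qsqrt, qfact, rfact, qnum_neg_left]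

theorem spinSum_const_mul (c : ℂ) (u : ℚ) (f : ℚ → ℂ) :
    c * spinSum u f = spinSum u fun x => c * f x := Finset.mul_sum _ _ _

theorem eq_of_mul_eq_mul_one {x y u v : ℂ} (hu : u = 1) (hv : v = 1) (hx : x * v = u * y) :
    x = y := by
  rwa [hu, hv, mul_one, one_mul] at hx

/-- Two `6j` factors are common to both sides. The other two of the `12j` are stretched, and since
`∇[j₁ x k₁]` cancels between them, their product is, up to sign and factors free of `x`, the third
`6j` of the `9j`, which is stretched by `k₄ = (l₁ + l₄) + j₂`. Changing `h` to `-h` leaves `6j`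
coefficients fixed and only corrects the weight `q^{-x(x+1)}`. -/
theorem twTerm_stretched_nineTerm₁ {h : ℂ} (hq : Generic h)
    {j1 j2 j3 j4 l1 l2 l3 l4 k1 k2 k3 k4 : ℚ}
    (hadm : Admissible j1 j2 j3 j4 l1 l2 l3 l4 k1 k2 k3 k4) (hk : k4 = l4 + j1)
    (hj : j1 = l1 + j2) {x : ℚ} (sx : IsSpin x) :
    twTerm h j1 j2 j3 j4 l1 l2 l3 l4 k1 k2 k3 k4 x =
      sgn (j3 + j4 - l3 + l2 + k2 - k3) *
        qpow h (Z [j1, j2, j3, j4] + Z [k1, k2, k3, k4] + Z [l2, l3, l1 + l4]) *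
        (nabla h (l1 + l4) j4 k2 / (nabla h l1 k1 k2 * nabla h l4 k1 j4)) *
        (sfact h (2 * l1) * sfact h (2 * l4) / (sfact h (2 * l1 + 2 * l4) * qsqrt h (2 * j1 + 1))) *
      nineTerm (-h) k4 k3 l3 j2 l2 j3 (l1 + l4) k2 j4 x := by
  obtain ⟨m1, m2, m3, m4, m5, m6, m7, m8, J1, J2, J3, J4, K1, K2, K3, K4, L1, L2, L3, L4,
    ⟨e1, e2, e3, e4, e5, e6, e7, e8⟩, ⟨f1, f2, f3, f4⟩, ⟨g1, g2, g3, g4⟩, i1, i2, i3, i4⟩ :=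
    hadm.exists_int
  obtain ⟨h1, h2, h3, h4, h5, h6, h7, h8⟩ := hadm
  obtain ⟨u1, v1, w1⟩ := h1.le
  obtain ⟨u2, v2, w2⟩ := h2.le
  obtain ⟨u3, v3, w3⟩ := h3.le
  obtain ⟨u4, v4, w4⟩ := h4.le
  obtain ⟨u5, v5, w5⟩ := h5.le
  obtain ⟨u6, v6, w6⟩ := h6.le
  obtain ⟨u7, v7, w7⟩ := h7.le
  obtain ⟨u8, v8, w8⟩ := h8.le
  have sr : IsSpin (l1 + l4) := h1.1.add h4.1
  have tr : Triangle k4 j2 (l1 + l4) := .mk' h4.2.2.1 h1.2.2.1 sr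
    ⟨m4, by linarith⟩ (by linarith) (by linarith [sr.nonneg])
    (by linarith [h1.2.2.1.nonneg])
  rw [nineTerm, sixJ_neg_left, sixJ_neg_left, sixJ_neg_left, qpow_neg_left, qnum_neg_left]
  have p2 : sixJ h k2 x j2 j3 l2 k3 = sixJ h j3 k3 x k2 j2 l2 := by
    rw [sixJ_columns₂₃ hq, sixJ_flip₁₃ hq, sixJ_flip₂₃ hq]
  have p3 : sixJ h k4 j4 x j3 k3 l3 = sixJ h j3 j4 l3 k4 k3 x := by
    rw [sixJ_flip₁₃ hq]
  rw [p2, p3, twTerm]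
  -- The common factors may be assumed admissible; together with the stretching relations they imply
  -- the triangular conditions of all the stretched factors.
  by_cases T2 : Tetra j3 k3 x k2 j2 l2
  swap
  · rw [sixJ_of_not_tetra T2]; ring
  by_cases T3 : Tetra j3 j4 l3 k4 k3 x
  swap
  · rw [sixJ_of_not_tetra T3]; ring
  have tx2 := T2.2.2.2
  have tx4 := T3.2.2.1
  have a1 := tx2.le₁
  have a2 := tx2.le₂
  have a3 := tx2.le₃
  have b1 := tx4.le₁
  have b2 := tx4.le₂
  have b3 := tx4.le₃
  obtain ⟨m9, e9⟩ := tx2.isZ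
  obtain ⟨X, ex⟩ := sx.two_mul_isNat.isZ
  have tx1 : Triangle j1 k1 x := .mk' h1.2.1 h5.2.1 sx ⟨m2 + (-1) * m3 + (-1) * m4 + (-1) * m6 + m7 + m8 + J1 + (-1) * J2 + m9, by push_cast; linarith⟩
    (by linarith) (by linarith) (by linarith)
  have t2r : Triangle k2 j4 (l1 + l4) := .mk' h5.2.2.1 h3.2.2.1 sr ⟨(-1) * m2 + m3 + m4 + m6 + (-1) * m7, by push_cast; linarith⟩
    (by linarith) (by linarith) (by linarith)
  have T1 : Tetra j1 j2 l1 k2 k1 x := ⟨h1.rot, tx1, tx2, h5.rev⟩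
  have T4 : Tetra k1 j1 x k4 j4 l4 := ⟨tx1.swap, h8.rot, h4.rev, tx4⟩
  have T1' : Tetra k4 j2 (l1 + l4) k2 j4 x := ⟨tr, tx4, tx2, t2r⟩
  have sg : sgn (j1 + j2 + j3 + j4 + l1 + l2 + l3 + l4 + k1 + k2 + k3 + k4 - x) = sgn (j3 + j4 - l3 + l2 + k2 - k3) * sgn (2 * x) * sgn (l1 + l4 + j4 + j2 + x) * sgn (l1 + k1 + j2 + x) * sgn (l4 + j4 + j1 + x) := by
    rw [sgn_eq_cis (x := j1 + j2 + j3 + j4 + l1 + l2 + l3 + l4 + k1 + k2 + k3 + k4 - x) ⟨m3 + m4 + m5 + m6 + J2 + (-1) * m9, by push_cast; linarith⟩,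
      sgn_eq_cis (x := j3 + j4 - l3 + l2 + k2 - k3) ⟨m3 + m4 + m6 + (-2) * m7, by push_cast; linarith⟩,
      sgn_eq_cis (x := 2 * x) ⟨m2 + (-1) * m3 + (-1) * m4 + (-1) * m5 + (-1) * m6 + m7 + m8 + J1 + (-2) * J2 + (2) * m9, by push_cast; linarith⟩,
      sgn_eq_cis (x := l1 + l4 + j4 + j2 + x) ⟨(-1) * m5 + m8 + J1 + (-1) * J2 + m9, by push_cast; linarith⟩,
      sgn_eq_cis (x := l1 + k1 + j2 + x) ⟨m2 + (-1) * m3 + (-1) * m4 + (-1) * m6 + m7 + m8 + J1 + (-1) * J2 + m9, by push_cast; linarith⟩,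
      sgn_eq_cis (x := l4 + j4 + j1 + x) ⟨(-1) * m5 + m8 + J1 + (-1) * J2 + m9, by push_cast; linarith⟩,
      ← cis_add, ← cis_add, ← cis_add, ← cis_add]
    exact cis_eq ((-1) * m2 + m3 + m4 + (2) * m5 + m6 + (-2) * m8 + (-2) * J1 + (3) * J2 + (-3) * m9) (by push_cast; linarith)
  rw [sixJ_stretched_a_be hq T1 hj, sixJ_stretched_d_fb hq T4 hk,
    sixJ_stretched_a_be hq T1' (by linarith)]
  have hZ : x * (x + 1) + Z [j1, j2, j3, j4] + Z [k1, k2, k3, k4] =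
      (Z [j1, j2, j3, j4] + Z [k1, k2, k3, k4] + Z [l2, l3, l1 + l4]) +
        -(Z [l2, l3, l1 + l4] - x * (x + 1)) := by ring
  rw [hZ, qpow_add h _ (-(Z [l2, l3, l1 + l4] - x * (x + 1))),
    sfact_two_mul_add_one h h1.2.1, nabla_swap' h l4 j4 k1,
    show 2 * (l1 + l4) = 2 * l1 + 2 * l4 by ring]
  rw [sg]
  have Q := sfact_ne_zero hq
  have N := nabla_ne_zero hq
  refine eq_of_mul_eq_mul_one (u := (sfact h (2 * j1) / sfact h (2 * j1)) * (nabla h j1 x k1 / nabla h j1 x k1) * (sgn (l1 + k1 + j2 + x) * sgn (l1 + k1 + j2 + x)) * (sgn (l4 + j4 + j1 + x) * sgn (l4 + j4 + j1 + x)))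
    (v := (sfact h (2 * l1 + 2 * l4) / sfact h (2 * l1 + 2 * l4)) * (nabla h (l1 + l4) j4 k2 / nabla h (l1 + l4) j4 k2)) ?_ ?_
    (by simp only [div_eq_mul_inv, mul_inv]; ring)
  · rw [div_self (Q _), div_self (N _ _ _), sgn_mul_self, sgn_mul_self]
    norm_num
  · rw [div_self (Q _), div_self (N _ _ _)]
    norm_num

/-- The mechanism is the same, but now the last two factors of the `12j` are the stretched ones.
Because `∇[k₄ j₄ x]` cancels, they merge into `{j₁ k₁ x; j₃ k₃ j₁+k₃}`. -/
theorem twTerm_stretched_nineTerm₂ {h : ℂ} (hq : Generic h)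
    {j1 j2 j3 j4 l1 l2 l3 l4 k1 k2 k3 k4 : ℚ}
    (hadm : Admissible j1 j2 j3 j4 l1 l2 l3 l4 k1 k2 k3 k4) (hk : k4 = l4 + j1)
    (hl : l3 = k3 + k4) {x : ℚ} (sx : IsSpin x) :
    twTerm h j1 j2 j3 j4 l1 l2 l3 l4 k1 k2 k3 k4 x =
      qpow h (Z [j1, j2, j3, j4] + Z [k1, k2, k3, k4] + Z [l2, j1 + k3, l1]) *
        sgn (j3 + j4 - l4 - l2 - k2 - j2 - l1) *
        (nabla h l3 j3 j4 / (nabla h l4 k1 j4 * nabla h (j1 + k3) j3 k1)) *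
        (sfact h (2 * l4) * sfact h (2 * j1 + 2 * k3 + 1) /
          (sfact h (2 * l3 + 1) * qsqrt h (2 * k4 + 1))) *
      nineTerm (-h) j1 k3 (j1 + k3) j2 l2 j3 l1 k2 k1 x := by
  obtain ⟨m1, m2, m3, m4, m5, m6, m7, m8, J1, J2, J3, J4, K1, K2, K3, K4, L1, L2, L3, L4,
    ⟨e1, e2, e3, e4, e5, e6, e7, e8⟩, ⟨f1, f2, f3, f4⟩, ⟨g1, g2, g3, g4⟩, i1, i2, i3, i4⟩ :=
    hadm.exists_int
  obtain ⟨h1, h2, h3, h4, h5, h6, h7, h8⟩ := hadm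
  obtain ⟨u1, v1, w1⟩ := h1.le
  obtain ⟨u2, v2, w2⟩ := h2.le
  obtain ⟨u3, v3, w3⟩ := h3.le
  obtain ⟨u4, v4, w4⟩ := h4.le
  obtain ⟨u5, v5, w5⟩ := h5.le
  obtain ⟨u6, v6, w6⟩ := h6.le
  obtain ⟨u7, v7, w7⟩ := h7.le
  obtain ⟨u8, v8, w8⟩ := h8.le
  have sr : IsSpin (j1 + k3) := h1.2.1.add h7.2.1
  rw [nineTerm, sixJ_neg_left, sixJ_neg_left, sixJ_neg_left, qpow_neg_left, qnum_neg_left]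
  have p2 : sixJ h k2 x j2 j3 l2 k3 = sixJ h j3 k3 x k2 j2 l2 := by
    rw [sixJ_columns₂₃ hq, sixJ_flip₁₃ hq, sixJ_flip₂₃ hq]
  rw [p2, twTerm]
  by_cases T1 : Tetra j1 j2 l1 k2 k1 x
  swap
  · rw [sixJ_of_not_tetra T1]; ring
  by_cases T2 : Tetra j3 k3 x k2 j2 l2
  swap
  · rw [sixJ_of_not_tetra T2]; ring
  have tx1 := T1.2.1
  have tx3 := T2.1
  have a1 := tx1.le₁
  have a2 := tx1.le₂
  have a3 := tx1.le₃
  have b1 := tx3.le₁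
  have b2 := tx3.le₂
  have b3 := tx3.le₃
  obtain ⟨m9, e9⟩ := tx1.isZ
  obtain ⟨X, ex⟩ := sx.two_mul_isNat.isZ
  have tx4 : Triangle k4 j4 x := .mk' h4.2.2.1 h3.2.2.1 sx ⟨(2) * m1 + (-2) * m2 + m4 + (-2) * m5 + (2) * m6 + (-1) * m7 + m8 + (-1) * J1 + J3 + m9, by push_cast; linarith⟩
    (by linarith) (by linarith) (by linarith)
  have t1 : Triangle j1 k3 (j1 + k3) := .mk' h1.2.1 h7.2.1 sr ⟨J1 + K3, by push_cast; linarith⟩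
    (by linarith [h7.2.1.nonneg]) (by linarith [h1.2.1.nonneg]) le_rfl
  have t2 : Triangle j3 k1 (j1 + k3) := .mk' h3.2.1 h5.2.1 sr ⟨(-1) * m1 + m2 + (-1) * m4 + m5 + (-1) * m6 + m7 + J1, by push_cast; linarith⟩
    (by linarith) (by linarith) (by linarith)
  have T3 : Tetra j3 j4 l3 k4 k3 x := ⟨h3.rot, tx3, tx4, h7.rev⟩
  have T4 : Tetra k1 j1 x k4 j4 l4 := ⟨tx1.swap, h8.rot, h4.rev, tx4⟩
  have T3' : Tetra j1 k1 x j3 k3 (j1 + k3) := ⟨tx1, t1, t2, tx3⟩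
  have sg : sgn (j1 + j2 + j3 + j4 + l1 + l2 + l3 + l4 + k1 + k2 + k3 + k4 - x) = sgn (j3 + j4 - l4 - l2 - k2 - j2 - l1) * sgn (2 * x) * sgn (j1 + k1 + k3 + j3) * sgn (k4 + j4 + k3 + j3) * sgn (l4 + j4 + j1 + x) := by
    rw [sgn_eq_cis (x := j1 + j2 + j3 + j4 + l1 + l2 + l3 + l4 + k1 + k2 + k3 + k4 - x) ⟨m2 + m5 + m7 + m8 + J1 + (-1) * m9, by push_cast; linarith⟩,
      sgn_eq_cis (x := j3 + j4 - l4 - l2 - k2 - j2 - l1) ⟨(-1) * m2 + (-1) * m4 + (-1) * m5 + m8 + J1 + J3, by push_cast; linarith⟩,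
      sgn_eq_cis (x := 2 * x) ⟨(2) * m1 + (-2) * m2 + m4 + (-2) * m5 + (2) * m6 + (-1) * m7 + (-2) * J1 + J3 + (2) * m9, by push_cast; linarith⟩,
      sgn_eq_cis (x := j1 + k1 + k3 + j3) ⟨(-1) * m1 + m2 + (-1) * m4 + m5 + (-1) * m6 + m7 + J1, by push_cast; linarith⟩,
      sgn_eq_cis (x := k4 + j4 + k3 + j3) ⟨m1 + (-1) * m2 + (-1) * m5 + m6 + m8 + J3, by push_cast; linarith⟩,
      sgn_eq_cis (x := l4 + j4 + j1 + x) ⟨(2) * m1 + (-2) * m2 + m4 + (-2) * m5 + (2) * m6 + (-1) * m7 + m8 + (-1) * J1 + J3 + m9, by push_cast; linarith⟩,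
      ← cis_add, ← cis_add, ← cis_add, ← cis_add]
    exact cis_eq ((-2) * m1 + (3) * m2 + (3) * m5 + (-2) * m6 + m7 + (-1) * m8 + J1 + (-2) * J3 + (-2) * m9) (by push_cast; linarith)
  rw [sixJ_stretched_e_dc hq T3 (by linarith), sixJ_stretched_d_fb hq T4 hk,
    sixJ_stretched hq T3' rfl]
  have hZ : x * (x + 1) + Z [j1, j2, j3, j4] + Z [k1, k2, k3, k4] =
      (Z [j1, j2, j3, j4] + Z [k1, k2, k3, k4] + Z [l2, j1 + k3, l1]) +
        -(Z [l2, j1 + k3, l1] - x * (x + 1)) := by ring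
  rw [hZ, qpow_add h _ (-(Z [l2, j1 + k3, l1] - x * (x + 1))),
    sfact_two_mul_add_one h h4.2.2.1, nabla_swap' h k4 x j4, nabla_swap' h l4 j4 k1,
    nabla_swap' h j1 x k1, show 2 * (j1 + k3) + 1 = 2 * j1 + 2 * k3 + 1 by ring, sg]
  have Q := sfact_ne_zero hq
  have N := nabla_ne_zero hq
  refine eq_of_mul_eq_mul_one (u := (sfact h (2 * k4) / sfact h (2 * k4)) * (nabla h k4 j4 x / nabla h k4 j4 x) * (sgn (k4 + j4 + k3 + j3) * sgn (k4 + j4 + k3 + j3)) * (sgn (l4 + j4 + j1 + x) * sgn (l4 + j4 + j1 + x)))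
    (v := (sfact h (2 * j1 + 2 * k3 + 1) / sfact h (2 * j1 + 2 * k3 + 1)) * (nabla h (j1 + k3) j3 k1 / nabla h (j1 + k3) j3 k1)) ?_ ?_
    (by simp only [div_eq_mul_inv, mul_inv]; ring)
  · rw [div_self (Q _), div_self (N _ _ _), sgn_mul_self, sgn_mul_self]
    norm_num
  · rw [div_self (Q _), div_self (N _ _ _)]
    norm_num

theorem twelveJ_stretched_nineJ₁ {h : ℂ} (hq : Generic h)
    {j1 j2 j3 j4 l1 l2 l3 l4 k1 k2 k3 k4 : ℚ}
    (hadm : Admissible j1 j2 j3 j4 l1 l2 l3 l4 k1 k2 k3 k4) (hk : k4 = l4 + j1)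
    (hj : j1 = l1 + j2) :
    twelveJ h j1 j2 j3 j4 l1 l2 l3 l4 k1 k2 k3 k4 =
      sgn (j3 + j4 - l3 + l2 + k2 - k3) *
        qpow h (Z [j1, j2, j3, j4] + Z [k1, k2, k3, k4] + Z [l2, l3, l1 + l4]) *
        (nabla h (l1 + l4) j4 k2 / (nabla h l1 k1 k2 * nabla h l4 k1 j4)) *
        (sfact h (2 * l1) * sfact h (2 * l4) / (sfact h (2 * l1 + 2 * l4) * qsqrt h (2 * j1 + 1))) *
      nineJ (-h) k4 k3 l3 j2 l2 j3 (l1 + l4) k2 j4 := by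
  rw [twelveJ_eq_spinSum, nineJ_eq_spinSum, spinSum_const_mul]
  refine spinSum_congr (fun x sx => twTerm_stretched_nineTerm₁ hq hadm hk hj sx) (fun x hx => ?_)
    fun x hx => ?_
  · by_contra H
    linarith [(twTerm_tetra H).1.2.1.le₃]
  · have : ¬ Tetra k4 j4 x j3 k3 l3 := fun T => by linarith [T.1.le₃]
    rw [nineTerm, sixJ_of_not_tetra this]; ring

theorem twelveJ_stretched_nineJ₂ {h : ℂ} (hq : Generic h)
    {j1 j2 j3 j4 l1 l2 l3 l4 k1 k2 k3 k4 : ℚ}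
    (hadm : Admissible j1 j2 j3 j4 l1 l2 l3 l4 k1 k2 k3 k4) (hk : k4 = l4 + j1)
    (hl : l3 = k3 + k4) :
    twelveJ h j1 j2 j3 j4 l1 l2 l3 l4 k1 k2 k3 k4 =
      qpow h (Z [j1, j2, j3, j4] + Z [k1, k2, k3, k4] + Z [l2, j1 + k3, l1]) *
        sgn (j3 + j4 - l4 - l2 - k2 - j2 - l1) *
        (nabla h l3 j3 j4 / (nabla h l4 k1 j4 * nabla h (j1 + k3) j3 k1)) *
        (sfact h (2 * l4) * sfact h (2 * j1 + 2 * k3 + 1) /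
          (sfact h (2 * l3 + 1) * qsqrt h (2 * k4 + 1))) *
      nineJ (-h) j1 k3 (j1 + k3) j2 l2 j3 l1 k2 k1 := by
  rw [twelveJ_eq_spinSum, nineJ_eq_spinSum, spinSum_const_mul]
  refine spinSum_congr (fun x sx => twTerm_stretched_nineTerm₂ hq hadm hk hl sx) (fun x hx => ?_)
    fun x hx => ?_
  · by_contra H
    linarith [(twTerm_tetra H).1.2.1.le₃]
  · have : ¬ Tetra j1 j2 l1 k2 k1 x := fun T => by linarith [T.2.1.le₃]
    rw [nineTerm, sixJ_of_not_tetra this]; ring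

/-! ### Sums over the lattice `s, s - 1, s - 2, …` -/

/-- The sum of `f` over the non-negative members of `s - ℕ`. -/
noncomputable def latSum (s : ℚ) (f : ℚ → ℂ) : ℂ := ∑ i ∈ Finset.range (⌊s⌋₊ + 1), f (s - i)

theorem latSum_congr {s : ℚ} (hs : 0 ≤ s) {f g : ℚ → ℂ}
    (hfg : ∀ x, 0 ≤ x → IsNat (s - x) → f x = g x) : latSum s f = latSum s g := by
  refine Finset.sum_congr rfl fun i hi => hfg _ ?_ ⟨i, by ring⟩
  have h1 : i ≤ ⌊s⌋₊ := Nat.lt_succ_iff.1 (Finset.mem_range.1 hi)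
  have h2 : (i : ℚ) ≤ s := (Nat.cast_le.2 h1).trans (Nat.floor_le hs)
  linarith

theorem latSum_eq_single {s : ℚ} {f : ℚ → ℂ} {x : ℚ} (hx : 0 ≤ x) (hxs : IsNat (s - x))
    (h0 : ∀ y, 0 ≤ y → IsNat (s - y) → y ≠ x → f y = 0) : latSum s f = f x := by
  obtain ⟨n, hn⟩ := hxs
  have hs : 0 ≤ s := by linarith [n.cast_nonneg (α := ℚ)]
  have e : x = s - n := by linarith
  subst e
  refine Finset.sum_eq_single n (fun i hi hin => h0 _ ?_ ⟨i, by ring⟩ fun e => hin ?_) fun hn' => ?_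
  · have h1 : i ≤ ⌊s⌋₊ := Nat.lt_succ_iff.1 (Finset.mem_range.1 hi)
    have h2 : (i : ℚ) ≤ s := (Nat.cast_le.2 h1).trans (Nat.floor_le hs)
    linarith
  · exact_mod_cast (by linarith : (i : ℚ) = n)
  · exact absurd (Finset.mem_range.2 (Nat.lt_succ_iff.2 (Nat.le_floor (by linarith)))) hn'

theorem latSum_add (s : ℚ) (f g : ℚ → ℂ) :
    latSum s (fun x => f x + g x) = latSum s f + latSum s g := Finset.sum_add_distrib

theorem latSum_const_mul (s : ℚ) (c : ℂ) (f : ℚ → ℂ) :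
    latSum s (fun x => c * f x) = c * latSum s f := (Finset.mul_sum ..).symm

theorem latSum_sum {ι : Type*} (s : ℚ) (t : Finset ι) (f : ι → ℚ → ℂ) :
    latSum s (fun x => ∑ i ∈ t, f i x) = ∑ i ∈ t, latSum s (f i) := Finset.sum_comm

/-- A non-zero term forces `s - x` to be natural, so half of the half-integers drop out. Counted
downwards from `s`, the survivors are the even indices. -/
theorem spinSum_eq_latSum {u s : ℚ} {f : ℚ → ℂ} (hs : IsSpin s) (hu : ∀ x, u < x → f x = 0)
    (hf : ∀ x, IsSpin x → f x ≠ 0 → IsNat (s - x)) : spinSum u f = latSum s f := by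
  classical
  have h1 : spinSum u f = spinSum s (fun x => if s < x then 0 else f x) := by
    refine spinSum_congr (fun x hx => ?_) hu fun x hx => if_pos hx
    split_ifs with hsx
    · by_contra H
      linarith [(hf x hx H).nonneg]
    · rfl
  rw [h1, spinSum, latSum]
  obtain ⟨N, hN⟩ := hs.two_mul_isNat
  rw [hN, Nat.floor_natCast, ← Finset.sum_range_reflect]
  symm
  have hs0 := hs.nonneg
  have hle : ∀ i ∈ Finset.range (⌊s⌋₊ + 1), 2 * i ≤ N := fun i hi => by
    have h1 : i ≤ ⌊s⌋₊ := Nat.lt_succ_iff.1 (Finset.mem_range.1 hi)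
    have h2 : (i : ℚ) ≤ s := (Nat.cast_le.2 h1).trans (Nat.floor_le hs0)
    have : ((2 * i : ℕ) : ℚ) ≤ N := by push_cast; linarith
    exact_mod_cast this
  have arg : ∀ t ≤ N, ((N + 1 - 1 - t : ℕ) : ℚ) / 2 = s - t / 2 := fun t ht => by
    rw [Nat.add_sub_cancel, Nat.cast_sub ht]; linarith
  refine Finset.sum_of_injOn (fun i => 2 * i) (fun a _ b _ e => by simpa using e) (fun i hi => ?_)
    (fun t ht hnot => ?_) fun i hi => ?_
  · have := hle i hi
    simp only [Finset.coe_range, Set.mem_Iio]; omega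
  · have htN : t ≤ N := Nat.lt_succ_iff.1 (Finset.mem_range.1 ht)
    rw [arg t htN]
    split_ifs
    · rfl
    · by_contra H
      have hsp : IsSpin (s - t / 2) := ⟨N - t, by rw [Nat.cast_sub htN]; linarith⟩
      obtain ⟨m, hm⟩ := hf _ hsp H
      have e : (t : ℚ) = ((2 * m : ℕ) : ℚ) := by push_cast; linarith
      have e' : t = 2 * m := by exact_mod_cast e
      refine hnot ⟨m, ?_, e'.symm⟩
      have : (m : ℚ) ≤ s := by linarith [hsp.nonneg, t.cast_nonneg (α := ℚ)]
      simpa using Nat.lt_succ_iff.2 (Nat.le_floor this)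
  · rw [arg _ (hle i hi), if_neg]
    · congr 1; push_cast; ring
    · push_cast; linarith [i.cast_nonneg (α := ℚ)]

/-! ### The star sum -/

/-- The eigenvalue `[x][x+1]`. -/
noncomputable def lam (h : ℂ) (x : ℚ) : ℂ := qnum h x * qnum h (x + 1)

/-- The factor `1 / ([B-x]! [B+x+1]!)`. -/
noncomputable def eFun (h : ℂ) (B x : ℚ) : ℂ := rfact h (B - x) * rfact h (B + x + 1)

/-- The factor `[x+C]! / [x-C]!`. -/
noncomputable def gFun (h : ℂ) (C x : ℚ) : ℂ := qfact h (x + C) * rfact h (x - C)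

/-- The weight `[2x+1] q^{x(x+1)}`. -/
noncomputable def wt (h : ℂ) (x : ℚ) : ℂ := qnum h (2 * x + 1) * qpow h (x * (x + 1))

/-- This factorization is what turns a unit shift of the parameter of `eFun` or `gFun` into
multiplication by a linear polynomial in `lam h x`. -/
theorem lam_sub_lam {h : ℂ} (hq : Generic h) (a x : ℚ) :
    lam h a - lam h x = qnum h (a - x) * qnum h (a + x + 1) := by
  rw [qnum_mul_qnum hq (a - x) (a + x + 1) a, lam, lam, show a - x + (a + x + 1) - a = a + 1 by ring,
    show a - x - a = -x by ring, show a + x + 1 - a = x + 1 by ring, qnum_neg]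
  ring

/-- Because of this reflection, a zero at a negative lattice point is also a zero at a non-negative
one. -/
theorem lam_reflect (h : ℂ) (x : ℚ) : lam h (-1 - x) = lam h x := by
  rw [lam, lam, show -1 - x + 1 = -x by ring, show -1 - x = -(x + 1) by ring, qnum_neg, qnum_neg]
  ring

theorem eFun_sub_one {h : ℂ} (hq : Generic h) {B x : ℚ} (h1 : IsZ (B - x)) (h2 : IsZ (B + x)) :
    eFun h (B - 1) x = (lam h B - lam h x) * eFun h B x := by
  rw [eFun, eFun, lam_sub_lam hq, show B - 1 - x = B - x - 1 by ring,
    show B - 1 + x + 1 = B + x + 1 - 1 by ring, rfact_sub_one hq h1,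
    rfact_sub_one hq (h2.add isZ_one)]
  ring

theorem gFun_of_lt (h : ℂ) {C x : ℚ} (hx : x < C) : gFun h C x = 0 := by
  rw [gFun, rfact_of_neg h (by linarith), mul_zero]

theorem eFun_of_lt (h : ℂ) {B x : ℚ} (hx : B < x) : eFun h B x = 0 := by
  rw [eFun, rfact_of_neg h (by linarith), zero_mul]

/-- The restriction on `x + C` is genuine: at `x + C = -1` the recurrence for `qfact` breaks down.
This is the obstruction that `starFun` is designed to circumvent. -/
theorem gFun_add_one {h : ℂ} (hq : Generic h) {C x : ℚ} (h1 : IsZ (x - C)) (h2 : IsNat (x + C)) :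
    gFun h (C + 1) x = (lam h x - lam h C) * gFun h C x := by
  rw [gFun, gFun, lam_sub_lam hq, show x + (C + 1) = x + C + 1 by ring, qfact_add_one h2,
    show x - (C + 1) = x - C - 1 by ring, rfact_sub_one hq h1]
  ring

/-- The value of the star sum. -/
noncomputable def starVal (h : ℂ) (s C B B' : ℚ) : ℂ :=
  sgn (s - C) * qpow h (C * B + C * B' - B * B' + C) * rfact h (B - C) * rfact h (B' - C) *
    rfact h (B + B' + 1)

theorem starVal_comm (h : ℂ) (s C B B' : ℚ) : starVal h s C B B' = starVal h s C B' B := by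
  rw [starVal, starVal, show C * B + C * B' - B * B' + C = C * B' + C * B - B' * B + C by ring,
    add_comm B B']; ring

theorem sgn_sub_one {x : ℚ} (hx : IsZ x) : sgn (x - 1) = -sgn x := by
  rw [sgn_sub hx isZ_one]
  have : sgn 1 = -1 := by simpa using sgn_natCast 1
  rw [this]; ring

/-- On the level of sums this is `λ_B - λ_x = (λ_B - λ_C) - (λ_x - λ_C)`. Checked directly on the
closed form, it involves only reciprocal factorials and so holds for negative `C` too. -/
theorem starVal_rec {h : ℂ} (hq : Generic h) {s C B B' : ℚ} (h1 : IsZ (s - C)) (h2 : IsZ (B - C))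
    (h3 : IsZ (B' - C)) (h4 : IsZ (B + B')) :
    starVal h s C (B - 1) B' =
      (lam h B - lam h C) * starVal h s C B B' - starVal h s (C + 1) B B' := by
  rw [lam_sub_lam hq]
  simp only [starVal]
  rw [show s - (C + 1) = s - C - 1 by ring, sgn_sub_one h1, show B - 1 - C = B - C - 1 by ring,
    rfact_sub_one hq h2, show B - 1 + B' + 1 = B + B' + 1 - 1 by ring,
    rfact_sub_one hq (h4.add isZ_one), show B - (C + 1) = B - C - 1 by ring, rfact_sub_one hq h2,
    show B' - (C + 1) = B' - C - 1 by ring, rfact_sub_one hq h3,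
    show C * (B - 1) + C * B' - (B - 1) * B' + C = (C * B + C * B' - B * B' + C) + (B' - C) by ring,
    show (C + 1) * B + (C + 1) * B' - B * B' + (C + 1) =
      (C * B + C * B' - B * B' + C) + (B + B' + 1) by ring,
    qpow_add h _ (B' - C), qpow_add h _ (B + B' + 1),
    show B + C + 1 = (B + B' + 1) - (B' - C) by ring, qnum_sub hq (B + B' + 1)]
  ring

theorem lam_sub_ne_zero {h : ℂ} (hq : Generic h) {B C : ℚ} (h1 : IsZ (B - C)) (h2 : IsZ (B + C))
    (hC : 0 ≤ C) (hBC : C < B) : lam h B - lam h C ≠ 0 := by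
  rw [lam_sub_lam hq]
  obtain ⟨m, hm⟩ := h1
  obtain ⟨n, hn⟩ := h2
  have h3 : (0 : ℚ) < m := by linarith
  have h4 : (0 : ℚ) < n := by linarith
  have h3' : 0 < m := by exact_mod_cast h3
  have h4' : 0 < n := by exact_mod_cast h4
  refine mul_ne_zero ?_ ?_
  · rw [hm]; exact hq.qnum_ne_zero (by omega)
  · have e : B + C + 1 = ((n + 1 : ℤ) : ℚ) := by push_cast; linarith
    rw [e]; exact hq.qnum_ne_zero (by omega)

/-- The star sum `∑ₓ ± [2x+1] q^{x(x+1)} [x+C]!/[x-C]! / ([B-x]! [B+x+1]! [B'-x]! [B'+x+1]!)`. -/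
theorem latSum_star {h : ℂ} (hq : Generic h) {s C B B' : ℚ} (hs : IsSpin s) (hB : B ≤ s)
    (hsC : IsZ (s - C)) (hC : 0 ≤ C) (h2 : IsZ (B - C)) (h3 : IsZ (B' - C)) :
    latSum s (fun x => sgn (s - x) * wt h x * gFun h C x * (eFun h B x * eFun h B' x)) =
      starVal h s C B B' := by
  have s2 := hs.two_mul_isNat.isZ
  have c2 : IsZ (2 * C) := by
    have := (s2.sub hsC).sub hsC; rwa [show 2 * s - (s - C) - (s - C) = 2 * C by ring] at this
  obtain hlt | hle := lt_or_ge B C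
  · rw [starVal, rfact_of_neg h (show B - C < 0 by linarith)]
    have : ∀ x, sgn (s - x) * wt h x * gFun h C x * (eFun h B x * eFun h B' x) = 0 * (0 : ℂ) :=
      fun x => by
        obtain hx | hx := lt_or_ge x C
        · rw [gFun_of_lt h hx]; ring
        · rw [eFun_of_lt h (hlt.trans_le hx)]; ring
    rw [funext this, latSum_const_mul]; ring
  -- Induction on `B - C`: the recurrence expresses the sum for `(C, B)` by those for `(C, B - 1)`
  -- and `(C + 1, B)`, after division by `λ_B - λ_C ≠ 0`.
  obtain ⟨n, hn⟩ := h2.isNat (by linarith)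
  induction n generalizing B C with
  | zero =>
    have hBC : B = C := by simp at hn; linarith
    subst hBC
    -- For `B = C` only `x = B` survives: `gFun` kills the smaller `x` and `eFun` the larger ones.
    rw [latSum_eq_single hC (hsC.isNat (by linarith))]
    · obtain hb | hb := lt_or_ge B' B
      · rw [eFun_of_lt h hb, starVal, rfact_of_neg h (show B' - B < 0 by linarith)]; ring
      have e0 : IsNat (2 * B) := c2.isNat (by linarith)
      rw [gFun, eFun, eFun, starVal, wt, sub_self, rfact_zero, show B + B = 2 * B by ring,
        rfact_of_nonneg h (show 0 ≤ 2 * B + 1 by linarith), qfact_add_one e0,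
        show B * B + B * B' - B * B' + B = B * (B + 1) by ring, add_comm B' B]
      have n1 := qfact_ne_zero hq (2 * B)
      have n2 : qnum h (2 * B + 1) ≠ 0 := by
        have := qfact_ne_zero hq (2 * B + 1)
        rw [qfact_add_one e0] at this
        exact left_ne_zero_of_mul this
      refine eq_of_eq_mul_one (u := qfact h (2 * B) / qfact h (2 * B) *
        (qnum h (2 * B + 1) / qnum h (2 * B + 1))) ?_ (by rw [mul_inv]; ring)
      rw [div_self n1, div_self n2, one_mul]
    · intro y _ _ hy
      obtain hy | hy := lt_or_gt_of_ne hy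
      · rw [gFun_of_lt h hy]; ring
      · rw [eFun_of_lt h hy]; ring
  | succ n ih =>
    push_cast at hn
    have hlt : C < B := by linarith [n.cast_nonneg (α := ℚ)]
    have bz : IsZ (B + C) := by
      have := h2.add c2; rwa [show B - C + 2 * C = B + C by ring] at this
    have i1 := ih (C := C) (B := B - 1) (by linarith) hsC hC
      ⟨n, by push_cast; linarith⟩ h3 c2 (by linarith [n.cast_nonneg (α := ℚ)]) (by linarith)
    have hsC' : IsZ (s - (C + 1)) := by
      have := hsC.sub isZ_one; rwa [show s - C - 1 = s - (C + 1) by ring] at this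
    have i2 := ih (C := C + 1) (B := B) hB hsC' (by linarith) ⟨n, by push_cast; linarith⟩
      (by have := h3.sub isZ_one; rwa [show B' - C - 1 = B' - (C + 1) by ring] at this)
      (by have := c2.add (isZ_natCast 2); rwa [show 2 * C + (2 : ℕ) = 2 * (C + 1) by push_cast; ring]
            at this)
      (by linarith [n.cast_nonneg (α := ℚ)]) (by linarith)
    have bb : IsZ (B + B') := by
      have := bz.add h3; rwa [show B + C + (B' - C) = B + B' by ring] at this
    refine mul_left_cancel₀ (lam_sub_ne_zero hq h2 bz hC hlt) ?_
    have r := starVal_rec hq hsC h2 h3 bb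
    have key : (lam h B - lam h C) * starVal h s C B B' =
        starVal h s C (B - 1) B' + starVal h s (C + 1) B B' := by rw [r]; ring
    rw [key, ← i1, ← i2, ← latSum_const_mul, ← latSum_add]
    refine latSum_congr hs.nonneg fun x _ hx => ?_
    have xC : IsZ (x - C) := by
      have := hsC.sub hx.isZ; rwa [show s - C - (s - x) = x - C by ring] at this
    obtain hxC | hxC := lt_or_ge x C
    · rw [gFun_of_lt h hxC, gFun_of_lt h (show x < C + 1 by linarith)]; ring
    have xC' : IsZ (x + C) := by
      have := xC.add c2; rwa [show x - C + 2 * C = x + C by ring] at this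
    rw [gFun_add_one hq xC (xC'.isNat (by linarith)), eFun_sub_one hq
      (by have := h2.sub xC; rwa [show B - C - (x - C) = B - x by ring] at this)
      (by have := h2.add xC'; rwa [show B - C + (x + C) = B + x by ring] at this)]
    ring

/-! ### The star functional -/

open Polynomial

/-- The Newton polynomials with nodes `[M-i][M-i+1]`. -/
noncomputable def newton (h : ℂ) (M : ℚ) (m : ℕ) : ℂ[X] :=
  ∏ i ∈ Finset.range m, (C (lam h (M - i)) - X)

theorem newton_succ (h : ℂ) (M : ℚ) (m : ℕ) :
    newton h M (m + 1) = newton h M m * (C (lam h (M - m)) - X) := Finset.prod_range_succ _ _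

theorem newton_zero (h : ℂ) (M : ℚ) : newton h M 0 = 1 := by simp [newton]

theorem degree_newton (h : ℂ) (M : ℚ) (m : ℕ) : (newton h M m).degree = m := by
  rw [newton, degree_prod, Finset.sum_congr rfl (g := fun _ => (1 : WithBot ℕ))]
  · simp
  · intro i _
    rw [← neg_sub, degree_neg, degree_X_sub_C]

/-- The Newton polynomials as a basis. -/
noncomputable def newtonBasis (h : ℂ) (M : ℚ) : Module.Basis ℕ ℂ ℂ[X] :=
  Polynomial.Sequence.basis ⟨newton h M, degree_newton h M⟩
    fun i => (leadingCoeff_ne_zero.2 (Polynomial.Sequence.ne_zero _ i)).isUnit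

theorem newtonBasis_apply (h : ℂ) (M : ℚ) (m : ℕ) : newtonBasis h M m = newton h M m :=
  Polynomial.Sequence.basis_eq_self _ _ m

theorem eFun_sub_nat {h : ℂ} (hq : Generic h) {M x : ℚ} (h1 : IsZ (M - x)) (h2 : IsZ (M + x))
    (m : ℕ) : eFun h (M - m) x = (newton h M m).eval (lam h x) * eFun h M x := by
  induction m with
  | zero => simp [newton_zero]
  | succ m ih =>
    rw [newton_succ, eval_mul, show M - ((m + 1 : ℕ) : ℚ) = M - m - 1 by push_cast; ring,
      eFun_sub_one hq, ih]
    · simp; ring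
    · have := h1.sub (isZ_natCast m); rwa [show M - x - m = M - m - x by ring] at this
    · have := h2.sub (isZ_natCast m); rwa [show M + x - m = M - m + x by ring] at this

/-- The functional on polynomials in `[x][x+1]` that extends the star sum to all `c`. -/
noncomputable def starFun (h : ℂ) (s M M' c : ℚ) : ℂ[X] →ₗ[ℂ] ℂ :=
  (newtonBasis h M).constr ℂ fun m => starVal h s c (M - m) M'

theorem starFun_newton (h : ℂ) (s M M' c : ℚ) (m : ℕ) :
    starFun h s M M' c (newton h M m) = starVal h s c (M - m) M' := by
  rw [← newtonBasis_apply, starFun, Module.Basis.constr_basis]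

/-- `M`, `M'` and `c` lie on the lattice of the spin `s`. -/
structure OnLattice (s M M' c : ℚ) : Prop where
  spin : IsSpin s
  left : IsZ (s - M)
  right : IsZ (s - M')
  base : IsZ (s - c)

theorem OnLattice.add_one {s M M' c : ℚ} (H : OnLattice s M M' c) : OnLattice s M M' (c + 1) :=
  ⟨H.1, H.2, H.3, by have := H.4.sub isZ_one; rwa [show s - c - 1 = s - (c + 1) by ring] at this⟩

/-- On the Newton basis `(X - λ_c) N_m = (λ_{M-m} - λ_c) N_m - N_{m+1}`, so the claim is exactly the
recurrence `starVal_rec`. -/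
theorem starFun_step {h : ℂ} (hq : Generic h) {s M M' c : ℚ} (H : OnLattice s M M' c)
    (P : ℂ[X]) :
    starFun h s M M' c ((X - C (lam h c)) * P) = starFun h s M M' (c + 1) P := by
  suffices starFun h s M M' c ∘ₗ LinearMap.mulLeft ℂ (X - C (lam h c)) =
      starFun h s M M' (c + 1) from LinearMap.congr_fun this P
  refine (newtonBasis h M).ext fun m => ?_
  obtain ⟨hs, h1, h2, h3⟩ := H
  have s2 := hs.two_mul_isNat.isZ
  have hm := isZ_natCast m
  rw [newtonBasis_apply, LinearMap.comp_apply, LinearMap.mulLeft_apply, starFun_newton]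
  have e : (X - C (lam h c)) * newton h M m =
      (lam h (M - m) - lam h c) • newton h M m - newton h M (m + 1) := by
    rw [newton_succ, smul_eq_C_mul, C_sub]; ring
  rw [e, map_sub, map_smul, starFun_newton, starFun_newton, smul_eq_mul,
    show M - ((m + 1 : ℕ) : ℚ) = M - m - 1 by push_cast; ring, starVal_rec hq h3]
  · ring
  · have := (h3.sub h1).sub hm; rwa [show s - c - (s - M) - m = M - m - c by ring] at this
  · have := h3.sub h2; rwa [show s - c - (s - M') = M' - c by ring] at this
  · have := ((s2.sub h1).sub h2).sub hm
    rwa [show 2 * s - (s - M) - (s - M') - m = M - m + M' by ring] at this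

/-- The construction singles out `M`, but `starVal` is symmetric in its last two arguments. The
recurrence therefore also lowers `M'`, and the functional treats both sides alike. -/
theorem starFun_mul_newton {h : ℂ} (hq : Generic h) {s M M' c : ℚ} (H : OnLattice s M M' c)
    (m m' : ℕ) :
    starFun h s M M' c (newton h M m * newton h M' m') = starVal h s c (M - m) (M' - m') := by
  induction m' generalizing c with
  | zero => simp [newton_zero, starFun_newton]
  | succ n ih =>
    have e : newton h M m * newton h M' (n + 1) =
        (lam h (M' - n) - lam h c) • (newton h M m * newton h M' n) -
          (X - C (lam h c)) * (newton h M m * newton h M' n) := by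
      rw [newton_succ, smul_eq_C_mul, C_sub]; ring
    rw [e, map_sub, map_smul, starFun_step hq H, ih H, ih H.add_one, smul_eq_mul]
    obtain ⟨hs, h1, h2, h3⟩ := H
    have s2 := hs.two_mul_isNat.isZ
    have hm := isZ_natCast m
    have hn := isZ_natCast n
    rw [starVal_comm, starVal_comm h s (c + 1), starVal_comm h s c (M - m),
      show M' - ((n + 1 : ℕ) : ℚ) = M' - n - 1 by push_cast; ring, starVal_rec hq h3]
    · have := (h3.sub h2).sub hn; rwa [show s - c - (s - M') - n = M' - n - c by ring] at this
    · have := (h3.sub h1).sub hm; rwa [show s - c - (s - M) - m = M - m - c by ring] at this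
    · have := (((s2.sub h1).sub h2).sub hm).sub hn
      rwa [show 2 * s - (s - M) - (s - M') - m - n = M' - n + (M - m) by ring] at this

/-- For `c ≥ 0` the star functional is a sum over the lattice. -/
theorem starFun_eq_latSum {h : ℂ} (hq : Generic h) {s M M' c : ℚ} (H : OnLattice s M M' c)
    (hM : M ≤ s) (hc : 0 ≤ c) (P : ℂ[X]) :
    starFun h s M M' c P = latSum s fun x =>
      sgn (s - x) * wt h x * gFun h c x * (P.eval (lam h x) * eFun h M x * eFun h M' x) := by
  let L : ℂ[X] →ₗ[ℂ] ℂ :=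
    { toFun := fun P => latSum s fun x =>
        sgn (s - x) * wt h x * gFun h c x * (P.eval (lam h x) * eFun h M x * eFun h M' x)
      map_add' := fun P Q => by
        rw [← latSum_add]; congr 1; funext x; rw [eval_add]; ring
      map_smul' := fun a P => by
        rw [RingHom.id_apply, smul_eq_mul, ← latSum_const_mul]; congr 1; funext x
        rw [eval_smul, smul_eq_mul]; ring }
  suffices starFun h s M M' c = L from LinearMap.congr_fun this P
  refine (newtonBasis h M).ext fun m => ?_
  obtain ⟨hs, h1, h2, h3⟩ := H
  have s2 := hs.two_mul_isNat.isZ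
  have hm := isZ_natCast m
  rw [newtonBasis_apply, starFun_newton, ← latSum_star hq hs
    (by linarith [m.cast_nonneg (α := ℚ)]) h3 hc
    (by have := (h3.sub h1).sub hm; rwa [show s - c - (s - M) - m = M - m - c by ring] at this)
    (by have := h3.sub h2; rwa [show s - c - (s - M') = M' - c by ring] at this)]
  change _ = latSum s fun x => sgn (s - x) * wt h x * gFun h c x *
    ((newton h M m).eval (lam h x) * eFun h M x * eFun h M' x)
  refine latSum_congr hs.nonneg fun x _ hx => ?_
  rw [eFun_sub_nat hq]
  · have := hx.isZ.sub h1; rwa [show s - x - (s - M) = M - x by ring] at this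
  · have := (s2.sub hx.isZ).sub h1
    rwa [show 2 * s - (s - x) - (s - M) = M + x by ring] at this

/-- The product of the `X - [a+i][a+i+1]` for `i < n`. -/
noncomputable def nodePoly (h : ℂ) (a : ℚ) (n : ℕ) : ℂ[X] :=
  ∏ i ∈ Finset.range n, (X - C (lam h (a + i)))

theorem nodePoly_zero (h : ℂ) (a : ℚ) : nodePoly h a 0 = 1 := by simp [nodePoly]

theorem nodePoly_add (h : ℂ) (a : ℚ) (m n : ℕ) :
    nodePoly h a (m + n) = nodePoly h a m * nodePoly h (a + m) n := by
  rw [nodePoly, Finset.prod_range_add, nodePoly, nodePoly]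
  congr 1
  refine Finset.prod_congr rfl fun i _ => ?_
  congr 3; push_cast; ring

theorem nodePoly_reflect (h : ℂ) (a : ℚ) (n : ℕ) : nodePoly h (-a - n) n = nodePoly h a n := by
  rw [nodePoly, ← Finset.prod_range_reflect, nodePoly]
  refine Finset.prod_congr rfl fun i hi => ?_
  rw [← lam_reflect h (a + i), Nat.cast_sub (by have := Finset.mem_range.1 hi; omega),
    Nat.cast_sub (by have := Finset.mem_range.1 hi; omega)]
  congr 3; push_cast; ring

/-- This trades zeros for the base point: removing `n` consecutive nodes starting at `c` raises `c`
by `n`, which can lift a negative base to a non-negative one. -/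
theorem starFun_nodePoly {h : ℂ} (hq : Generic h) {s M M' c : ℚ} (H : OnLattice s M M' c)
    (n : ℕ) (P : ℂ[X]) :
    starFun h s M M' c (nodePoly h c n * P) = starFun h s M M' (c + n) P := by
  induction n generalizing c with
  | zero => simp [nodePoly_zero]
  | succ n ih =>
    rw [add_comm n 1, nodePoly_add, mul_assoc]
    have e : nodePoly h c 1 = X - C (lam h c) := by simp [nodePoly]
    rw [e, starFun_step hq H, Nat.cast_one, ih H.add_one]
    push_cast; rw [add_assoc]

theorem eval_nodePoly_mul_gFun {h : ℂ} (hq : Generic h) {c x : ℚ} (h1 : IsZ (x - c))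
    (h2 : IsNat (x + c)) (n : ℕ) :
    (nodePoly h c n).eval (lam h x) * gFun h c x = gFun h (c + n) x := by
  induction n with
  | zero => simp [nodePoly_zero]
  | succ n ih =>
    rw [nodePoly_add, eval_mul, mul_right_comm, ih]
    push_cast
    rw [← add_assoc, gFun_add_one hq]
    · simp [nodePoly]; ring
    · have := h1.sub (isZ_natCast n); rwa [show x - c - n = x - (c + n) by ring] at this
    · obtain ⟨m, hm⟩ := h2
      exact ⟨m + n, by push_cast; linarith⟩

theorem eval_nodePoly_eq_zero {h : ℂ} {a x : ℚ} {n : ℕ} (h1 : IsZ (x - a)) (h2 : a ≤ x)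
    (h3 : x < a + n) : (nodePoly h a n).eval (lam h x) = 0 := by
  obtain ⟨m, hm⟩ := h1.isNat (by linarith)
  rw [nodePoly, eval_prod]
  refine Finset.prod_eq_zero (i := m) (Finset.mem_range.2 ?_) ?_
  · have : (m : ℚ) < n := by linarith
    exact_mod_cast this
  · rw [← hm]; simp

open Polynomial

/-! ### A `6j` coefficient as a polynomial in `[x][x+1]` -/

/-- The coefficients of `sixPoly`. -/
noncomputable def sixCoeff (h : ℂ) (a b e d c : ℚ) (z : ℕ) : ℂ :=
  sgn z * qfact h (a + b - e + z) * qfact h (c + d - e + z) * qfact h (2 * e - z) * rfact h z *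
    rfact h (c - d + e - z) * rfact h (e - a + b - z)

/-- The polynomial in `[x][x+1]` that carries the dependence on `x` of `{a b e; d c x}`. -/
noncomputable def sixPoly (h : ℂ) (a b e d c : ℚ) : ℂ[X] :=
  ∑ z ∈ Finset.range (⌊e - a + b⌋₊ + 1), C (sixCoeff h a b e d c z) *
    newton h (b + d) (⌊e - a + b⌋₊ - z)

theorem eval_newton {h : ℂ} (hq : Generic h) (M x : ℚ) (m : ℕ) :
    (newton h M m).eval (lam h x) = poch h (M - m - x + 1) m * poch h (M - m + x + 2) m := by
  rw [newton, eval_prod, ← Finset.prod_range_reflect, poch, poch, ← Finset.prod_mul_distrib]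
  refine Finset.prod_congr rfl fun i hi => ?_
  rw [eval_sub, eval_C, eval_X, lam_sub_lam hq,
    Nat.cast_sub (by have := Finset.mem_range.1 hi; omega),
    Nat.cast_sub (by have := Finset.mem_range.1 hi; omega)]
  congr 2 <;> (push_cast; ring)

/-- No condition is put on `x`, so Sears' transformation of the right-hand side amounts to an
identity between polynomials. -/
theorem eval_sixPoly {h : ℂ} (hq : Generic h) {a b e d c : ℚ} (h1 : Triangle a b e)
    (h4 : Triangle d c e) {n : ℕ} (hn : e - a + b = n) (x : ℚ) :
    (sixPoly h a b e d c).eval (lam h x) =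
      (-1) ^ n * qfact h (a + b - e) * qfact h (c + d - e) * qfact h (2 * e - n) *
        rfact h (c - d + e) * bal h n (a + b - e + 1) (c + d - e + 1) (-(c - d + e))
          (a + d - e - x + 1) (a + d - e + x + 2) (-(2 * e)) := by
  rw [sixPoly, hn, Nat.floor_natCast, eval_finsetSum, bal, Finset.mul_sum]
  refine Finset.sum_congr rfl fun k hk => ?_
  have hk := Nat.lt_succ_iff.1 (Finset.mem_range.1 hk)
  have m1 := h1.isNat₃
  have m2 : IsNat (c + d - e) := by rw [add_comm]; exact h4.isNat₃
  have m3 : IsNat (2 * e - n) := by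
    rw [show 2 * e - n = a - b + e by linarith]; exact h1.isNat₂
  have m4 : IsNat (c - d + e) := by rw [show c - d + e = c + e - d by ring]; exact h4.isNat₁
  rw [eval_mul, eval_C, eval_newton hq, sixCoeff, hn, sgn_natCast, qfact_add_nat m1,
    qfact_add_nat m2, qfact_sub_nat m3 hk, rfact_sub_nat hq m4.isZ, Nat.cast_sub hk,
    show b + d - ((n : ℚ) - k) - x + 1 = a + d - e - x + 1 + k by linarith,
    show b + d - ((n : ℚ) - k) + x + 2 = a + d - e + x + 2 + k by linarith]
  have r := rfact_nat_mul (h := h) hk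
  obtain ⟨m, rfl⟩ := Nat.exists_eq_add_of_le hk
  rw [Nat.add_sub_cancel_left] at r ⊢
  rw [pow_add, div_eq_mul_inv, ← r]
  ring

theorem polynomial_eq_of_eval_lam {h : ℂ} (hq : Generic h) {P Q : ℂ[X]}
    (H : ∀ x, P.eval (lam h x) = Q.eval (lam h x)) : P = Q := by
  refine eq_of_infinite_eval_eq P Q (Set.Infinite.mono
    (s := Set.range fun m : ℕ => lam h m) ?_ (Set.infinite_range_of_injective fun m k e => ?_))
  · rintro _ ⟨m, rfl⟩
    exact H m
  · by_contra hmk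
    wlog hlt : k < m generalizing m k
    · exact this k m e.symm (Ne.symm hmk) (lt_of_le_of_ne (not_lt.1 hlt) hmk)
    exact lam_sub_ne_zero hq ((isZ_natCast m).sub (isZ_natCast k))
      ((isZ_natCast m).add (isZ_natCast k)) k.cast_nonneg (by exact_mod_cast hlt) (sub_eq_zero.2 e)

theorem bal_rotate (h : ℂ) (n : ℕ) (a b c d e f : ℚ) :
    bal h n a b c d e f = bal h n a b c f d e :=
  Finset.sum_congr rfl fun _ _ => by ring

theorem bal_swap (h : ℂ) (n : ℕ) (a b c d e f : ℚ) :
    bal h n a b c d e f = bal h n b a c d e f :=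
  Finset.sum_congr rfl fun _ _ => by ring

theorem bal_reverse (h : ℂ) (n : ℕ) (a b c d e f : ℚ) :
    bal h n a b c d e f = bal h n c b a d f e :=
  Finset.sum_congr rfl fun _ _ => by ring

theorem eval_nodePoly {h : ℂ} (hq : Generic h) (c x : ℚ) (n : ℕ) :
    (nodePoly h (c - n) n).eval (lam h x) = (-1) ^ n * (poch h (-x - c) n * poch h (x + 1 - c) n) := by
  rw [nodePoly, eval_prod, ← Finset.prod_range_reflect, poch, poch, ← Finset.prod_mul_distrib,
    ← Finset.card_range n, ← Finset.prod_const, Finset.card_range, ← Finset.prod_mul_distrib]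
  refine Finset.prod_congr rfl fun i hi => ?_
  have hi := Finset.mem_range.1 hi
  rw [eval_sub, eval_C, eval_X, lam_sub_lam hq, Nat.cast_sub (by omega), Nat.cast_sub (by omega),
    neg_one_mul, ← neg_mul, ← qnum_neg, mul_comm]
  congr 2 <;> (push_cast; ring)

/-- By Sears' transformation `sixPoly` vanishes at the lattice points between `a - c` and
`b - d`. -/
theorem nodePoly_dvd_sixPoly {h : ℂ} (hq : Generic h) {a b e d c : ℚ} (h1 : Triangle a b e)
    (h4 : Triangle d c e) {δ : ℕ} (hδ : b - d - (a - c) = δ) :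
    nodePoly h (a - c) δ ∣ sixPoly h a b e d c := by
  obtain ⟨n, hn⟩ := h1.isNat₁
  obtain ⟨t, ht⟩ := h4.isNat₂
  have hn' : e - a + b = n := by linarith
  have hnt : n = t + δ := by
    have : (n : ℚ) = ((t + δ : ℕ) : ℚ) := by push_cast; linarith
    exact_mod_cast this
  -- Sears' transformation puts into the `k`-th term the nodes at the `n - k` lattice points just
  -- below `b - d`, and makes the terms with `k > t` vanish. Each remaining term has `n - k ≥ δ`,
  -- hence contains all `δ` points from `a - c` to `b - d - 1`. The witness is the sum of the
  -- cofactors.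
  refine ⟨∑ k ∈ Finset.range (t + 1), C ((-1) ^ n * qfact h (a + b - e) * qfact h (c + d - e) *
    qfact h (2 * e - n) * rfact h (c - d + e) * ((-1) ^ n * poch h (a + b - e + 1) k *
      poch h (-(2 * e) - (c + d - e + 1)) k * poch h (-(2 * e) + (c - d + e)) k *
      poch h (-(2 * e) + k) (n - k) / (nfact h k * nfact h (n - k)))) *
    nodePoly h (b - d - ((n - k : ℕ) : ℚ)) (t - k), polynomial_eq_of_eval_lam hq fun x => ?_⟩
  rw [eval_sixPoly hq h1 h4 hn', bal_rotate, sears hq n (by linarith), eval_mul,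
    eval_finsetSum, Finset.mul_sum, Finset.mul_sum]
  have hsub : Finset.range (t + 1) ⊆ Finset.range (n + 1) :=
    Finset.range_subset_range.2 (by omega)
  rw [← Finset.sum_subset hsub]
  · refine Finset.sum_congr rfl fun k hk => ?_
    have hk := Nat.lt_succ_iff.1 (Finset.mem_range.1 hk)
    have e1 : nodePoly h (a - c) δ * nodePoly h (b - d - ((n - k : ℕ) : ℚ)) (t - k) =
        nodePoly h (b - d - ((n - k : ℕ) : ℚ)) (n - k) := by
      rw [mul_comm, show n - k = t - k + δ by omega, nodePoly_add]
      congr 2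
      push_cast [hk]; linarith
    have e2 := congrArg (eval (lam h x)) e1
    rw [eval_mul, eval_nodePoly hq] at e2
    rw [eval_mul, eval_C, mul_left_comm, e2, show a + d - e - x + 1 - (a + b - e + 1) =
      -x - (b - d) by ring, show a + d - e + x + 2 - (a + b - e + 1) = x + 1 - (b - d) by ring,
      sub_neg_eq_add]
    obtain ⟨m, rfl⟩ := Nat.exists_eq_add_of_le (show k ≤ n by omega)
    rw [Nat.add_sub_cancel_left, pow_add]
    have s1 : ((-1 : ℂ) ^ m * (-1) ^ m) = 1 := by rw [← mul_pow]; simp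
    linear_combination (-(-1 : ℂ) ^ k * (-1) ^ m * qfact h (a + b - e) * qfact h (c + d - e) *
      qfact h (2 * e - ((k + m : ℕ) : ℚ)) * rfact h (c - d + e) * ((-1) ^ k *
      poch h (a + b - e + 1) k *
      poch h (-(2 * e) - (c + d - e + 1)) k * poch h (-(2 * e) + (c - d + e)) k *
      poch h (-(2 * e) + k) m / (nfact h k * nfact h m)) * poch h (-x - (b - d)) m *
      poch h (x + 1 - (b - d)) m) * s1
  · intro k _ hk
    have hk : t < k := by simpa using hk
    rw [poch_eq_zero (a := -(2 * e) - -(c - d + e)) t hk (by linarith)]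
    ring

/-- A symmetry makes the length `b + e - a` of the Racah series independent of `x`. Sears'
transformation then places `x` in the parameters `a+d-e-x+1` and `a+d-e+x+2`, whose shifted
factorials together depend only on `λ_x`. -/
theorem sixJ_eq_sixPoly {h : ℂ} (hq : Generic h) {a b e d c x : ℚ} (H : Tetra a b e d c x) :
    sixJ h a b e d c x = sgn (b + c + e + x) *
      (nabla h a c x * nabla h d b x / (nabla h a b e * nabla h d c e)) *
      ((sixPoly h a b e d c).eval (lam h x) * eFun h (b + d) x) := by
  have H' : Tetra b x d c e a := tetra_flip₂₃.1 (tetra_columns₂₃.1 (tetra_columns₁₂.1 H))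
  obtain ⟨n, hn⟩ := H'.2.1.isNat₃
  obtain ⟨h1, h2, h3, h4⟩ := id H
  have e1 : racahJ h a b e d c x = racahJ h b x d c e a := by
    rw [racahJ_columns₁₂, racahJ_columns₂₃, racahJ_columns₁₂, racahJ_columns₂₃, racahJ_flip,
      racahJ_columns₂₃, racahJ_columns₁₂]
  have hz : IsZ (b + x + e + c) := by
    obtain ⟨t₁, t₂, t₃, t₄, q₁, q₂, q₃, -, -, -, -, -, -, e7⟩ := H.exists_nat
    exact ⟨q₃, by push_cast; linarith⟩
  have m1 := h1.isNat₁
  have m2 := h2.isNat₁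
  have m3 := h3.isNat₁
  have m4 := h4.isNat₁
  have p1 := h1.isNat₃.nonneg
  have p2 := h2.isNat₁.nonneg
  have p3 := h3.isNat₁.nonneg
  have p3' := h3.isNat₂.nonneg
  have p3'' := h3.isNat₃.nonneg
  have p4 := h4.isNat₁.nonneg
  have p5 := h4.isNat₂.nonneg
  have x0 := h3.2.2.1.nonneg
  have b0 := h3.2.1.nonneg
  have d0 := h3.1.nonneg
  have hb : bal h n (-(x + c - a)) (-(e + c - d)) (-(b + x - d)) (d + a - x - e + 1)
      (d + a - b - c + 1) (-(b + x + e + c) - 1) = bal h n (a + b - e + 1) (c + d - e + 1)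
        (-(c - d + e)) (a + d - e - x + 1) (a + d - e + x + 2) (-(2 * e)) := by
    rw [bal_swap, bal_sears hq n (by linarith), bal_reverse, ← hn]
    congr 1 <;> ring
  rw [H.sixJ_eq_racahJ hq, e1, racahJ_eq_bal hq H' hn, hb,
    eval_sixPoly hq h1 h4 (n := n) (by linarith)]
  have t1 : tri h a b e = qfact h (a + b - e) * qfact h (a - b + e) / nabla h a b e :=
    eq_div_of_mul_eq (nabla_ne_zero hq _ _ _) (by rw [mul_comm, nabla_mul_tri hq])
  have t4 : tri h d c e = qfact h (d + c - e) * qfact h (d - c + e) / nabla h d c e :=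
    eq_div_of_mul_eq (nabla_ne_zero hq _ _ _) (by rw [mul_comm, nabla_mul_tri hq])
  have t2 : tri h a c x = nabla h a c x * qfact h (c + x - a) / qfact h (a + c + x + 1) := by
    rw [nabla_eq_tri hq]
    field_simp [qfact_ne_zero hq (c + x - a), qfact_ne_zero hq (a + c + x + 1)]
  have t3 : tri h d b x = nabla h d b x * qfact h (b + x - d) / qfact h (d + b + x + 1) := by
    rw [nabla_eq_tri hq]
    field_simp [qfact_ne_zero hq (b + x - d), qfact_ne_zero hq (d + b + x + 1)]
  rw [t1, t2, t3, t4, eFun, rfact_of_nonneg h (show 0 ≤ x + c - a by linarith),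
    rfact_of_nonneg h (show 0 ≤ e + c - d by linarith),
    rfact_of_nonneg h (show 0 ≤ b + x - d by linarith),
    rfact_of_nonneg h (show 0 ≤ b + d - x by linarith),
    rfact_of_nonneg h (show 0 ≤ e + d - c by linarith),
    rfact_of_nonneg h (show 0 ≤ c - d + e by linarith),
    rfact_of_nonneg h (show 0 ≤ b + d + x + 1 by linarith), sgn_add hz (isZ_natCast n),
    sgn_natCast, show b + c + e + x = b + x + e + c by ring, show 2 * e - n = a - b + e by linarith,
    show c - d + e = e + c - d by ring, show c + d - e = d + c - e by ring,
    show x + c - a = c + x - a by ring, show c + x + a + 1 = a + c + x + 1 by ring,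
    show d + b + x + 1 = b + d + x + 1 by ring, show e + d - c = d - c + e by ring]
  have Q := qfact_ne_zero hq
  refine eq_of_eq_mul_one (u := qfact h (c + x - a) / qfact h (c + x - a) *
    (qfact h (a + c + x + 1) / qfact h (a + c + x + 1)) * (qfact h (b + x - d) / qfact h (b + x - d)) *
    (qfact h (d - c + e) / qfact h (d - c + e))) ?_ (by ring)
  rw [div_self (Q _), div_self (Q _), div_self (Q _), div_self (Q _)]
  norm_num

/-! ### Zeros of polynomials and the star functional at a negative base. -/

open Polynomial

/-- `P` vanishes, as a polynomial in `[x][x+1]`, at the lattice points from `a` to `b - 1`. -/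
def VanishesBetween (h : ℂ) (a b : ℚ) (P : ℂ[X]) : Prop := ∀ n : ℕ, b - a = n → nodePoly h a n ∣ P

theorem VanishesBetween.eval_eq_zero {h : ℂ} {a b x : ℚ} {P : ℂ[X]} (H : VanishesBetween h a b P)
    (hab : IsZ (b - a)) (hx : IsZ (x - a)) (h1 : a ≤ x) (h2 : x < b) : P.eval (lam h x) = 0 := by
  obtain ⟨n, hn⟩ := hab.isNat (by linarith)
  obtain ⟨Q, rfl⟩ := H n hn
  rw [eval_mul, eval_nodePoly_eq_zero hx h1 (by linarith), zero_mul]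

/-- The zeros seen through the reflection `x ↦ -1 - x`: the points `a, …, b - 1` go to `-b, …, -a -
1`. -/
theorem VanishesBetween.eval_eq_zero' {h : ℂ} {a b x : ℚ} {P : ℂ[X]} (H : VanishesBetween h a b P)
    (hab : IsZ (b - a)) (hx : IsZ (x + b)) (h1 : -b ≤ x) (h2 : x < -a) :
    P.eval (lam h x) = 0 := by
  obtain ⟨n, hn⟩ := hab.isNat (by linarith)
  obtain ⟨Q, rfl⟩ := H n hn
  rw [← nodePoly_reflect, show -a - n = -b by linarith, eval_mul,
    eval_nodePoly_eq_zero (by rwa [sub_neg_eq_add]) h1 (by linarith), zero_mul]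

/-- The least non-negative point of a lattice. -/
theorem exists_lattice_min {s : ℚ} (hs : IsSpin s) :
    ∃ c : ℚ, 0 ≤ c ∧ IsZ (s - c) ∧ IsZ (2 * c) ∧ ∀ x, 0 ≤ x → IsZ (s - x) → c ≤ x := by
  obtain ⟨n, rfl⟩ := hs
  obtain ⟨m, rfl | rfl⟩ := n.even_or_odd'
  · exact ⟨0, le_rfl, ⟨m, by push_cast; ring⟩, ⟨0, by simp⟩, fun x hx _ => hx⟩
  · refine ⟨1 / 2, by norm_num, ⟨m, by push_cast; ring⟩, ⟨1, by norm_num⟩, ?_⟩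
    rintro x hx ⟨k, hk⟩
    push_cast at hk
    have h1 : ((k - m : ℤ) : ℚ) < ((1 : ℤ) : ℚ) := by push_cast; linarith
    have h2 : k - m < 1 := by exact_mod_cast h1
    have h3 : ((k - m : ℤ) : ℚ) ≤ ((0 : ℤ) : ℚ) := by exact_mod_cast (by omega : k - m ≤ 0)
    push_cast at h3
    linarith

/-- The star functional, applied to a product of two polynomials with prescribed zeros, is a sum
over the admissible part of the lattice, also for negative `c`. -/
theorem starFun_mul_eq_latSum {h : ℂ} (hq : Generic h) {s M M' c d1 d2 d3 d4 : ℚ} {P Q : ℂ[X]}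
    (H : OnLattice s M M' c) (hM : M ≤ s) (z1 : IsZ (s - d1)) (z2 : IsZ (s - d2))
    (z3 : IsZ (s - d3)) (z4 : IsZ (s - d4)) (hP : VanishesBetween h d1 d2 P)
    (hQ : VanishesBetween h d3 d4 Q) (h14 : d1 ≤ d4) (hc2 : -d2 ≤ c) (hc3 : d3 ≤ c) :
    starFun h s M M' c (P * Q) = latSum s fun x => open Classical in
      if |d1| ≤ x ∧ |d2| ≤ x ∧ |d3| ≤ x ∧ |d4| ≤ x then
        sgn (s - x) * wt h x * gFun h c x * ((P * Q).eval (lam h x) * eFun h M x * eFun h M' x)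
      else 0 := by
  obtain ⟨hs, hz, hz', hzc⟩ := id H
  obtain ⟨S, eS⟩ := hs.two_mul_isNat.isZ
  obtain ⟨n1, e1⟩ := z1
  obtain ⟨n2, e2⟩ := z2
  obtain ⟨n3, e3⟩ := z3
  obtain ⟨n4, e4⟩ := z4
  obtain ⟨nc, ec⟩ := id hzc
  -- If `P` does not vanish then `-d1 ≤ x`, and if `Q` does not vanish then `d4 ≤ x`. By `h14`, `x`
  -- then also lies above `d1` and `-d4`, so it is past the zeros below `d2` and the reflected zeros
  -- below `-d3`.
  have van : ∀ x, 0 ≤ x → IsZ (s - x) → -d2 ≤ x → d3 ≤ x →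
      ¬ (|d1| ≤ x ∧ |d2| ≤ x ∧ |d3| ≤ x ∧ |d4| ≤ x) → (P * Q).eval (lam h x) = 0 := by
    rintro x hx ⟨k, ek⟩ hx2 hx3 hn
    rw [eval_mul]
    by_contra H0
    have p0 := left_ne_zero_of_mul H0
    have q0 := right_ne_zero_of_mul H0
    have k1 : -d1 ≤ x := by
      by_contra hlt
      exact p0 (hP.eval_eq_zero' ⟨n1 - n2, by push_cast; linarith⟩ ⟨S - n2 - k, by push_cast; linarith⟩
        hx2 (not_le.1 hlt))
    have k4 : d4 ≤ x := by
      by_contra hlt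
      exact q0 (hQ.eval_eq_zero ⟨n3 - n4, by push_cast; linarith⟩ ⟨n3 - k, by push_cast; linarith⟩
        hx3 (not_le.1 hlt))
    have k2 : d2 ≤ x := by
      by_contra hlt
      exact p0 (hP.eval_eq_zero ⟨n1 - n2, by push_cast; linarith⟩ ⟨n1 - k, by push_cast; linarith⟩
        (by linarith) (not_le.1 hlt))
    have k3 : -d3 ≤ x := by
      by_contra hlt
      exact q0 (hQ.eval_eq_zero' ⟨n3 - n4, by push_cast; linarith⟩ ⟨S - n4 - k, by push_cast; linarith⟩
        (by linarith) (not_le.1 hlt))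
    exact hn ⟨abs_le.2 ⟨by linarith, by linarith⟩, abs_le.2 ⟨by linarith, by linarith⟩,
      abs_le.2 ⟨by linarith, by linarith⟩, abs_le.2 ⟨by linarith, by linarith⟩⟩
  obtain hc | hc := le_or_gt 0 c
  · rw [starFun_eq_latSum hq H hM hc]
    refine latSum_congr hs.nonneg fun x hx hsx => ?_
    split_ifs with hd
    · rfl
    · obtain hxc | hxc := lt_or_ge x c
      · rw [gFun_of_lt h hxc]; ring
      · rw [van x hx hsx.isZ (by linarith) (by linarith) hd]; ring
  -- For `c < 0` a block of zeros at `-D, …, c0 - 1` is split off from `P * Q` and used to raise the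
  -- base to the least non-negative lattice point `c0`. The choice `D = min d2 (-d3)` keeps `-D ≤
  -- c`.
  · obtain ⟨c0, hc0, ⟨m0, em0⟩, ⟨t0, et0⟩, hmin⟩ := exists_lattice_min hs
    have hd2 : 0 < d2 := by linarith
    have hd3 : d3 < 0 := by linarith
    obtain ⟨D, hD, hD2, hD3, hcD, zD⟩ : ∃ D, 0 < D ∧ D ≤ d2 ∧ D ≤ -d3 ∧ -D ≤ c ∧ IsZ (s - D) := by
      obtain hle | hle := le_total d2 (-d3)
      · exact ⟨d2, hd2, le_rfl, hle, hc2, n2, e2⟩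
      · exact ⟨-d3, by linarith, hle, le_rfl, by linarith, S - n3, by push_cast; linarith⟩
    obtain ⟨nD, eD⟩ := zD
    have hc0D := hmin D hD.le ⟨nD, eD⟩
    obtain ⟨N, hN⟩ := IsZ.isNat (x := D + c0) ⟨S - nD - m0, by push_cast; linarith⟩ (by linarith)
    obtain ⟨m, hm⟩ := IsZ.isNat (x := c + D) ⟨S - nc - nD, by push_cast; linarith⟩ (by linarith)
    have hR : ∃ R, P * Q = nodePoly h (-D) N * R ∧
        ∀ x, 0 ≤ x → IsZ (s - x) → x < D → R.eval (lam h x) = 0 := by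
      -- For `d1 ≤ 0` the block is, after reflection to `-c0, …, D - 1`, among the zeros of `P`. For
      -- `d1 > 0` it is among those of `Q`, since `d4 ≥ d1 > 0`. The cofactor keeps enough zeros to
      -- vanish at every lattice point `0 ≤ x < D`.
      obtain hd1 | hd1 := le_or_gt d1 0
      · have hc1 := hmin (-d1) (by linarith) ⟨S - n1, by push_cast; linarith⟩
        obtain ⟨p, hp⟩ := IsZ.isNat (x := -c0 - d1) ⟨m0 + n1 - S, by push_cast; linarith⟩
          (by linarith)
        obtain ⟨r, hr⟩ := IsZ.isNat (x := d2 - D) ⟨nD - n2, by push_cast; linarith⟩ (by linarith)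
        obtain ⟨A, hA⟩ := hP (p + N + r) (by push_cast; linarith)
        rw [nodePoly_add, nodePoly_add] at hA
        have f1 : nodePoly h (d1 + p) N = nodePoly h (-D) N := by
          rw [show d1 + p = -c0 by linarith, ← nodePoly_reflect]
          congr 1; linarith
        rw [f1] at hA
        refine ⟨nodePoly h d1 p * nodePoly h (d1 + ((p + N : ℕ) : ℚ)) r * A * Q,
          by rw [hA]; ring, fun x hx hsx hxD => ?_⟩
        have hxc := hmin x hx hsx
        obtain ⟨k, ek⟩ := hsx
        obtain hlt | hge := lt_or_ge x (-d1)
        · have : (nodePoly h d1 p).eval (lam h x) = 0 := by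
            rw [← nodePoly_reflect]
            exact eval_nodePoly_eq_zero (a := -d1 - p) ⟨m0 - k, by push_cast; linarith⟩
              (by linarith) (by linarith)
          simp [eval_mul, this]
        · have := hQ.eval_eq_zero' ⟨n3 - n4, by push_cast; linarith⟩
            (x := x) ⟨S - n4 - k, by push_cast; linarith⟩ (by linarith) (by linarith)
          simp [eval_mul, this]
      · have hc4 := hmin d4 (by linarith) ⟨n4, e4⟩
        obtain ⟨p, hp⟩ := IsZ.isNat (x := -D - d3) ⟨nD + n3 - S, by push_cast; linarith⟩
          (by linarith)
        obtain ⟨r, hr⟩ := IsZ.isNat (x := d4 - c0) ⟨m0 - n4, by push_cast; linarith⟩ (by linarith)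
        obtain ⟨A, hA⟩ := hQ (p + N + r) (by push_cast; linarith)
        rw [nodePoly_add, nodePoly_add, show d3 + p = -D by linarith] at hA
        refine ⟨P * (nodePoly h d3 p * nodePoly h (d3 + ((p + N : ℕ) : ℚ)) r * A),
          by rw [hA]; ring, fun x hx hsx hxD => ?_⟩
        have hxc := hmin x hx hsx
        obtain ⟨k, ek⟩ := hsx
        obtain hlt | hge := lt_or_ge x d4
        · have : (nodePoly h (d3 + ((p + N : ℕ) : ℚ)) r).eval (lam h x) = 0 :=
            eval_nodePoly_eq_zero ⟨m0 - k, by push_cast; linarith⟩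
              (by push_cast; linarith) (by push_cast; linarith)
          rw [eval_mul, eval_mul, eval_mul, this]; ring
        · have := hP.eval_eq_zero ⟨n1 - n2, by push_cast; linarith⟩
            (x := x) ⟨n1 - k, by push_cast; linarith⟩ (by linarith) (by linarith)
          rw [eval_mul, this, zero_mul]
    obtain ⟨R, hR, hR0⟩ := hR
    have HD : OnLattice s M M' (-D) := ⟨hs, hz, hz', S - nD, by push_cast; linarith⟩
    have H0 : OnLattice s M M' c0 := ⟨hs, hz, hz', m0, em0⟩
    -- Both shifts start at `-D`: the block of length `m` leads to `c` and the block of length `N`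
    -- to `c0`. Exchanging them turns the functional at `c` into the one at `c0`, which is a sum.
    rw [show c = -D + m by linarith, ← starFun_nodePoly hq HD, hR, mul_left_comm,
      starFun_nodePoly hq HD, show -D + N = c0 by linarith, starFun_eq_latSum hq H0 hM hc0]
    refine latSum_congr hs.nonneg fun x hx hsx => ?_
    obtain ⟨k, ek⟩ := hsx.isZ
    obtain hxD | hxD := lt_or_ge x D
    · rw [eval_mul, hR0 x hx hsx.isZ hxD, if_neg]
      · ring
      · rintro ⟨-, h2, -, -⟩
        linarith [le_abs_self d2]
    have a1 : IsNat (x + -D) := IsZ.isNat ⟨nD - k, by push_cast; linarith⟩ (by linarith)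
    have a2 : IsZ (x - -D) := ⟨S - nD - k, by push_cast; linarith⟩
    have g1 := eval_nodePoly_mul_gFun hq a2 a1 N
    have g2 := eval_nodePoly_mul_gFun hq a2 a1 m
    rw [show -D + N = c0 by linarith] at g1
    have key : sgn (s - x) * wt h x * gFun h c0 x *
        ((nodePoly h (-D) m * R).eval (lam h x) * eFun h M x * eFun h M' x) =
        sgn (s - x) * wt h x * gFun h (-D + m) x *
          ((nodePoly h (-D) N * R).eval (lam h x) * eFun h M x * eFun h M' x) := by
      rw [← g1, ← g2, eval_mul, eval_mul]; ring
    rw [key]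
    split_ifs with hd
    · rfl
    · rw [← hR, van x hx hsx.isZ (by linarith) (by linarith) hd]; ring

/-! ### The triple sum for `l₄ = k₄ + j₁`. -/

open Polynomial

theorem sixJ_stretched_f_db {h : ℂ} (hq : Generic h) {a b e d c f : ℚ} (H : Tetra a b e d c f)
    (hf : f = d + b) :
    sixJ h a b e d c f = sgn (d + c + b + a) * (sfact h (2 * d) * sfact h (2 * b) /
      sfact h (2 * f + 1)) * (nabla h f a c / (nabla h d c e * nabla h b a e)) := by
  rw [sixJ_flip hq, sixJ_stretched hq (tetra_flip.1 H) hf]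

theorem newton_mul_eFun {h : ℂ} (hq : Generic h) {M x : ℚ} (h1 : IsZ (M - x)) (h2 : IsZ (M + x))
    (m : ℕ) : (newton h M m).eval (lam h x) * eFun h M x = eFun h (M - m) x :=
  (eFun_sub_nat hq h1 h2 m).symm

theorem sixPoly_eval_mul_eFun {h : ℂ} (hq : Generic h) {a b e d c x : ℚ} (hn : IsNat (e - a + b))
    (h1 : IsZ (b + d - x)) (h2 : IsZ (b + d + x)) :
    (sixPoly h a b e d c).eval (lam h x) * eFun h (b + d) x =
      ∑ z ∈ Finset.range (⌊e - a + b⌋₊ + 1), sixCoeff h a b e d c z * eFun h (a + d - e + z) x := by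
  obtain ⟨n, hn⟩ := hn
  rw [sixPoly, eval_finsetSum, Finset.sum_mul]
  refine Finset.sum_congr rfl fun z hz => ?_
  rw [hn, Nat.floor_natCast] at hz ⊢
  have hz := Nat.lt_succ_iff.1 (Finset.mem_range.1 hz)
  rw [eval_mul, eval_C, mul_assoc, newton_mul_eFun hq h1 h2, Nat.cast_sub hz]
  congr 2; linarith

/-- A coefficient survives only for `z ≤ c - d + e`, where the parameter of `eFun` is at most `a + c
< x`. This enforces the upper triangular bound on `x`. -/
theorem sixPoly_eval_mul_eFun_eq_zero {h : ℂ} (hq : Generic h) {a b e d c x : ℚ}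
    (hn : IsNat (e - a + b)) (h1 : IsZ (b + d - x)) (h2 : IsZ (b + d + x)) (hx : a + c < x) :
    (sixPoly h a b e d c).eval (lam h x) * eFun h (b + d) x = 0 := by
  rw [sixPoly_eval_mul_eFun hq hn h1 h2]
  refine Finset.sum_eq_zero fun z _ => ?_
  obtain hz | hz := lt_or_ge (c - d + e - z) 0
  · rw [sixCoeff, rfact_of_neg h hz]; ring
  · rw [eFun_of_lt h (show a + d - e + z < x by linarith), mul_zero]

theorem starFun_sixPoly_mul {h : ℂ} (hq : Generic h) {s c a b e d c' a₁ b₁ e₁ d₁ c₁ : ℚ}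
    (H : OnLattice s (b + d) (b₁ + d₁) c) (hn : IsNat (e - a + b)) (hn₁ : IsNat (e₁ - a₁ + b₁)) :
    starFun h s (b + d) (b₁ + d₁) c (sixPoly h a b e d c' * sixPoly h a₁ b₁ e₁ d₁ c₁) =
      ∑ z ∈ Finset.range (⌊e - a + b⌋₊ + 1), ∑ z₁ ∈ Finset.range (⌊e₁ - a₁ + b₁⌋₊ + 1),
        sixCoeff h a b e d c' z * sixCoeff h a₁ b₁ e₁ d₁ c₁ z₁ *
          starVal h s c (a + d - e + z) (a₁ + d₁ - e₁ + z₁) := by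
  obtain ⟨n, hn⟩ := hn
  obtain ⟨n₁, hn₁⟩ := hn₁
  rw [sixPoly, sixPoly, Finset.sum_mul, map_sum]
  refine Finset.sum_congr rfl fun z hz => ?_
  rw [Finset.mul_sum, map_sum]
  refine Finset.sum_congr rfl fun z₁ hz₁ => ?_
  rw [hn, Nat.floor_natCast] at hz ⊢
  rw [hn₁, Nat.floor_natCast] at hz₁ ⊢
  have hz := Nat.lt_succ_iff.1 (Finset.mem_range.1 hz)
  have hz₁ := Nat.lt_succ_iff.1 (Finset.mem_range.1 hz₁)
  rw [show C (sixCoeff h a b e d c' z) * newton h (b + d) (n - z) *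
      (C (sixCoeff h a₁ b₁ e₁ d₁ c₁ z₁) * newton h (b₁ + d₁) (n₁ - z₁)) =
      (sixCoeff h a b e d c' z * sixCoeff h a₁ b₁ e₁ d₁ c₁ z₁) •
        (newton h (b + d) (n - z) * newton h (b₁ + d₁) (n₁ - z₁)) by
      rw [smul_eq_C_mul, C_mul]; ring,
    map_smul, starFun_mul_newton hq H, smul_eq_mul, Nat.cast_sub hz, Nat.cast_sub hz₁]
  congr 2 <;> linarith

/-- The coefficients of the middle sum of the stretched case `l₄ = k₄ + j₁`. -/
noncomputable def midCoeff (h : ℂ) (j2 j3 l2 k2 k3 : ℚ) (z : ℕ) : ℂ :=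
  sgn z * qfact h (l2 + j2 - j3 + z) * qfact h (l2 + k3 - k2 + z) * rfact h z *
    rfact h (j2 + j3 - l2 - z) * rfact h (k2 + k3 - l2 - z) * rfact h (2 * l2 + z + 1)

theorem sixSum_eq_midCoeff {h : ℂ} {j2 j3 l2 k2 k3 x : ℚ} (hz : IsZ (j3 + k3 + j2 + k2)) :
    sixSum h j3 k3 x k2 j2 l2 = sgn (j3 + k3 + j2 + k2) *
      ∑ z ∈ Finset.range (⌊j2 + j3 - l2⌋₊ + 1),
        midCoeff h j2 j3 l2 k2 k3 z * gFun h (j3 + k2 - l2 - z) x := by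
  rw [sixSum, Finset.mul_sum, show j3 + j2 - l2 = j2 + j3 - l2 by ring]
  refine Finset.sum_congr rfl fun z _ => ?_
  rw [midCoeff, gFun, sgn_add hz (isZ_natCast z), show j2 + l2 - j3 + z = l2 + j2 - j3 + z by ring,
    show k3 + k2 - l2 - z = k2 + k3 - l2 - z by ring,
    show k3 + l2 - k2 + z = l2 + k3 - k2 + z by ring,
    show j3 + k2 + x - l2 - z = x + (j3 + k2 - l2 - z) by ring,
    show x + l2 - j3 - k2 + z = x - (j3 + k2 - l2 - z) by ring]
  ring

/-- The factor in front of the triple sum of the stretched case `l₄ = k₄ + j₁`. -/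
noncomputable def preFactor (h : ℂ) (j1 j2 j3 j4 l1 l2 l3 l4 k1 k2 k3 k4 : ℚ) : ℂ :=
  sgn (k1 + k2 - k3 - j2 + j3 + j4 - l4) *
    (nabla h j3 j2 l2 * nabla h k2 k3 l2 * nabla h l4 j4 k1 /
      (nabla h j1 j2 l1 * nabla h k2 k1 l1 * nabla h j3 j4 l3 * nabla h k4 k3 l3)) *
    (sfact h (2 * k4) * sfact h (2 * j1) / sfact h (2 * l4 + 1)) *
    qpow h (Z [j1, j2, j3, j4] + Z [k1, k2, k3, k4])

/-- The first and third factors, in `sixPoly` form, carry the `∇` containing `x` in the numerator.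
The second, in the defining form, and the stretched fourth carry the same ones in the denominator,
so no square root depends on `x`. -/
theorem twTerm_stretched_l4 {h : ℂ} (hq : Generic h) {j1 j2 j3 j4 l1 l2 l3 l4 k1 k2 k3 k4 x : ℚ}
    (hadm : Admissible j1 j2 j3 j4 l1 l2 l3 l4 k1 k2 k3 k4) (hl : l4 = k4 + j1)
    (T1 : Tetra j1 j2 l1 k2 k1 x) (T2 : Tetra j3 k3 x k2 j2 l2) (T3 : Tetra j3 j4 l3 k4 k3 x)
    (T4 : Tetra k1 j1 x k4 j4 l4) :
    twTerm h j1 j2 j3 j4 l1 l2 l3 l4 k1 k2 k3 k4 x =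
      preFactor h j1 j2 j3 j4 l1 l2 l3 l4 k1 k2 k3 k4 * sgn (j2 - j3 + l2) *
      ∑ z ∈ Finset.range (⌊j2 + j3 - l2⌋₊ + 1), midCoeff h j2 j3 l2 k2 k3 z *
        (sgn (j2 + k2 - x) * wt h x * gFun h (j3 + k2 - l2 - z) x *
          ((sixPoly h j1 j2 l1 k2 k1 * sixPoly h j3 j4 l3 k4 k3).eval (lam h x) *
            eFun h (j2 + k2) x * eFun h (j4 + k4) x)) := by
  obtain ⟨m1, m2, m3, m4, m5, m6, m7, m8, J1, J2, J3, J4, K1, K2, K3, K4, L1, L2, L3, L4,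
    ⟨e1, e2, e3, e4, e5, e6, e7, e8⟩, ⟨f1, f2, f3, f4⟩, ⟨g1, g2, g3, g4⟩, i1, i2, i3, i4⟩ :=
    hadm.exists_int
  obtain ⟨h1, h2, h3, h4, h5, h6, h7, h8⟩ := hadm
  obtain ⟨m9, e9⟩ := T1.2.1.isZ
  have hz : IsZ (j3 + k3 + j2 + k2) := ⟨(-1) * m2 + m6 + J2 + J3, by push_cast; linarith⟩
  have sg : sgn (j1 + j2 + j3 + j4 + l1 + l2 + l3 + l4 + k1 + k2 + k3 + k4 - x) = sgn (k1 + k2 - k3 - j2 + j3 + j4 - l4) * sgn (j2 - j3 + l2) * sgn (j2 + k2 - x) * sgn (j2 + k1 + l1 + x) * sgn (j3 + k3 + j2 + k2) * sgn (j4 + k3 + l3 + x) * sgn (k4 + j4 + j1 + k1) := by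
    rw [sgn_eq_cis (x := j1 + j2 + j3 + j4 + l1 + l2 + l3 + l4 + k1 + k2 + k3 + k4 - x) ⟨m2 + m5 + m7 + m8 + J1 + (-1) * m9, by push_cast; linarith⟩,
      sgn_eq_cis (x := k1 + k2 - k3 - j2 + j3 + j4 - l4) ⟨(-1) * m1 + m3 + m5 + (-1) * m7, by push_cast; linarith⟩,
      sgn_eq_cis (x := j2 - j3 + l2) ⟨m2 + (-1) * J3, by push_cast; linarith⟩,
      sgn_eq_cis (x := j2 + k2 - x) ⟨(-1) * m1 + m5 + J1 + J2 + (-1) * m9, by push_cast; linarith⟩,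
      sgn_eq_cis (x := j2 + k1 + l1 + x) ⟨m1 + (-1) * J1 + m9, by push_cast; linarith⟩,
      sgn_eq_cis (x := j3 + k3 + j2 + k2) ⟨(-1) * m2 + m6 + J2 + J3, by push_cast; linarith⟩,
      sgn_eq_cis (x := j4 + k3 + l3 + x) ⟨m1 + (-1) * m2 + m3 + (-1) * m5 + m6 + (-1) * J1 + m9, by push_cast; linarith⟩,
      sgn_eq_cis (x := k4 + j4 + j1 + k1) ⟨m8, by linarith⟩,
      ← cis_add, ← cis_add, ← cis_add, ← cis_add, ← cis_add, ← cis_add]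
    exact cis_eq (m2 + (-1) * m3 + (-1) * m6 + m7 + J1 + (-1) * J2 + (-1) * m9) (by push_cast; linarith)
  have pull : ∑ z ∈ Finset.range (⌊j2 + j3 - l2⌋₊ + 1), midCoeff h j2 j3 l2 k2 k3 z *
        (sgn (j2 + k2 - x) * wt h x * gFun h (j3 + k2 - l2 - z) x *
          ((sixPoly h j1 j2 l1 k2 k1 * sixPoly h j3 j4 l3 k4 k3).eval (lam h x) *
            eFun h (j2 + k2) x * eFun h (j4 + k4) x)) =
      (sgn (j2 + k2 - x) * wt h x * ((sixPoly h j1 j2 l1 k2 k1).eval (lam h x) *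
        (sixPoly h j3 j4 l3 k4 k3).eval (lam h x) * eFun h (j2 + k2) x * eFun h (j4 + k4) x)) *
      ∑ z ∈ Finset.range (⌊j2 + j3 - l2⌋₊ + 1),
        midCoeff h j2 j3 l2 k2 k3 z * gFun h (j3 + k2 - l2 - z) x := by
    rw [Finset.mul_sum]
    refine Finset.sum_congr rfl fun z _ => ?_
    rw [eval_mul]; ring
  rw [pull, twTerm, sixJ_eq_sixPoly hq T1, T2.sixJ, sixJ_eq_sixPoly hq T3,
    sixJ_stretched_f_db hq T4 hl, sixSum_eq_midCoeff hz, preFactor, wt,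
    show x * (x + 1) + Z [j1, j2, j3, j4] + Z [k1, k2, k3, k4] =
      x * (x + 1) + (Z [j1, j2, j3, j4] + Z [k1, k2, k3, k4]) by ring, qpow_add h (x * (x + 1)),
    sg, nabla_swap' h l4 k1 j4]
  generalize ∑ z ∈ Finset.range (⌊j2 + j3 - l2⌋₊ + 1),
    midCoeff h j2 j3 l2 k2 k3 z * gFun h (j3 + k2 - l2 - z) x = σ
  have N := nabla_ne_zero hq
  refine eq_of_eq_mul_one (u := (nabla h j1 k1 x / nabla h j1 k1 x) *
    (nabla h k2 j2 x / nabla h k2 j2 x) * (nabla h j3 k3 x / nabla h j3 k3 x) *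
    (nabla h k4 j4 x / nabla h k4 j4 x) * (sgn (j2 + k1 + l1 + x) * sgn (j2 + k1 + l1 + x)) *
    (sgn (j3 + k3 + j2 + k2) * sgn (j3 + k3 + j2 + k2)) *
    (sgn (j4 + k3 + l3 + x) * sgn (j4 + k3 + l3 + x)) *
    (sgn (k4 + j4 + j1 + k1) * sgn (k4 + j4 + j1 + k1))) ?_
    (by simp only [div_eq_mul_inv, mul_inv]; ring)
  rw [div_self (N _ _ _), div_self (N _ _ _), div_self (N _ _ _), div_self (N _ _ _), sgn_mul_self,
    sgn_mul_self, sgn_mul_self, sgn_mul_self]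
  norm_num

open Polynomial

theorem IsSpin.of_isZ {x : ℚ} (hx : IsZ (2 * x)) (h0 : 0 ≤ x) : IsSpin x :=
  (hx.isNat (by linarith)).isSpin

theorem Triangle.abs_sub_le {a b c : ℚ} (H : Triangle a b c) : |a - b| ≤ c := H.2.2.2.2.1

/-- Expanding the second `6j` gives `gFun` with a possibly negative parameter, so each term is a
value of the star functional, equal to a lattice sum cut off at the lower triangular bounds. Beyond
the upper bounds the products of `sixPoly` and `eFun` vanish by themselves. -/
theorem twelveJ_eq_starFun {h : ℂ} (hq : Generic h) {j1 j2 j3 j4 l1 l2 l3 l4 k1 k2 k3 k4 : ℚ}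
    (hadm : Admissible j1 j2 j3 j4 l1 l2 l3 l4 k1 k2 k3 k4) (hl : l4 = k4 + j1) :
    twelveJ h j1 j2 j3 j4 l1 l2 l3 l4 k1 k2 k3 k4 =
      preFactor h j1 j2 j3 j4 l1 l2 l3 l4 k1 k2 k3 k4 * sgn (j2 - j3 + l2) *
      ∑ z ∈ Finset.range (⌊j2 + j3 - l2⌋₊ + 1), midCoeff h j2 j3 l2 k2 k3 z *
        starFun h (j2 + k2) (j2 + k2) (j4 + k4) (j3 + k2 - l2 - z)
          (sixPoly h j1 j2 l1 k2 k1 * sixPoly h j3 j4 l3 k4 k3) := by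
  obtain ⟨m1, m2, m3, m4, m5, m6, m7, m8, J1, J2, J3, J4, K1, K2, K3, K4, L1, L2, L3, L4,
    ⟨e1, e2, e3, e4, e5, e6, e7, e8⟩, ⟨f1, f2, f3, f4⟩, ⟨g1, g2, g3, g4⟩, i1, i2, i3, i4⟩ :=
    hadm.exists_int
  obtain ⟨h1, h2, h3, h4, h5, h6, h7, h8⟩ := hadm
  obtain ⟨u1, v1, w1⟩ := h1.le
  obtain ⟨u2, v2, w2⟩ := h2.le
  obtain ⟨u3, v3, w3⟩ := h3.le
  obtain ⟨u4, v4, w4⟩ := h4.le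
  obtain ⟨u5, v5, w5⟩ := h5.le
  obtain ⟨u6, v6, w6⟩ := h6.le
  obtain ⟨u7, v7, w7⟩ := h7.le
  obtain ⟨u8, v8, w8⟩ := h8.le
  have hs : IsSpin (j2 + k2) := h1.2.2.1.add h5.2.2.1
  have vP : VanishesBetween h (j1 - k1) (j2 - k2) (sixPoly h j1 j2 l1 k2 k1) :=
    fun n hn => nodePoly_dvd_sixPoly hq h1.rot h5.rev hn
  have vQ : VanishesBetween h (j3 - k3) (j4 - k4) (sixPoly h j3 j4 l3 k4 k3) :=
    fun n hn => nodePoly_dvd_sixPoly hq h3.rot h7.rev hn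
  have star : ∀ z ∈ Finset.range (⌊j2 + j3 - l2⌋₊ + 1), midCoeff h j2 j3 l2 k2 k3 z ≠ 0 →
      starFun h (j2 + k2) (j2 + k2) (j4 + k4) (j3 + k2 - l2 - z)
          (sixPoly h j1 j2 l1 k2 k1 * sixPoly h j3 j4 l3 k4 k3) =
        latSum (j2 + k2) fun x => open Classical in
          if |j1 - k1| ≤ x ∧ |j2 - k2| ≤ x ∧ |j3 - k3| ≤ x ∧ |j4 - k4| ≤ x then
            sgn (j2 + k2 - x) * wt h x * gFun h (j3 + k2 - l2 - z) x *
              ((sixPoly h j1 j2 l1 k2 k1 * sixPoly h j3 j4 l3 k4 k3).eval (lam h x) *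
                eFun h (j2 + k2) x * eFun h (j4 + k4) x)
          else 0 := by
    intro z _ hz
    have z1 : 0 ≤ j2 + j3 - l2 - z := by
      by_contra H
      exact hz (by rw [midCoeff, rfact_of_neg h (not_le.1 H)]; ring)
    have z2 : 0 ≤ k2 + k3 - l2 - z := by
      by_contra H
      exact hz (by rw [midCoeff, rfact_of_neg h (not_le.1 H)]; ring)
    -- The bounds `z1` and `z2`, valid wherever `midCoeff` is non-zero, say `-d2 ≤ c` and `d3 ≤ c`.
    -- The condition `d1 ≤ d4` is `l₄ ≤ k₁ + j₄` with `l₄ = k₄ + j₁`.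
    exact starFun_mul_eq_latSum hq ⟨hs, ⟨0, by push_cast; linarith⟩, ⟨(-1) * m1 + m5 + (-1) * m8 + J1 + J2, by push_cast; linarith⟩,
        ⟨m2 + (-1) * J3 + z, by push_cast; linarith⟩⟩ le_rfl
      ⟨(-1) * m1 + m5 + J2, by push_cast; linarith⟩ ⟨(-1) * m1 + (-1) * m2 + m3 + m4 + m5 + m6 + (-1) * m7 + (-1) * m8 + J2, by push_cast; linarith⟩ ⟨(-1) * m2 + m6 + J2, by push_cast; linarith⟩ ⟨(-1) * m1 + m4 + m5 + (-1) * m8 + J2, by push_cast; linarith⟩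
      vP vQ (by linarith) (by linarith) (by linarith)
  have hsum : ∑ z ∈ Finset.range (⌊j2 + j3 - l2⌋₊ + 1), midCoeff h j2 j3 l2 k2 k3 z *
        starFun h (j2 + k2) (j2 + k2) (j4 + k4) (j3 + k2 - l2 - z)
          (sixPoly h j1 j2 l1 k2 k1 * sixPoly h j3 j4 l3 k4 k3) =
      latSum (j2 + k2) fun x => open Classical in
          if |j1 - k1| ≤ x ∧ |j2 - k2| ≤ x ∧ |j3 - k3| ≤ x ∧ |j4 - k4| ≤ x then
            ∑ z ∈ Finset.range (⌊j2 + j3 - l2⌋₊ + 1), midCoeff h j2 j3 l2 k2 k3 z *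
              (sgn (j2 + k2 - x) * wt h x * gFun h (j3 + k2 - l2 - z) x *
              ((sixPoly h j1 j2 l1 k2 k1 * sixPoly h j3 j4 l3 k4 k3).eval (lam h x) *
                eFun h (j2 + k2) x * eFun h (j4 + k4) x))
          else 0 := by
    have step : ∀ z ∈ Finset.range (⌊j2 + j3 - l2⌋₊ + 1), midCoeff h j2 j3 l2 k2 k3 z *
        starFun h (j2 + k2) (j2 + k2) (j4 + k4) (j3 + k2 - l2 - z)
          (sixPoly h j1 j2 l1 k2 k1 * sixPoly h j3 j4 l3 k4 k3) =
        latSum (j2 + k2) fun x => midCoeff h j2 j3 l2 k2 k3 z * open Classical in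
          if |j1 - k1| ≤ x ∧ |j2 - k2| ≤ x ∧ |j3 - k3| ≤ x ∧ |j4 - k4| ≤ x then
            sgn (j2 + k2 - x) * wt h x * gFun h (j3 + k2 - l2 - z) x *
              ((sixPoly h j1 j2 l1 k2 k1 * sixPoly h j3 j4 l3 k4 k3).eval (lam h x) *
                eFun h (j2 + k2) x * eFun h (j4 + k4) x)
          else 0 := by
      intro z hz
      rw [latSum_const_mul]
      by_cases hm : midCoeff h j2 j3 l2 k2 k3 z = 0
      · rw [hm, zero_mul, zero_mul]
      · rw [star z hz hm]
    rw [Finset.sum_congr rfl step, ← latSum_sum]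
    congr 1
    funext x
    split_ifs
    · rfl
    · simp
  rw [hsum, ← latSum_const_mul, twelveJ_eq_spinSum, spinSum_eq_latSum hs]
  · refine latSum_congr hs.nonneg fun x hx hsx => ?_
    obtain ⟨m9, e9⟩ := hsx.isZ
    have sx : IsSpin x := .of_isZ ⟨(-2) * m1 + (2) * m5 + J1 + (2) * J2 + (-1) * K1 + (-2) * m9, by push_cast; linarith⟩ hx
    split_ifs with hd
    · obtain ⟨d1, d2, d3, d4⟩ := hd
      rw [abs_le] at d1 d2 d3 d4
      by_cases hu : x ≤ j1 + k1 ∧ x ≤ j3 + k3 ∧ x ≤ j4 + k4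
      · obtain ⟨u1, u3, u4⟩ := hu
        have tx1 : Triangle j1 k1 x := .mk' h1.2.1 h5.2.1 sx ⟨(-1) * m1 + m5 + J1 + J2 + (-1) * m9, by push_cast; linarith⟩
          (by linarith) (by linarith) u1
        have tx2 : Triangle j2 k2 x := .mk' h1.2.2.1 h5.2.2.1 sx ⟨(-2) * m1 + (2) * m5 + J1 + (2) * J2 + (-1) * K1 + (-1) * m9, by push_cast; linarith⟩
          (by linarith) (by linarith) (by linarith [hsx.nonneg])
        have tx3 : Triangle j3 k3 x := .mk' h3.2.1 h7.2.1 sx ⟨(-1) * m2 + m6 + J2 + J3 + (-1) * m9, by push_cast; linarith⟩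
          (by linarith) (by linarith) u3
        have tx4 : Triangle j4 k4 x := .mk' h3.2.2.1 h7.2.2.1 sx ⟨(-1) * m1 + m5 + m8 + J2 + (-1) * K1 + (-1) * m9, by push_cast; linarith⟩
          (by linarith) (by linarith) u4
        exact twTerm_stretched_l4 hq ⟨h1, h2, h3, h4, h5, h6, h7, h8⟩ hl
          ⟨h1.rot, tx1, tx2.swap, h5.rev⟩ ⟨tx3, h2.rev, h6.rot, tx2.swap⟩
          ⟨h3.rot, tx3, tx4.swap, h7.rev⟩ ⟨tx1.swap, h8.rot, h4.rev, tx4.swap⟩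
      · have t0 : twTerm h j1 j2 j3 j4 l1 l2 l3 l4 k1 k2 k3 k4 x = 0 := by
          by_contra H
          obtain ⟨T1, T2, T3, T4⟩ := twTerm_tetra H
          exact hu ⟨T1.2.1.le₃, T2.1.le₃, by linarith [T3.2.2.1.le₃]⟩
        have p0 : (sixPoly h j1 j2 l1 k2 k1 * sixPoly h j3 j4 l3 k4 k3).eval (lam h x) *
            eFun h (j2 + k2) x * eFun h (j4 + k4) x = 0 := by
          have q1 : j1 + k1 < x → (sixPoly h j1 j2 l1 k2 k1).eval (lam h x) *
              eFun h (j2 + k2) x = 0 := sixPoly_eval_mul_eFun_eq_zero hq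
            (IsZ.isNat ⟨m1 + (-1) * J1, by push_cast; linarith⟩ (by linarith))
            ⟨m9, by linarith⟩ ⟨(-2) * m1 + (2) * m5 + J1 + (2) * J2 + (-1) * K1 + (-1) * m9, by push_cast; linarith⟩
          have q3 : j3 + k3 < x → (sixPoly h j3 j4 l3 k4 k3).eval (lam h x) *
              eFun h (j4 + k4) x = 0 := sixPoly_eval_mul_eFun_eq_zero hq
            (IsZ.isNat ⟨m3 + (-1) * J3, by push_cast; linarith⟩ (by linarith))
            ⟨m1 + (-1) * m5 + m8 + (-1) * J1 + (-1) * J2 + m9, by push_cast; linarith⟩ ⟨(-1) * m1 + m5 + m8 + J2 + (-1) * K1 + (-1) * m9, by push_cast; linarith⟩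
          rw [eval_mul]
          by_cases a1 : x ≤ j1 + k1
          · by_cases a3 : x ≤ j3 + k3
            · rw [eFun_of_lt h (not_le.1 fun a4 => hu ⟨a1, a3, a4⟩), mul_zero]
            · linear_combination (sixPoly h j1 j2 l1 k2 k1).eval (lam h x) *
                eFun h (j2 + k2) x * q3 (not_le.1 a3)
          · linear_combination (sixPoly h j3 j4 l3 k4 k3).eval (lam h x) *
                eFun h (j4 + k4) x * q1 (not_le.1 a1)
        rw [t0]
        simp only [p0, mul_zero, Finset.sum_const_zero]
    · rw [mul_zero]
      by_contra H
      obtain ⟨T1, T2, T3, T4⟩ := twTerm_tetra H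
      exact hd ⟨T1.2.1.abs_sub_le, T1.2.2.1.swap.abs_sub_le, T2.1.abs_sub_le,
        T3.2.2.1.swap.abs_sub_le⟩
  · intro x hx
    by_contra H
    linarith [(twTerm_tetra H).1.2.1.le₃]
  · intro x _ H
    have T := (twTerm_tetra H).1.2.2.1
    have := T.isNat₃
    rwa [add_comm k2 j2] at this

theorem twelveJ_stretched_l4 {h : ℂ} (hq : Generic h)
    {j1 j2 j3 j4 l1 l2 l3 l4 k1 k2 k3 k4 : ℚ}
    (hadm : Admissible j1 j2 j3 j4 l1 l2 l3 l4 k1 k2 k3 k4) (hl : l4 = k4 + j1) :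
      twelveJ h j1 j2 j3 j4 l1 l2 l3 l4 k1 k2 k3 k4 =
        sgn (k1 + k2 - k3 - j2 + j3 + j4 - l4) *
        (nabla h j3 j2 l2 * nabla h k2 k3 l2 * nabla h l4 j4 k1 /
          (nabla h j1 j2 l1 * nabla h k2 k1 l1 * nabla h j3 j4 l3 * nabla h k4 k3 l3)) *
        (sfact h (2 * k4) * sfact h (2 * j1) / sfact h (2 * l4 + 1)) *
        qpow h (-(j1 + k2 - l1 + 1) * (k4 - k2 + l2 - l3) - (l2 - k2 - j3 - 1) * (j3 + k4 - l3)
          + Z [j1, j2, j3, j4] + Z [k1, k2, k3, k4]) *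
        ∑ z1 ∈ Finset.range (⌊l1 - j1 + j2⌋₊ + 1),
        ∑ z2 ∈ Finset.range (⌊j2 + j3 - l2⌋₊ + 1),
        ∑ z3 ∈ Finset.range (⌊l3 - j3 + j4⌋₊ + 1),
          sgn (z1 + z3) * qfact h (j1 + j2 - l1 + z1) * qfact h (k1 + k2 - l1 + z1) *
          qfact h (2 * l1 - z1) *
          rfact h z1 * rfact h z2 * rfact h z3 *
          rfact h (k1 - k2 + l1 - z1) * rfact h (l1 - j1 + j2 - z1) *
          qfact h (l2 + j2 - j3 + z2) * qfact h (l2 + k3 - k2 + z2) *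
          rfact h (j2 + j3 - l2 - z2) * rfact h (k2 + k3 - l2 - z2) * rfact h (2 * l2 + z2 + 1) *
          qfact h (k3 + k4 - l3 + z3) * qfact h (j3 + j4 - l3 + z3) * qfact h (2 * l3 - z3) *
          rfact h (k3 + l3 - k4 - z3) * rfact h (l3 - j3 + j4 - z3) *
          rfact h (j1 - j3 - l1 + l2 + z1 + z2) *
          qpow h (z3 * (l1 - l2 - j1 + j3) - z2 * (j3 + k2 - l1 - l3 + l4 + z3 + 1)
            - z1 * (l2 - l3 - k2 + k4 + z2 + z3)) *
          rfact h (l2 - l3 - k2 + k4 + z2 + z3) *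
          rfact h (j3 + k2 - l1 - l3 + l4 + z1 + z3 + 1) := by
  obtain ⟨m1, m2, m3, m4, m5, m6, m7, m8, J1, J2, J3, J4, K1, K2, K3, K4, L1, L2, L3, L4,
    ⟨e1, e2, e3, e4, e5, e6, e7, e8⟩, ⟨f1, f2, f3, f4⟩, ⟨g1, g2, g3, g4⟩, i1, i2, i3, i4⟩ :=
    hadm.exists_int
  rw [twelveJ_eq_starFun hq hadm hl]
  obtain ⟨h1, h2, h3, h4, h5, h6, h7, h8⟩ := hadm
  obtain ⟨u1, v1, w1⟩ := h1.le
  obtain ⟨u2, v2, w2⟩ := h2.le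
  obtain ⟨u3, v3, w3⟩ := h3.le
  obtain ⟨u4, v4, w4⟩ := h4.le
  obtain ⟨u5, v5, w5⟩ := h5.le
  obtain ⟨u6, v6, w6⟩ := h6.le
  obtain ⟨u7, v7, w7⟩ := h7.le
  obtain ⟨u8, v8, w8⟩ := h8.le
  have hs : IsSpin (j2 + k2) := h1.2.2.1.add h5.2.2.1
  have zs : IsZ (j2 - j3 + l2) := ⟨m2 + (-1) * J3, by push_cast; linarith⟩
  rw [Finset.sum_comm]
  simp only [Finset.mul_sum (Finset.range (⌊j2 + j3 - l2⌋₊ + 1))]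
  refine Finset.sum_congr rfl fun z2 _ => ?_
  rw [starFun_sixPoly_mul hq ⟨hs, ⟨0, by push_cast; linarith⟩, ⟨(-1) * m1 + m5 + (-1) * m8 + J1 + J2, by push_cast; linarith⟩,
        ⟨m2 + (-1) * J3 + z2, by push_cast; linarith⟩⟩ (IsZ.isNat ⟨m1 + (-1) * J1, by push_cast; linarith⟩ (by linarith))
        (IsZ.isNat ⟨m3 + (-1) * J3, by push_cast; linarith⟩ (by linarith))]
  simp only [Finset.mul_sum]
  refine Finset.sum_congr rfl fun z1 _ => Finset.sum_congr rfl fun z3 _ => ?_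
  rw [sixCoeff, sixCoeff, midCoeff, starVal, preFactor,
    show j2 + k2 - (j3 + k2 - l2 - z2) = j2 - j3 + l2 + z2 by ring, sgn_add zs (isZ_natCast z2),
    sgn_add (isZ_natCast z1) (isZ_natCast z3),
    show j1 + k2 - l1 + z1 - (j3 + k2 - l2 - z2) = j1 - j3 - l1 + l2 + z1 + z2 by ring,
    show j3 + k4 - l3 + z3 - (j3 + k2 - l2 - z2) = l2 - l3 - k2 + k4 + z2 + z3 by ring,
    show j1 + k2 - l1 + z1 + (j3 + k4 - l3 + z3) + 1 =
      j3 + k2 - l1 - l3 + l4 + z1 + z3 + 1 by rw [hl]; ring]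
  have qe : qpow h (-(j1 + k2 - l1 + 1) * (k4 - k2 + l2 - l3) - (l2 - k2 - j3 - 1) * (j3 + k4 - l3)
      + Z [j1, j2, j3, j4] + Z [k1, k2, k3, k4]) =
      qpow h (Z [j1, j2, j3, j4] + Z [k1, k2, k3, k4]) *
        qpow h ((j3 + k2 - l2 - z2) * (j1 + k2 - l1 + z1) +
          (j3 + k2 - l2 - z2) * (j3 + k4 - l3 + z3) -
          (j1 + k2 - l1 + z1) * (j3 + k4 - l3 + z3) + (j3 + k2 - l2 - z2)) /
        qpow h (z3 * (l1 - l2 - j1 + j3) - z2 * (j3 + k2 - l1 - l3 + l4 + z3 + 1)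
          - z1 * (l2 - l3 - k2 + k4 + z2 + z3)) := by
    rw [← qpow_add, ← qpow_sub]
    congr 1
    rw [hl]; ring
  rw [qe]
  generalize qpow h ((j3 + k2 - l2 - z2) * (j1 + k2 - l1 + z1) + _ - _ + _) = q1
  have Q := qpow_ne_zero h (z3 * (l1 - l2 - j1 + j3) - z2 * (j3 + k2 - l1 - l3 + l4 + z3 + 1)
          - z1 * (l2 - l3 - k2 + k4 + z2 + z3))
  generalize qpow h (z3 * (l1 - l2 - j1 + j3) - z2 * (j3 + k2 - l1 - l3 + l4 + z3 + 1)
          - z1 * (l2 - l3 - k2 + k4 + z2 + z3)) = q2 at Q ⊢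
  refine eq_of_mul_eq_mul_one (u := (sgn (j2 - j3 + l2) * sgn (j2 - j3 + l2)) * (sgn z2 * sgn z2))
    (v := q2 / q2) (by rw [sgn_mul_self, sgn_mul_self, one_mul]) (div_self Q) ?_
  ring_nf

open Polynomial

/-! ### The second star sum -/

/-- The value of the second star sum. -/
noncomputable def starVal₂ (h : ℂ) (X A B : ℚ) : ℂ :=
  qpow h (X * B - X * A + B * A + B) * qfact h (X + A) * rfact h (B - X) * rfact h (B - A)

theorem starVal₂_comm (h : ℂ) (X A B : ℚ) : starVal₂ h X A B = starVal₂ h A X B := by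
  rw [starVal₂, starVal₂, add_comm X A,
    show X * B - X * A + B * A + B = A * B - A * X + B * X + B by ring]
  ring

/-- The same splitting of `λ_B - λ_A` as for the first star sum, with `X` as a spectator. -/
theorem starVal₂_rec {h : ℂ} (hq : Generic h) {X A B : ℚ} (h1 : IsNat (X + A)) (h2 : IsZ (B - A))
    (h3 : IsZ (B - X)) :
    (lam h B - lam h A) * starVal₂ h X A B = starVal₂ h X A (B - 1) + starVal₂ h X (A + 1) B := by
  rw [lam_sub_lam hq]
  simp only [starVal₂]
  rw [show X + (A + 1) = X + A + 1 by ring, qfact_add_one h1,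
    show B - 1 - X = B - X - 1 by ring, rfact_sub_one hq h3,
    show B - 1 - A = B - A - 1 by ring, rfact_sub_one hq h2,
    show B - (A + 1) = B - A - 1 by ring, rfact_sub_one hq h2,
    show X * (B - 1) - X * A + (B - 1) * A + (B - 1) =
      X * B - X * A + B * A + B + -(X + A + 1) by ring,
    show X * B - X * (A + 1) + B * (A + 1) + B = X * B - X * A + B * A + B + (B - X) by ring,
    qpow_add h _ (-(X + A + 1)), qpow_add h _ (B - X),
    show B + A + 1 = (B - X) - (-(X + A + 1)) by ring, qnum_sub hq (B - X), qnum_neg]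
  ring

/-- Where `gFun h A x` is non-zero, `x ≥ A ≥ -X`, so no factorial of a negative integer occurs even
if `X < 0`, and no functional is needed. The induction is on `B - A`, and raising `A` preserves `X ≤
A`. -/
theorem latSum_star₂_of_le {h : ℂ} (hq : Generic h) {s X A B : ℚ} (hs : IsSpin s) (hB : B ≤ s)
    (hsA : IsZ (s - A)) (hXA : IsNat (X + A)) (hle : X ≤ A) (h2 : IsZ (B - A)) :
    latSum s (fun x => wt h x * gFun h X x * gFun h A x * eFun h B x) = starVal₂ h X A B := by
  obtain ⟨S, eS⟩ := hs.two_mul_isNat.isZ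
  have hA : 0 ≤ A := by linarith [hXA.nonneg]
  obtain hlt | hle' := lt_or_ge B A
  · rw [starVal₂, rfact_of_neg h (show B - A < 0 by linarith)]
    have : ∀ x, wt h x * gFun h X x * gFun h A x * eFun h B x = 0 * (0 : ℂ) := fun x => by
      obtain hx | hx := lt_or_ge x A
      · rw [gFun_of_lt h hx]; ring
      · rw [eFun_of_lt h (hlt.trans_le hx)]; ring
    rw [funext this, latSum_const_mul]; ring
  obtain ⟨n, hn⟩ := h2.isNat (by linarith)
  induction n generalizing A B with
  | zero =>
    have hBA : B = A := by simp at hn; linarith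
    subst hBA
    obtain ⟨b, eb⟩ := hsA
    have e0 : IsNat (2 * B) := IsZ.isNat ⟨S - 2 * b, by push_cast; linarith⟩ (by linarith)
    rw [latSum_eq_single hA (IsZ.isNat ⟨b, eb⟩ (by linarith))]
    · rw [gFun, gFun, eFun, starVal₂, wt, sub_self, rfact_zero, show B + B = 2 * B by ring,
        rfact_of_nonneg h (show 0 ≤ 2 * B + 1 by linarith), qfact_add_one e0,
        show X * B - X * B + B * B + B = B * (B + 1) by ring, add_comm B X]
      have n1 := qfact_ne_zero hq (2 * B)
      have n2 : qnum h (2 * B + 1) ≠ 0 := by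
        have := qfact_ne_zero hq (2 * B + 1)
        rw [qfact_add_one e0] at this
        exact left_ne_zero_of_mul this
      refine eq_of_eq_mul_one (u := qfact h (2 * B) / qfact h (2 * B) *
        (qnum h (2 * B + 1) / qnum h (2 * B + 1))) ?_ (by rw [mul_inv]; ring)
      rw [div_self n1, div_self n2, one_mul]
    · intro y _ _ hy
      obtain hy | hy := lt_or_gt_of_ne hy
      · rw [gFun_of_lt h hy]; ring
      · rw [eFun_of_lt h hy]; ring
  | succ n ih =>
    push_cast at hn
    have hlt : A < B := by linarith [n.cast_nonneg (α := ℚ)]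
    obtain ⟨a, ea⟩ := id hsA
    obtain ⟨m, em⟩ := id hXA
    obtain ⟨b, eb⟩ := id h2
    have i1 := ih (A := A) (B := B - 1) (by linarith) hsA hXA hle
      ⟨n, by push_cast; linarith⟩ hA (by linarith [n.cast_nonneg (α := ℚ)]) (by linarith)
    have i2 := ih (A := A + 1) (B := B) hB ⟨a - 1, by push_cast; linarith⟩
      ⟨m + 1, by push_cast; linarith⟩ (by linarith) ⟨n, by push_cast; linarith⟩ (by linarith)
      (by linarith [n.cast_nonneg (α := ℚ)]) (by linarith)
    refine mul_left_cancel₀ (lam_sub_ne_zero hq h2 ⟨b + S - 2 * a, by push_cast; linarith⟩ hA hlt) ?_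
    rw [starVal₂_rec hq hXA h2 ⟨b + S - 2 * a - m, by push_cast; linarith⟩, ← i1, ← i2,
      ← latSum_const_mul, ← latSum_add]
    refine latSum_congr hs.nonneg fun x _ hx => ?_
    obtain ⟨k, ek⟩ := hx.isZ
    obtain hxA | hxA := lt_or_ge x A
    · rw [gFun_of_lt h hxA, gFun_of_lt h (show x < A + 1 by linarith)]; ring
    rw [gFun_add_one hq ⟨a - k, by push_cast; linarith⟩
        (IsZ.isNat ⟨S - k - a, by push_cast; linarith⟩ (by linarith)),
      eFun_sub_one hq ⟨b + k - a, by push_cast; linarith⟩ ⟨b + S - a - k, by push_cast; linarith⟩]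
    ring

/-- The star sum `∑ₓ [2x+1] q^{x(x+1)} [x+X]! [x+A]! / ([x-X]! [x-A]! [B-x]! [B+x+1]!)`. -/
theorem latSum_star₂ {h : ℂ} (hq : Generic h) {s X A B : ℚ} (hs : IsSpin s) (hB : B ≤ s)
    (hsA : IsZ (s - A)) (hXA : IsNat (X + A)) (h2 : IsZ (B - A)) :
    latSum s (fun x => wt h x * gFun h X x * gFun h A x * eFun h B x) = starVal₂ h X A B := by
  obtain hle | hle := le_total X A
  · exact latSum_star₂_of_le hq hs hB hsA hXA hle h2
  · obtain ⟨S, eS⟩ := hs.two_mul_isNat.isZ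
    obtain ⟨a, ea⟩ := hsA
    obtain ⟨m, em⟩ := id hXA
    obtain ⟨b, eb⟩ := h2
    rw [starVal₂_comm, ← latSum_star₂_of_le hq hs hB (X := A) (A := X)
      ⟨S - a - m, by push_cast; linarith⟩ (by rwa [add_comm]) hle
      ⟨b + S - 2 * a - m, by push_cast; linarith⟩]
    congr 1; funext x; ring

/-! ### A further form of the `6j` coefficient -/

/-- The coefficients of `lowSum`. -/
noncomputable def lowCoeff (h : ℂ) (j2 j3 l2 k2 k3 : ℚ) (z : ℕ) : ℂ :=
  sgn z * qfact h (j2 + j3 - l2 + z) * qfact h (2 * l2 - z) * rfact h z *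
    rfact h (l2 + k2 - k3 - z) * rfact h (j2 - j3 + l2 - z) * rfact h (l2 + k2 + k3 - z + 1)

/-- The sum that carries the dependence on `x` of `{j₃ k₃ x; k₂ j₂ l₂}`. -/
noncomputable def lowSum (h : ℂ) (j2 j3 l2 k2 k3 x : ℚ) : ℂ :=
  ∑ z ∈ Finset.range (⌊j2 - j3 + l2⌋₊ + 1),
    lowCoeff h j2 j3 l2 k2 k3 z * gFun h (k2 - j3 + l2 - z) x

theorem lowSum_eq_bal {h : ℂ} (hq : Generic h) {j2 j3 l2 k2 k3 x : ℚ} (h2 : Triangle l2 j2 j3)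
    (h6 : Triangle l2 k2 k3) (x1 : IsNat (x + k2 - j2)) (x2 : IsNat (x - k2 + j2)) {n : ℕ}
    (hn : j2 - j3 + l2 = n) :
    lowSum h j2 j3 l2 k2 k3 x = qfact h (j2 + j3 - l2) * qfact h (2 * l2 - n) *
      rfact h (l2 + k2 - k3) * rfact h (l2 + k2 + k3 + 1) * qfact h (x + k2 - j2) *
      rfact h (x - k2 + j2) * bal h n (j3 + j2 - l2 + 1) (k3 - k2 - l2) (-k3 - k2 - l2 - 1)
        (-(2 * l2)) (j3 - k2 - x - l2) (j3 - k2 + x - l2 + 1) := by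
  rw [lowSum, hn, Nat.floor_natCast, bal, Finset.mul_sum]
  refine Finset.sum_congr rfl fun k hk => ?_
  have hk := Nat.lt_succ_iff.1 (Finset.mem_range.1 hk)
  have m1 : IsNat (j2 + j3 - l2) := h2.isNat₁
  have m2 : IsNat (2 * l2 - n) := by
    have := h2.isNat₂; rwa [show l2 - j2 + j3 = 2 * l2 - n by linarith] at this
  have m3 : IsNat (l2 + k2 - k3) := h6.isNat₃
  have m4 : IsZ (l2 + k2 + k3 + 1) := h6.isZ.add isZ_one
  have x1' : IsNat (x + (k2 - j3 + l2) - n) := by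
    rwa [show x + (k2 - j3 + l2) - n = x + k2 - j2 by linarith]
  have x2' : IsNat (x - (k2 - j3 + l2) + n) := by
    rwa [show x - (k2 - j3 + l2) + n = x - k2 + j2 by linarith]
  rw [lowCoeff, hn, sgn_natCast, gFun, qfact_add_nat m1, qfact_sub_nat m2 hk,
    rfact_sub_nat hq m3.isZ, show l2 + k2 + k3 - k + 1 = l2 + k2 + k3 + 1 - k by ring,
    rfact_sub_nat hq m4, show x + (k2 - j3 + l2 - k) = x + (k2 - j3 + l2) - k by ring,
    qfact_sub_nat x1' hk, show x - (k2 - j3 + l2 - k) = x - (k2 - j3 + l2) + k by ring,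
    rfact_add_nat hq x2' hk, show x + (k2 - j3 + l2) - n = x + k2 - j2 by linarith,
    show x - (k2 - j3 + l2) + n = x - k2 + j2 by linarith,
    show j2 + j3 - l2 + 1 = j3 + j2 - l2 + 1 by ring,
    show -(l2 + k2 - k3) = k3 - k2 - l2 by ring,
    show -(l2 + k2 + k3 + 1) = -k3 - k2 - l2 - 1 by ring,
    show -(x + (k2 - j3 + l2)) + k = j3 - k2 - x - l2 + k by ring,
    show x - (k2 - j3 + l2) + 1 + k = j3 - k2 + x - l2 + 1 + k by ring]
  have r := rfact_nat_mul (h := h) hk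
  obtain ⟨m, rfl⟩ := Nat.exists_eq_add_of_le hk
  rw [Nat.add_sub_cancel_left] at r ⊢
  have s1 : ((-1 : ℂ) ^ m * (-1) ^ m) = 1 := by rw [← mul_pow]; simp
  have s2 : ((-1 : ℂ) ^ k * (-1) ^ k) = 1 := by rw [← mul_pow]; simp
  rw [div_eq_mul_inv, ← r]
  refine eq_of_eq_mul_one (u := ((-1 : ℂ) ^ m * (-1) ^ m) * ((-1) ^ k * (-1) ^ k)) ?_ (by ring)
  rw [s1, s2, one_mul]

theorem bal_rotate' (h : ℂ) (n : ℕ) (a b c d e f : ℚ) :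
    bal h n a b c d e f = bal h n b c a d e f :=
  Finset.sum_congr rfl fun _ _ => by ring

theorem bal_shuffle (h : ℂ) (n : ℕ) (a b c d e f : ℚ) :
    bal h n a b c d e f = bal h n b c a d f e :=
  Finset.sum_congr rfl fun _ _ => by ring

/-- One Sears transformation away from `lowSum`, the left-hand form shows the bound `x ≤ j₃ + k₃`
through zeros of its shifted factorials. It is also the halfway point between Racah's sum and
`lowSum`. -/
theorem bal_low {h : ℂ} (hq : Generic h) {j2 j3 l2 k2 k3 : ℚ} (x : ℚ) {n : ℕ}
    (hn : j2 - j3 + l2 = n) :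
    bal h n (-j3 - j2 - l2 - 1) (-k3 - k2 - l2 - 1) (-(k3 + l2 - k2)) (-k3 - j2 - x - l2 - 1)
        (x - k3 - j2 - l2) (-(2 * l2)) =
      bal h n (j3 + j2 - l2 + 1) (k3 - k2 - l2) (-k3 - k2 - l2 - 1) (-(2 * l2))
        (j3 - k2 - x - l2) (j3 - k2 + x - l2 + 1) := by
  rw [bal_swap, bal_rotate, bal_sears hq n (by linarith), bal_shuffle, ← hn]
  congr 1 <;> ring

/-- In the form of `bal_low` every term vanishes. For `k > k₃ + l₂ - k₂` the third numerator has a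
zero factor. For smaller `k` the zero sits in the denominator parameter `x - k₃ - j₂ - l₂`, whose
shifted factorial stands as a multiplier in `bal`. -/
theorem lowSum_eq_zero {h : ℂ} (hq : Generic h) {j2 j3 l2 k2 k3 x : ℚ} (h2 : Triangle l2 j2 j3)
    (h6 : Triangle l2 k2 k3) (x1 : IsNat (x + k2 - j2)) (x2 : IsNat (x - k2 + j2))
    (x3 : j3 + k3 < x) (x4 : x ≤ j2 + k2) (xz : IsZ (j2 + k2 - x)) :
    lowSum h j2 j3 l2 k2 k3 x = 0 := by
  obtain ⟨n, hn⟩ : IsNat (j2 - j3 + l2) := by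
    have := h2.isNat₃; rwa [show l2 + j2 - j3 = j2 - j3 + l2 by ring] at this
  rw [lowSum_eq_bal hq h2 h6 x1 x2 hn, ← bal_low hq x hn]
  have b0 : bal h n (-j3 - j2 - l2 - 1) (-k3 - k2 - l2 - 1) (-(k3 + l2 - k2))
      (-k3 - j2 - x - l2 - 1) (x - k3 - j2 - l2) (-(2 * l2)) = 0 := by
    refine Finset.sum_eq_zero fun k hk => ?_
    have hk := Nat.lt_succ_iff.1 (Finset.mem_range.1 hk)
    obtain ⟨t, ht⟩ : IsNat (k3 + l2 - k2) := by
      have := h6.isNat₂; rwa [show l2 - k2 + k3 = k3 + l2 - k2 by ring] at this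
    obtain hkt | hkt := lt_or_ge t k
    · rw [poch_eq_zero (a := -(k3 + l2 - k2)) t hkt (by linarith)]
      ring
    · have hkt' : (k : ℚ) ≤ t := by exact_mod_cast hkt
      obtain ⟨y, hy⟩ : IsNat (j2 + k2 - x + (k3 + l2 - k2) - k) :=
        IsZ.isNat ((xz.add ⟨t, by simpa using ht⟩).sub (isZ_natCast k)) (by linarith)
      have hyn : y < n - k := by
        have : (y : ℚ) < ((n - k : ℕ) : ℚ) := by rw [Nat.cast_sub hk]; linarith
        exact_mod_cast this
      rw [poch_eq_zero (a := x - k3 - j2 - l2 + k) y hyn (by linarith)]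
      ring
  rw [b0, mul_zero]

/-- Two successive Sears transformations lead from Racah's sum to this one. The form is chosen
because it has `∇[j₃ k₃ x]` in the numerator and `∇[k₂ j₂ x]` in the denominator, as the
cancellation around the cycle requires. -/
theorem sixJ_eq_lowSum {h : ℂ} (hq : Generic h) {j2 j3 l2 k2 k3 x : ℚ}
    (H : Tetra j3 k3 x k2 j2 l2) :
    sixJ h j3 k3 x k2 j2 l2 = sgn (j2 + x + l2 + k3) * sgn (j2 - j3 + l2) *
      (nabla h j3 k3 x * nabla h k2 k3 l2 / (nabla h k2 j2 x * nabla h j3 j2 l2)) *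
      lowSum h j2 j3 l2 k2 k3 x := by
  have H' : Tetra j2 x k2 k3 l2 j3 :=
    tetra_flip₁₃.1 (tetra_columns₂₃.1 (tetra_columns₁₂.1 H))
  obtain ⟨n, hn⟩ := H'.2.1.isNat₃
  have hn' : j2 - j3 + l2 = n := by linarith
  obtain ⟨h1, h2, h3, h4⟩ := id H
  have e1 : racahJ h j3 k3 x k2 j2 l2 = racahJ h j2 x k2 k3 l2 j3 := by
    rw [racahJ_columns₁₂, racahJ_columns₂₃, racahJ_columns₂₃, racahJ_flip, racahJ_columns₂₃]
  have hz : IsZ (j2 + x + l2 + k3) := by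
    obtain ⟨t₁, t₂, t₃, t₄, q₁, q₂, q₃, -, -, -, -, -, -, e7⟩ := H.exists_nat
    exact ⟨q₃, by push_cast; linarith⟩
  have p1 := h1.isNat₁.nonneg
  have p2 := h3.isNat₁.nonneg
  have p3 := h3.isNat₃.nonneg
  have p4 := h4.isNat₁.nonneg
  have p5 := h4.isNat₂.nonneg
  have p6 := h3.isNat₂.nonneg
  have p7 := h3.isNat.nonneg
  have p8 := h4.isNat₃.nonneg
  have hb : bal h n (-(x + k3 - j3)) (-(l2 + k3 - k2)) (-(j2 + x - k2)) (k2 + j3 - x - l2 + 1)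
      (k2 + j3 - j2 - k3 + 1) (-(j2 + x + l2 + k3) - 1) = bal h n (j3 + j2 - l2 + 1)
        (k3 - k2 - l2) (-k3 - k2 - l2 - 1) (-(2 * l2)) (j3 - k2 - x - l2)
        (j3 - k2 + x - l2 + 1) := by
    rw [← bal_low hq x hn', bal_swap, bal_rotate, bal_sears hq n (by linarith), bal_rotate', ← hn]
    congr 1 <;> ring
  rw [H.sixJ_eq_racahJ hq, e1, racahJ_eq_bal hq H' hn, hb, lowSum_eq_bal hq h2.rot.rot.swap'
    h3.rot.rot.swap'.swap'
    (by have := h4.isNat₂; rwa [show k2 - j2 + x = x + k2 - j2 by ring] at this)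
    (by have := h4.isNat₁; rwa [show j2 + x - k2 = x - k2 + j2 by ring] at this) hn']
  have t1 : tri h j3 j2 l2 = qfact h (j3 + j2 - l2) * qfact h (j3 - j2 + l2) / nabla h j3 j2 l2 :=
    eq_div_of_mul_eq (nabla_ne_zero hq _ _ _) (by rw [mul_comm, nabla_mul_tri hq])
  have t4 : tri h k2 j2 x = qfact h (k2 + j2 - x) * qfact h (k2 - j2 + x) / nabla h k2 j2 x :=
    eq_div_of_mul_eq (nabla_ne_zero hq _ _ _) (by rw [mul_comm, nabla_mul_tri hq])
  have t2 : tri h j3 k3 x = nabla h j3 k3 x * qfact h (k3 + x - j3) / qfact h (j3 + k3 + x + 1) := by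
    rw [nabla_eq_tri hq]
    field_simp [qfact_ne_zero hq (k3 + x - j3), qfact_ne_zero hq (j3 + k3 + x + 1)]
  have t3 : tri h k2 k3 l2 =
      nabla h k2 k3 l2 * qfact h (k3 + l2 - k2) / qfact h (k2 + k3 + l2 + 1) := by
    rw [nabla_eq_tri hq]
    field_simp [qfact_ne_zero hq (k3 + l2 - k2), qfact_ne_zero hq (k2 + k3 + l2 + 1)]
  rw [t1, t2, t3, t4, rfact_of_nonneg h (show 0 ≤ x + k3 - j3 by linarith),
    rfact_of_nonneg h (show 0 ≤ l2 + k3 - k2 by linarith),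
    rfact_of_nonneg h (show 0 ≤ j2 + x - k2 by linarith),
    rfact_of_nonneg h (show 0 ≤ j2 + k2 - x by linarith),
    rfact_of_nonneg h (show 0 ≤ l2 + k2 - k3 by linarith),
    rfact_of_nonneg h (show 0 ≤ l2 + k2 + k3 + 1 by linarith),
    rfact_of_nonneg h (show 0 ≤ x - k2 + j2 by linarith), hn', sgn_add hz (isZ_natCast n),
    show x + k3 - j3 = k3 + x - j3 by ring, show l2 + k3 - k2 = k3 + l2 - k2 by ring,
    show k3 + x + j3 + 1 = j3 + k3 + x + 1 by ring, show x - k2 + j2 = j2 + x - k2 by ring,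
    show k2 + k3 + l2 + 1 = l2 + k2 + k3 + 1 by ring, show 2 * l2 - n = j3 - j2 + l2 by linarith,
    show x + k2 - j2 = k2 - j2 + x by ring, show k2 + j2 - x = j2 + k2 - x by ring,
    show j3 + j2 - l2 = j2 + j3 - l2 by ring]
  have Q := qfact_ne_zero hq
  refine eq_of_eq_mul_one (u := qfact h (k3 + x - j3) / qfact h (k3 + x - j3) *
    (qfact h (j3 + k3 + x + 1) / qfact h (j3 + k3 + x + 1)) *
    (qfact h (j2 + k2 - x) / qfact h (j2 + k2 - x)) *
    (qfact h (k3 + l2 - k2) / qfact h (k3 + l2 - k2))) ?_ (by ring)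
  rw [div_self (Q _), div_self (Q _), div_self (Q _), div_self (Q _)]
  norm_num

/-! ### The triple sum for `k₄ = l₄ + j₁`. -/

open Polynomial

theorem triple_sum {α β γ : Type*} (r : Finset α) (s : Finset β) (t : Finset γ) (w : ℂ)
    (f e : α → ℂ) (g u : β → ℂ) (k v : γ → ℂ) :
    w * (∑ a ∈ r, f a * e a) * (∑ b ∈ s, g b * u b) * ∑ c ∈ t, k c * v c =
      ∑ a ∈ r, ∑ b ∈ s, ∑ c ∈ t, f a * g b * k c * (w * u b * v c * e a) := by
  rw [Finset.mul_sum r, Finset.sum_mul_sum, Finset.sum_mul]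
  refine Finset.sum_congr rfl fun a _ => ?_
  rw [Finset.sum_mul]
  refine Finset.sum_congr rfl fun b _ => ?_
  rw [Finset.mul_sum]
  exact Finset.sum_congr rfl fun c _ => by ring

/-- The factor in front of the triple sum of the stretched case `k₄ = l₄ + j₁`. -/
noncomputable def preFactor₂ (h : ℂ) (j1 j2 j3 j4 l1 l2 l3 l4 k1 k2 k3 k4 : ℚ) : ℂ :=
  sgn (j3 + j4 - l3 + l2 + k2 - k3) *
    (nabla h j3 j4 l3 * nabla h k4 k3 l3 * nabla h k2 k3 l2 /
      (nabla h j1 j2 l1 * nabla h k2 k1 l1 * nabla h j3 j2 l2 * nabla h l4 k1 j4)) *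
    (sfact h (2 * j1) * sfact h (2 * l4) / sfact h (2 * k4 + 1)) *
    qpow h (Z [j1, j2, j3, j4] + Z [k1, k2, k3, k4])

theorem twTerm_stretched_k4 {h : ℂ} (hq : Generic h) {j1 j2 j3 j4 l1 l2 l3 l4 k1 k2 k3 k4 x : ℚ}
    (hadm : Admissible j1 j2 j3 j4 l1 l2 l3 l4 k1 k2 k3 k4) (hk : k4 = l4 + j1)
    (T1 : Tetra j1 j2 l1 k2 k1 x) (T2 : Tetra j3 k3 x k2 j2 l2) (T3 : Tetra j3 j4 l3 k4 k3 x)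
    (T4 : Tetra k1 j1 x k4 j4 l4) :
    twTerm h j1 j2 j3 j4 l1 l2 l3 l4 k1 k2 k3 k4 x =
      preFactor₂ h j1 j2 j3 j4 l1 l2 l3 l4 k1 k2 k3 k4 *
      (wt h x * ((sixPoly h j1 j2 l1 k2 k1).eval (lam h x) * eFun h (j2 + k2) x) *
        lowSum h j2 j3 l2 k2 k3 x *
        ∑ z ∈ Finset.range (⌊j4 + j3 - l3⌋₊ + 1),
          midCoeff h j4 j3 l3 k4 k3 z * gFun h (j3 + k4 - l3 - z) x) := by
  obtain ⟨m1, m2, m3, m4, m5, m6, m7, m8, J1, J2, J3, J4, K1, K2, K3, K4, L1, L2, L3, L4,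
    ⟨e1, e2, e3, e4, e5, e6, e7, e8⟩, ⟨f1, f2, f3, f4⟩, ⟨g1, g2, g3, g4⟩, i1, i2, i3, i4⟩ :=
    hadm.exists_int
  obtain ⟨h1, h2, h3, h4, h5, h6, h7, h8⟩ := hadm
  obtain ⟨m9, e9⟩ : IsZ (j2 + k2 - x) := by
    have := T1.2.2.1.isNat₃.isZ; rwa [add_comm k2 j2] at this
  have hz : IsZ (j3 + k3 + j4 + k4) := ⟨(-1) * m3 + m7 + J3 + J4, by push_cast; linarith⟩
  have sg : sgn (j1 + j2 + j3 + j4 + l1 + l2 + l3 + l4 + k1 + k2 + k3 + k4 - x) = sgn (j3 + j4 - l3 + l2 + k2 - k3) * sgn (j2 + k1 + l1 + x) * sgn (j2 + x + l2 + k3) * sgn (j2 - j3 + l2) * sgn (j3 + k3 + j4 + k4) * sgn (l4 + j4 + j1 + x) := by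
    rw [sgn_eq_cis (x := j1 + j2 + j3 + j4 + l1 + l2 + l3 + l4 + k1 + k2 + k3 + k4 - x) ⟨(2) * m2 + (-1) * m3 + m5 + (-1) * m6 + (2) * m7 + (-1) * J2 + J4 + m9, by push_cast; linarith⟩,
      sgn_eq_cis (x := j3 + j4 - l3 + l2 + k2 - k3) ⟨m3 + m4 + m6 + (-2) * m7, by push_cast; linarith⟩,
      sgn_eq_cis (x := j2 + k1 + l1 + x) ⟨m5 + J2 + (-1) * m9, by push_cast; linarith⟩,
      sgn_eq_cis (x := j2 + x + l2 + k3) ⟨m6 + J2 + (-1) * m9, by push_cast; linarith⟩,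
      sgn_eq_cis (x := j2 - j3 + l2) ⟨m2 + (-1) * J3, by push_cast; linarith⟩,
      sgn_eq_cis (x := j3 + k3 + j4 + k4) ⟨(-1) * m3 + m7 + J3 + J4, by push_cast; linarith⟩,
      sgn_eq_cis (x := l4 + j4 + j1 + x) ⟨(-1) * m2 + m3 + m4 + m6 + (-1) * m7 + J2 + (-1) * m9, by push_cast; linarith⟩,
      ← cis_add, ← cis_add, ← cis_add, ← cis_add, ← cis_add]
    exact cis_eq (m2 + (-1) * m3 + (-1) * m4 + (-2) * m6 + (2) * m7 + (-2) * J2 + (2) * m9) (by push_cast; linarith)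
  rw [twTerm, sixJ_eq_sixPoly hq T1, sixJ_eq_lowSum hq T2, sixJ_flip₂₃ hq j3 j4,
    (tetra_flip₂₃.1 T3).sixJ, sixJ_stretched_d_fb hq T4 hk, sixSum_eq_midCoeff hz, preFactor₂, wt,
    show x * (x + 1) + Z [j1, j2, j3, j4] + Z [k1, k2, k3, k4] =
      x * (x + 1) + (Z [j1, j2, j3, j4] + Z [k1, k2, k3, k4]) by ring, qpow_add h (x * (x + 1)),
    sg, nabla_swap' h l4 k1 j4, nabla_swap' h k4 x j4, nabla_swap' h j1 x k1]
  generalize ∑ z ∈ Finset.range (⌊j4 + j3 - l3⌋₊ + 1),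
    midCoeff h j4 j3 l3 k4 k3 z * gFun h (j3 + k4 - l3 - z) x = σ
  have N := nabla_ne_zero hq
  refine eq_of_eq_mul_one (u := (nabla h j1 k1 x / nabla h j1 k1 x) *
    (nabla h k2 j2 x / nabla h k2 j2 x) * (nabla h j3 k3 x / nabla h j3 k3 x) *
    (nabla h k4 j4 x / nabla h k4 j4 x) * (sgn (j2 + k1 + l1 + x) * sgn (j2 + k1 + l1 + x)) *
    (sgn (j2 + x + l2 + k3) * sgn (j2 + x + l2 + k3)) *
    (sgn (j2 - j3 + l2) * sgn (j2 - j3 + l2)) *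
    (sgn (j3 + k3 + j4 + k4) * sgn (j3 + k3 + j4 + k4)) *
    (sgn (l4 + j4 + j1 + x) * sgn (l4 + j4 + j1 + x))) ?_
    (by simp only [div_eq_mul_inv, mul_inv]; ring)
  rw [div_self (N _ _ _), div_self (N _ _ _), div_self (N _ _ _), div_self (N _ _ _), sgn_mul_self,
    sgn_mul_self, sgn_mul_self, sgn_mul_self, sgn_mul_self]
  norm_num

/-- Here the summation may be extended to the whole lattice below `j₂ + k₂` at no cost: at every
non-admissible `x` one of the three `x`-dependent factors vanishes. -/
theorem twelveJ_eq_latSum {h : ℂ} (hq : Generic h) {j1 j2 j3 j4 l1 l2 l3 l4 k1 k2 k3 k4 : ℚ}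
    (hadm : Admissible j1 j2 j3 j4 l1 l2 l3 l4 k1 k2 k3 k4) (hk : k4 = l4 + j1) :
    twelveJ h j1 j2 j3 j4 l1 l2 l3 l4 k1 k2 k3 k4 =
      preFactor₂ h j1 j2 j3 j4 l1 l2 l3 l4 k1 k2 k3 k4 * latSum (j2 + k2) fun x =>
        wt h x * ((sixPoly h j1 j2 l1 k2 k1).eval (lam h x) * eFun h (j2 + k2) x) *
        lowSum h j2 j3 l2 k2 k3 x *
        ∑ z ∈ Finset.range (⌊j4 + j3 - l3⌋₊ + 1),
          midCoeff h j4 j3 l3 k4 k3 z * gFun h (j3 + k4 - l3 - z) x := by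
  obtain ⟨m1, m2, m3, m4, m5, m6, m7, m8, J1, J2, J3, J4, K1, K2, K3, K4, L1, L2, L3, L4,
    ⟨e1, e2, e3, e4, e5, e6, e7, e8⟩, ⟨f1, f2, f3, f4⟩, ⟨g1, g2, g3, g4⟩, i1, i2, i3, i4⟩ :=
    hadm.exists_int
  obtain ⟨h1, h2, h3, h4, h5, h6, h7, h8⟩ := hadm
  obtain ⟨u1, v1, w1⟩ := h1.le
  obtain ⟨u2, v2, w2⟩ := h2.le
  obtain ⟨u3, v3, w3⟩ := h3.le
  obtain ⟨u4, v4, w4⟩ := h4.le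
  obtain ⟨u5, v5, w5⟩ := h5.le
  obtain ⟨u6, v6, w6⟩ := h6.le
  obtain ⟨u7, v7, w7⟩ := h7.le
  obtain ⟨u8, v8, w8⟩ := h8.le
  have hs : IsSpin (j2 + k2) := h1.2.2.1.add h5.2.2.1
  have vP : VanishesBetween h (j1 - k1) (j2 - k2) (sixPoly h j1 j2 l1 k2 k1) :=
    fun n hn => nodePoly_dvd_sixPoly hq h1.rot h5.rev hn
  rw [← latSum_const_mul, twelveJ_eq_spinSum, spinSum_eq_latSum hs]
  · refine latSum_congr hs.nonneg fun x hx hsx => ?_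
    obtain ⟨m9, e9⟩ := hsx.isZ
    have hx2 := hsx.nonneg
    have sx : IsSpin x := .of_isZ ⟨(-2) * m2 + (2) * m3 + m4 + (2) * m6 + (-2) * m7 + (2) * J2 + (-1) * J4 + (-2) * m9, by push_cast; linarith⟩ hx
    by_cases hT : Tetra j1 j2 l1 k2 k1 x ∧ Tetra j3 k3 x k2 j2 l2 ∧ Tetra j3 j4 l3 k4 k3 x ∧
        Tetra k1 j1 x k4 j4 l4
    · exact twTerm_stretched_k4 hq ⟨h1, h2, h3, h4, h5, h6, h7, h8⟩ hk hT.1 hT.2.1 hT.2.2.1 hT.2.2.2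
    have t0 : twTerm h j1 j2 j3 j4 l1 l2 l3 l4 k1 k2 k3 k4 x = 0 := by
      by_contra H
      exact hT (twTerm_tetra H)
    rw [t0]
    by_contra H
    have H := right_ne_zero_of_mul (Ne.symm H)
    have H3 := right_ne_zero_of_mul H
    have H2 := right_ne_zero_of_mul (left_ne_zero_of_mul H)
    have H1 := right_ne_zero_of_mul (left_ne_zero_of_mul (left_ne_zero_of_mul H))
    have HP := left_ne_zero_of_mul H1
    obtain ⟨z2, -, hz2⟩ := Finset.exists_ne_zero_of_sum_ne_zero H2
    obtain ⟨z3, -, hz3⟩ := Finset.exists_ne_zero_of_sum_ne_zero H3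
    -- A non-zero term of each expansion bounds `x` from below: `c1`, `c2`, `c5` give `k₃ - j₃ ≤ x`
    -- and `k₂ - j₂ ≤ x`, while `c3`, `c4`, `c6` give `k₄ - j₄ ≤ x` and `j₃ - k₃ ≤ x`.
    have c1 : 0 ≤ l2 + k2 - k3 - z2 := by
      by_contra hc
      exact hz2 (by rw [lowCoeff, rfact_of_neg h (not_le.1 hc)]; ring)
    have c2 : 0 ≤ j2 - j3 + l2 - z2 := by
      by_contra hc
      exact hz2 (by rw [lowCoeff, rfact_of_neg h (not_le.1 hc)]; ring)
    have c3 : 0 ≤ j4 + j3 - l3 - z3 := by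
      by_contra hc
      exact hz3 (by rw [midCoeff, rfact_of_neg h (not_le.1 hc)]; ring)
    have c4 : 0 ≤ k4 + k3 - l3 - z3 := by
      by_contra hc
      exact hz3 (by rw [midCoeff, rfact_of_neg h (not_le.1 hc)]; ring)
    have c5 : k2 - j3 + l2 - z2 ≤ x := by
      by_contra hc
      exact hz2 (by rw [gFun_of_lt h (not_le.1 hc), mul_zero])
    have c6 : j3 + k4 - l3 - z3 ≤ x := by
      by_contra hc
      exact hz3 (by rw [gFun_of_lt h (not_le.1 hc), mul_zero])
    -- The remaining lower bounds come from the zeros of `sixPoly` and from `k₄ = l₄ + j₁` with the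
    -- triangle `(l₄, k₁, j₄)`.
    have d1 : k1 - j1 ≤ x := by
      by_contra hc
      exact HP (vP.eval_eq_zero' ⟨m2 + (-1) * m3 + (-1) * m4 + (-1) * m6 + m7 + m8, by push_cast; linarith⟩ ⟨J2 + (-1) * m9, by push_cast; linarith⟩ (by linarith)
        (by linarith))
    have d2 : j2 - k2 ≤ x := by
      by_contra hc
      exact HP (vP.eval_eq_zero ⟨m2 + (-1) * m3 + (-1) * m4 + (-1) * m6 + m7 + m8, by push_cast; linarith⟩ ⟨(-1) * m1 + m5 + J2 + (-1) * m9, by push_cast; linarith⟩ (by linarith)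
        (by linarith))
    have u1' : x ≤ j1 + k1 := by
      by_contra hc
      exact H1 (sixPoly_eval_mul_eFun_eq_zero hq (IsZ.isNat ⟨m1 + (-1) * J1, by push_cast; linarith⟩ (by linarith))
        ⟨m9, by linarith⟩ ⟨(-2) * m2 + (2) * m3 + m4 + (2) * m6 + (-2) * m7 + (2) * J2 + (-1) * J4 + (-1) * m9, by push_cast; linarith⟩ (not_le.1 hc))
    have u3' : x ≤ j3 + k3 := by
      by_contra hc
      exact H2 (lowSum_eq_zero hq h2 h6 (IsZ.isNat ⟨(-2) * m2 + (2) * m3 + m4 + (2) * m6 + (-2) * m7 + J2 + (-1) * J4 + (-1) * m9, by push_cast; linarith⟩ (by linarith))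
        (IsZ.isNat ⟨J2 + (-1) * m9, by push_cast; linarith⟩ (by linarith)) (not_le.1 hc) (by linarith)
        ⟨m9, by linarith⟩)
    have tx1 : Triangle j1 k1 x := .mk' h1.2.1 h5.2.1 sx ⟨(-1) * m1 + m5 + J1 + J2 + (-1) * m9, by push_cast; linarith⟩
      (by linarith) (by linarith) u1'
    have tx2 : Triangle j2 k2 x := .mk' h1.2.2.1 h5.2.2.1 sx ⟨(-2) * m2 + (2) * m3 + m4 + (2) * m6 + (-2) * m7 + (2) * J2 + (-1) * J4 + (-1) * m9, by push_cast; linarith⟩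
      (by linarith) (by linarith) (by linarith)
    have tx3 : Triangle j3 k3 x := .mk' h3.2.1 h7.2.1 sx ⟨(-1) * m2 + m6 + J2 + J3 + (-1) * m9, by push_cast; linarith⟩
      (by linarith) (by linarith) u3'
    have tx4 : Triangle j4 k4 x := .mk' h3.2.2.1 h7.2.2.1 sx ⟨(-1) * m2 + m3 + m4 + m6 + (-1) * m7 + J2 + (-1) * m9, by push_cast; linarith⟩
      (by linarith) (by linarith) (by linarith)
    exact hT ⟨⟨h1.rot, tx1, tx2.swap, h5.rev⟩, ⟨tx3, h2.rev, h6.rot, tx2.swap⟩,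
      ⟨h3.rot, tx3, tx4.swap, h7.rev⟩, ⟨tx1.swap, h8.rot, h4.rev, tx4.swap⟩⟩
  · intro x hx
    by_contra H
    linarith [(twTerm_tetra H).1.2.1.le₃]
  · intro x _ H
    have T := (twTerm_tetra H).1.2.2.1
    have := T.isNat₃
    rwa [add_comm k2 j2] at this

theorem twelveJ_stretched_k4 {h : ℂ} (hq : Generic h)
    {j1 j2 j3 j4 l1 l2 l3 l4 k1 k2 k3 k4 : ℚ}
    (hadm : Admissible j1 j2 j3 j4 l1 l2 l3 l4 k1 k2 k3 k4) (hk : k4 = l4 + j1) :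
      twelveJ h j1 j2 j3 j4 l1 l2 l3 l4 k1 k2 k3 k4 =
        sgn (j3 + j4 - l3 + l2 + k2 - k3) *
        (nabla h j3 j4 l3 * nabla h k4 k3 l3 * nabla h k2 k3 l2 /
          (nabla h j1 j2 l1 * nabla h k2 k1 l1 * nabla h j3 j2 l2 * nabla h l4 k1 j4)) *
        (sfact h (2 * j1) * sfact h (2 * l4) / sfact h (2 * k4 + 1)) *
        qpow h ((j1 + k2 - l1 + 1) * (k2 + k4 + l2 - l3 + 1) - (l2 + k2 - j3 + 1) * (j3 - l3 + k4 + 1)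
          + Z [j1, j2, j3, j4] + Z [k1, k2, k3, k4]) *
        ∑ z1 ∈ Finset.range (⌊l1 - j1 + j2⌋₊ + 1),
        ∑ z2 ∈ Finset.range (⌊j2 - j3 + l2⌋₊ + 1),
        ∑ z3 ∈ Finset.range (⌊j3 + j4 - l3⌋₊ + 1),
          qfact h (j1 + j2 - l1 + z1) * qfact h (k1 + k2 - l1 + z1) * qfact h (2 * l1 - z1) *
          rfact h z1 * rfact h z2 * rfact h z3 *
          rfact h (k1 - k2 + l1 - z1) * rfact h (l1 - j1 + j2 - z1) *
          sgn (z1 + z2 + z3) * qfact h (j2 + j3 - l2 + z2) * qfact h (2 * l2 - z2) *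
          rfact h (l2 + k2 - k3 - z2) * rfact h (j2 - j3 + l2 - z2) *
          rfact h (l2 + k2 + k3 - z2 + 1) *
          qpow h (z1 * (k2 + k4 + l2 - l3 - z2 - z3 + 1)) *
          qfact h (k3 - k4 + l3 + z3) * qfact h (j4 - j3 + l3 + z3) *
          rfact h (k3 + k4 - l3 - z3) * rfact h (j3 + j4 - l3 - z3) * rfact h (2 * l3 + z3 + 1) *
          qpow h (-z2 * (k2 - j3 - l1 + l3 - l4 + z3) - z3 * (j1 + j3 - l1 - l2)) *
          qfact h (k2 + k4 + l2 - l3 - z2 - z3) *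
          rfact h (j1 + j3 - l1 - l2 + z1 + z2) *
          rfact h (k2 - j3 - l1 + l3 - l4 + z1 + z3) := by
  obtain ⟨m1, m2, m3, m4, m5, m6, m7, m8, J1, J2, J3, J4, K1, K2, K3, K4, L1, L2, L3, L4,
    ⟨e1, e2, e3, e4, e5, e6, e7, e8⟩, ⟨f1, f2, f3, f4⟩, ⟨g1, g2, g3, g4⟩, i1, i2, i3, i4⟩ :=
    hadm.exists_int
  rw [twelveJ_eq_latSum hq hadm hk]
  obtain ⟨h1, h2, h3, h4, h5, h6, h7, h8⟩ := hadm
  obtain ⟨u1, v1, w1⟩ := h1.le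
  obtain ⟨u2, v2, w2⟩ := h2.le
  obtain ⟨u3, v3, w3⟩ := h3.le
  obtain ⟨u4, v4, w4⟩ := h4.le
  obtain ⟨u5, v5, w5⟩ := h5.le
  obtain ⟨u6, v6, w6⟩ := h6.le
  obtain ⟨u7, v7, w7⟩ := h7.le
  obtain ⟨u8, v8, w8⟩ := h8.le
  have hs : IsSpin (j2 + k2) := h1.2.2.1.add h5.2.2.1
  have expand : (latSum (j2 + k2) fun x =>
        wt h x * ((sixPoly h j1 j2 l1 k2 k1).eval (lam h x) * eFun h (j2 + k2) x) *
        lowSum h j2 j3 l2 k2 k3 x *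
        ∑ z ∈ Finset.range (⌊j4 + j3 - l3⌋₊ + 1),
          midCoeff h j4 j3 l3 k4 k3 z * gFun h (j3 + k4 - l3 - z) x) =
      ∑ z1 ∈ Finset.range (⌊l1 - j1 + j2⌋₊ + 1),
        ∑ z2 ∈ Finset.range (⌊j2 - j3 + l2⌋₊ + 1),
        ∑ z3 ∈ Finset.range (⌊j3 + j4 - l3⌋₊ + 1),
          sixCoeff h j1 j2 l1 k2 k1 z1 * lowCoeff h j2 j3 l2 k2 k3 z2 *
            midCoeff h j4 j3 l3 k4 k3 z3 * latSum (j2 + k2) fun x =>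
              wt h x * gFun h (k2 - j3 + l2 - z2) x * gFun h (j3 + k4 - l3 - z3) x *
                eFun h (j1 + k2 - l1 + z1) x := by
    simp only [← latSum_const_mul, ← latSum_sum]
    refine latSum_congr hs.nonneg fun x _ hsx => ?_
    obtain ⟨m9, e9⟩ := hsx.isZ
    rw [sixPoly_eval_mul_eFun hq (IsZ.isNat ⟨m1 + (-1) * J1, by push_cast; linarith⟩ (by linarith))
      ⟨m9, by linarith⟩ ⟨(-2) * m2 + (2) * m3 + m4 + (2) * m6 + (-2) * m7 + (2) * J2 + (-1) * J4 + (-1) * m9, by push_cast; linarith⟩, lowSum, add_comm j4 j3]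
    exact triple_sum _ _ _ _ _ _ _ _ _ _
  rw [expand]
  simp only [Finset.mul_sum]
  refine Finset.sum_congr rfl fun z1 _ => Finset.sum_congr rfl fun z2 _ =>
    Finset.sum_congr rfl fun z3 _ => ?_
  -- Terms outside these ranges vanish on both sides. Discarding them secures the hypotheses of the
  -- second star sum: its `B` is at most `j₂ + k₂`, and the argument `k₂ + k₄ + l₂ - l₃ - z₂ - z₃`
  -- of its factorial is natural.
  by_cases d1 : l1 - j1 + j2 - z1 < 0
  · rw [sixCoeff, rfact_of_neg h d1]; ring
  by_cases d2 : l2 + k2 - k3 - z2 < 0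
  · rw [lowCoeff, rfact_of_neg h d2]; ring
  by_cases d4 : k4 + k3 - l3 - z3 < 0
  · rw [midCoeff, rfact_of_neg h d4, add_comm k3 k4, rfact_of_neg h d4]; ring
  rw [not_lt] at d1 d2 d4
  rw [latSum_star₂ hq hs (by linarith) ⟨(-1) * m1 + m3 + m5 + (-1) * m8 + J2 + (-1) * J3 + z3, by push_cast; linarith⟩
    (IsZ.isNat ⟨m4 + m6 + (-1) * m7 + (-1) * z2 + (-1) * z3, by push_cast; linarith⟩ (by linarith))
    ⟨(-2) * m1 + m3 + m5 + (-1) * m8 + J1 + J2 + (-1) * J3 + z1 + z3, by push_cast; linarith⟩, sixCoeff, lowCoeff, midCoeff, starVal₂, preFactor₂,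
    sgn_add ((isZ_natCast z1).add (isZ_natCast z2)) (isZ_natCast z3),
    sgn_add (isZ_natCast z1) (isZ_natCast z2),
    show k2 - j3 + l2 - z2 + (j3 + k4 - l3 - z3) = k2 + k4 + l2 - l3 - z2 - z3 by ring,
    show j1 + k2 - l1 + z1 - (k2 - j3 + l2 - z2) = j1 + j3 - l1 - l2 + z1 + z2 by ring,
    show j1 + k2 - l1 + z1 - (j3 + k4 - l3 - z3) = k2 - j3 - l1 + l3 - l4 + z1 + z3 by
      rw [hk]; ring]
  have qe : qpow h ((j1 + k2 - l1 + 1) * (k2 + k4 + l2 - l3 + 1) -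
        (l2 + k2 - j3 + 1) * (j3 - l3 + k4 + 1) + Z [j1, j2, j3, j4] + Z [k1, k2, k3, k4]) =
      qpow h (Z [j1, j2, j3, j4] + Z [k1, k2, k3, k4]) *
        qpow h ((k2 - j3 + l2 - z2) * (j1 + k2 - l1 + z1) -
          (k2 - j3 + l2 - z2) * (j3 + k4 - l3 - z3) +
          (j1 + k2 - l1 + z1) * (j3 + k4 - l3 - z3) + (j1 + k2 - l1 + z1)) /
        (qpow h (z1 * (k2 + k4 + l2 - l3 - z2 - z3 + 1)) *
          qpow h (-z2 * (k2 - j3 - l1 + l3 - l4 + z3) - z3 * (j1 + j3 - l1 - l2))) := by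
    rw [← qpow_add, ← qpow_add, ← qpow_sub]
    congr 1
    rw [hk]; ring
  rw [qe]
  generalize qpow h ((k2 - j3 + l2 - z2) * (j1 + k2 - l1 + z1) - _ + _ + _) = q1
  have Q1 := qpow_ne_zero h (z1 * (k2 + k4 + l2 - l3 - z2 - z3 + 1))
  have Q2 := qpow_ne_zero h (-z2 * (k2 - j3 - l1 + l3 - l4 + z3) - z3 * (j1 + j3 - l1 - l2))
  generalize qpow h (z1 * (k2 + k4 + l2 - l3 - z2 - z3 + 1)) = q2 at Q1 ⊢
  generalize qpow h (-z2 * (k2 - j3 - l1 + l3 - l4 + z3) - z3 * (j1 + j3 - l1 - l2)) = q3 at Q2 ⊢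
  refine eq_of_mul_eq_mul_one (u := 1) (v := (q2 / q2) * (q3 / q3)) rfl
    (by rw [div_self Q1, div_self Q2, one_mul]) ?_
  ring_nf

end QuantumU2

theorem mainTheorem9 (h : ℂ) (hq : Generic h)
    (j1 j2 j3 j4 l1 l2 l3 l4 k1 k2 k3 k4 : ℚ)
    (hadm : Admissible j1 j2 j3 j4 l1 l2 l3 l4 k1 k2 k3 k4) :
    -- stretched, `l₄ = k₄ + j₁`: a triple sum
    (l4 = k4 + j1 →
      twelveJ h j1 j2 j3 j4 l1 l2 l3 l4 k1 k2 k3 k4 =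
        sgn (k1 + k2 - k3 - j2 + j3 + j4 - l4) *
        (nabla h j3 j2 l2 * nabla h k2 k3 l2 * nabla h l4 j4 k1 /
          (nabla h j1 j2 l1 * nabla h k2 k1 l1 * nabla h j3 j4 l3 * nabla h k4 k3 l3)) *
        (sfact h (2 * k4) * sfact h (2 * j1) / sfact h (2 * l4 + 1)) *
        qpow h (-(j1 + k2 - l1 + 1) * (k4 - k2 + l2 - l3) - (l2 - k2 - j3 - 1) * (j3 + k4 - l3)
          + Z [j1, j2, j3, j4] + Z [k1, k2, k3, k4]) *
        ∑ z1 ∈ Finset.range (⌊l1 - j1 + j2⌋₊ + 1),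
        ∑ z2 ∈ Finset.range (⌊j2 + j3 - l2⌋₊ + 1),
        ∑ z3 ∈ Finset.range (⌊l3 - j3 + j4⌋₊ + 1),
          sgn (z1 + z3) * qfact h (j1 + j2 - l1 + z1) * qfact h (k1 + k2 - l1 + z1) *
          qfact h (2 * l1 - z1) *
          rfact h z1 * rfact h z2 * rfact h z3 *
          rfact h (k1 - k2 + l1 - z1) * rfact h (l1 - j1 + j2 - z1) *
          qfact h (l2 + j2 - j3 + z2) * qfact h (l2 + k3 - k2 + z2) *
          rfact h (j2 + j3 - l2 - z2) * rfact h (k2 + k3 - l2 - z2) * rfact h (2 * l2 + z2 + 1) *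
          qfact h (k3 + k4 - l3 + z3) * qfact h (j3 + j4 - l3 + z3) * qfact h (2 * l3 - z3) *
          rfact h (k3 + l3 - k4 - z3) * rfact h (l3 - j3 + j4 - z3) *
          rfact h (j1 - j3 - l1 + l2 + z1 + z2) *
          qpow h (z3 * (l1 - l2 - j1 + j3) - z2 * (j3 + k2 - l1 - l3 + l4 + z3 + 1)
            - z1 * (l2 - l3 - k2 + k4 + z2 + z3)) *
          rfact h (l2 - l3 - k2 + k4 + z2 + z3) *
          rfact h (j3 + k2 - l1 - l3 + l4 + z1 + z3 + 1)) ∧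
    -- stretched, `k₄ = l₄ + j₁`: a triple sum
    (k4 = l4 + j1 →
      twelveJ h j1 j2 j3 j4 l1 l2 l3 l4 k1 k2 k3 k4 =
        sgn (j3 + j4 - l3 + l2 + k2 - k3) *
        (nabla h j3 j4 l3 * nabla h k4 k3 l3 * nabla h k2 k3 l2 /
          (nabla h j1 j2 l1 * nabla h k2 k1 l1 * nabla h j3 j2 l2 * nabla h l4 k1 j4)) *
        (sfact h (2 * j1) * sfact h (2 * l4) / sfact h (2 * k4 + 1)) *
        qpow h ((j1 + k2 - l1 + 1) * (k2 + k4 + l2 - l3 + 1) - (l2 + k2 - j3 + 1) * (j3 - l3 + k4 + 1)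
          + Z [j1, j2, j3, j4] + Z [k1, k2, k3, k4]) *
        ∑ z1 ∈ Finset.range (⌊l1 - j1 + j2⌋₊ + 1),
        ∑ z2 ∈ Finset.range (⌊j2 - j3 + l2⌋₊ + 1),
        ∑ z3 ∈ Finset.range (⌊j3 + j4 - l3⌋₊ + 1),
          qfact h (j1 + j2 - l1 + z1) * qfact h (k1 + k2 - l1 + z1) * qfact h (2 * l1 - z1) *
          rfact h z1 * rfact h z2 * rfact h z3 *
          rfact h (k1 - k2 + l1 - z1) * rfact h (l1 - j1 + j2 - z1) *
          sgn (z1 + z2 + z3) * qfact h (j2 + j3 - l2 + z2) * qfact h (2 * l2 - z2) *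
          rfact h (l2 + k2 - k3 - z2) * rfact h (j2 - j3 + l2 - z2) *
          rfact h (l2 + k2 + k3 - z2 + 1) *
          qpow h (z1 * (k2 + k4 + l2 - l3 - z2 - z3 + 1)) *
          qfact h (k3 - k4 + l3 + z3) * qfact h (j4 - j3 + l3 + z3) *
          rfact h (k3 + k4 - l3 - z3) * rfact h (j3 + j4 - l3 - z3) * rfact h (2 * l3 + z3 + 1) *
          qpow h (-z2 * (k2 - j3 - l1 + l3 - l4 + z3) - z3 * (j1 + j3 - l1 - l2)) *
          qfact h (k2 + k4 + l2 - l3 - z2 - z3) *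
          rfact h (j1 + j3 - l1 - l2 + z1 + z2) *
          rfact h (k2 - j3 - l1 + l3 - l4 + z1 + z3)) ∧
    -- doubly stretched, `k₄ = l₄ + j₁` and `j₁ = l₁ + j₂`: a stretched `9j` coefficient at `q⁻¹`
    (k4 = l4 + j1 → j1 = l1 + j2 →
      twelveJ h j1 j2 j3 j4 l1 l2 l3 l4 k1 k2 k3 k4 =
        sgn (j3 + j4 - l3 + l2 + k2 - k3) *
        qpow h (Z [j1, j2, j3, j4] + Z [k1, k2, k3, k4] + Z [l2, l3, l1 + l4]) *
        (nabla h (l1 + l4) j4 k2 / (nabla h l1 k1 k2 * nabla h l4 k1 j4)) *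
        (sfact h (2 * l1) * sfact h (2 * l4) / (sfact h (2 * l1 + 2 * l4) * qsqrt h (2 * j1 + 1))) *
        nineJ (-h) k4 k3 l3 j2 l2 j3 (l1 + l4) k2 j4) ∧
    -- doubly stretched, `k₄ = l₄ + j₁` and `l₃ = k₃ + k₄`: a stretched `9j` coefficient at `q⁻¹`
    (k4 = l4 + j1 → l3 = k3 + k4 →
      twelveJ h j1 j2 j3 j4 l1 l2 l3 l4 k1 k2 k3 k4 =
        qpow h (Z [j1, j2, j3, j4] + Z [k1, k2, k3, k4] + Z [l2, j1 + k3, l1]) *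
        sgn (j3 + j4 - l4 - l2 - k2 - j2 - l1) *
        (nabla h l3 j3 j4 / (nabla h l4 k1 j4 * nabla h (j1 + k3) j3 k1)) *
        (sfact h (2 * l4) * sfact h (2 * j1 + 2 * k3 + 1) /
          (sfact h (2 * l3 + 1) * qsqrt h (2 * k4 + 1))) *
        nineJ (-h) j1 k3 (j1 + k3) j2 l2 j3 l1 k2 k1) ∧
    -- doubly stretched, `l₁ = j₁ + j₂` and `k₂ = k₁ + l₁`: a `6j` coefficient
    (l1 = j1 + j2 → k2 = k1 + l1 →
      twelveJ h j1 j2 j3 j4 l1 l2 l3 l4 k1 k2 k3 k4 =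
        sgn (k1 + j3 - l3 - l4 + 2 * k3) *
        (qpow h (2 * j1 * k1 + Z [j2, j3, j4] + Z [k2, k3, k4]) *
          nabla h k2 k3 l2 * nabla h (k1 + j1) j4 k4 /
          (nabla h j1 k4 l4 * nabla h j2 l2 j3 * nabla h k1 j4 l4 * nabla h (k1 + j1) j3 k3)) *
        (sfact h (2 * j2) * sfact h (2 * j1) * sfact h (2 * k1) /
          (sfact h (2 * k2 + 1) * qsqrt h (2 * l1 + 1))) *
        sixJ h j3 j4 l3 k4 k3 (k1 + j1)) ∧
    -- virtually stretched, `j₃ = j₁ + k₁ + k₃`: a product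
    (j3 = j1 + k1 + k3 →
      twelveJ h j1 j2 j3 j4 l1 l2 l3 l4 k1 k2 k3 k4 =
        sgn (j2 + j4 - l1 - k1 - j1 - l4) *
        (qpow h (2 * j1 * k1 + Z [j2, j3, j4] + Z [k2, k3, k4]) *
          qfact h (2 * j1) * qfact h (2 * k1) * qfact h (2 * k3) *
          nabla h j3 j4 l3 * nabla h j3 j2 l2 /
          (qfact h (2 * j3 + 1) * nabla h j1 j2 l1 * nabla h k1 k2 l1 * nabla h j1 k4 l4 *
            nabla h k1 j4 l4 * nabla h k3 k2 l2 * nabla h k3 k4 l3))) := by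
  refine ⟨fun e => twelveJ_stretched_l4 hq hadm e,
    fun e => twelveJ_stretched_k4 hq hadm e,
    fun e e1 => twelveJ_stretched_nineJ₁ hq hadm e e1, fun e e1 => twelveJ_stretched_nineJ₂ hq hadm e e1,
    fun e e1 => twelveJ_stretched_sixJ hq hadm e e1, fun e => twelveJ_virtually_stretched hq hadm e⟩
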